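/- Let $V$ be an $n$-dimensional smooth Riemannian orbifold ($n\ge 0$) on a second countable Hausdorff space $|V|$, given by charts $(U_i,h_i,\Gamma_i,q_i)$: $U_i\subset\mathbb R^n$ is open and connected with a smooth Riemannian metric $h_i$, $\Gamma_i$ is a finite group of isometries of $(U_i,h_i)$, $q_i:U_i\to|V|$ is a continuous open map inducing a homeomorphism of $U_i/\Gamma_i$ onto an open set $V_i$, the $V_i$ cover $|V|$, and whenever $q_i(x)=q_j(y)$ there are connected open neighbourhoods $W_i\ni x$, $W_j\ni y$ in $U_i$, $U_j$ and an isometry (change of charts) $\phi:W_i\to W_j$ with $q_j\phi=q_i$ on $W_i$. A function $f:|V|\to\mathbb R$ is smooth if every point lies in some $V_i$ such that $f q_i$ is smooth. $\mathcal D^k(V)$ is the space of linear endomorphisms $D$ of $C^\infty(V)$ such that on every $U_i$ one has $(Df)q_i=\sum_{|\alpha|\le k}D_\alpha\,\partial^\alpha(fq_i)$ for all $f$, with coefficients $D_\alpha\in C^\infty(U_i)$; $\mathcal D(V)=\bigcup_k\mathcal D^k(V)$ with the commutator bracket, $\mathcal S^k(V)=\mathcal D^k(V)/\mathcal D^{k-1}(V)$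 (with $\mathcal D^{-1}=0$), and $\mathrm{Vect}(V)=\mathcal S^1(V)$ with the bracket induced by the commutator. Let $\tilde V$ be the manifold obtained from the orthonormal frame bundles $\tilde U_i$ of $(U_i,h_i)$ by identifying frames that correspond to each other under the lift $(x,u)\mapsto(\phi x,\phi_*u)$ of a change of charts $\phi$ (this includes the elements of $\Gamma_i$), let $p:\tilde V\to V$ be the projection induced by $(x,u)\mapsto q_i(x)$, and let $\mathcal F$ be the foliation of $\tilde V$, of codimension $n$, whose leaves are the fibres of $p$, i.e. the orbits of $O(n)$ (a leaf need not be connected). $C^\infty(\tilde V,\mathcal F)$ is the algebra of smooth functions on $\tilde V$ that are constant along each leaf. Adapted coordinates $(x,y)$ are smooth charts of $\tilde V$ onto a product $A\times B$ of open subsets of $\mathbb R^{n(n-1)/2}$ and $\mathbb R^n$, $A$ connected, such that each plaque $y=\mathrm{const}$ lies in a leaf. $\mathcal D^k(\tilde V,\mathcal F)$ is the space of linear endomorphisms $D$ of $C^\infty(\tilde V,\mathcal F)$ that in all adapted coordinates read $D=\sum_{|\alpha|\le k}D_\alpha\,\partial_y^\alpha$ with smooth coefficients $D_\alpha=D_\alpha(y)$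 depending on $y$ only; $\mathcal D(\tilde V,\mathcal F)$ and $\mathcal S^k(\tilde V,\mathcal F)$ are defined as above. $\Gamma(T\mathcal F)$ is the space of vector fields on $\tilde V$ tangent to the leaves, $\mathrm{Vect}_{\mathcal F}(\tilde V)$ is the Lie algebra of the vector fields $X$ on $\tilde V$ with $[X,\Gamma(T\mathcal F)]\subset\Gamma(T\mathcal F)$ and $X\,C^\infty(\tilde V,\mathcal F)\subset C^\infty(\tilde V,\mathcal F)$, and $\mathrm{Vect}(\tilde V,\mathcal F)=\mathrm{Vect}_{\mathcal F}(\tilde V)/\Gamma(T\mathcal F)$. Proposition. The map $p^*:C^\infty(V)\to C^\infty(\tilde V,\mathcal F)$, $f\mapsto f\circ p$, is an isomorphism of algebras. For each $k\ge 0$, conjugation $$p^*_{\mathcal D}:\mathcal D^k(V)\to\mathcal D^k(\tilde V,\mathcal F),\qquad D\mapsto p^*\circ D\circ (p^*)^{-1},$$ is a well-defined linear isomorphism, and it is a Lie algebra isomorphism $\mathcal D(V)\cong\mathcal D(\tilde V,\mathcal F)$. Consequently $[D]\mapsto[p^*_{\mathcal D}D]$ is a well-defined linear isomorphism $p^*_{\mathcal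 S}:\mathcal S^k(V)\cong\mathcal S^k(\tilde V,\mathcal F)$ for each $k\ge 0$, and its restriction to $\mathcal S^1(V)$ gives a Lie algebra isomorphism $p^*_{\mathrm{Vect}}:\mathrm{Vect}(V)\cong\mathrm{Vect}(\tilde V,\mathcal F)$: for $D\in\mathcal D^1(V)$ and $Y\in\mathrm{Vect}_{\mathcal F}(\tilde V)$ one has $p^*_{\mathrm{Vect}}[D]=[Y]$ if and only if the action of $Y$ on $C^\infty(\tilde V,\mathcal F)$ belongs to $\mathcal D^1(\tilde V,\mathcal F)$ and has symbol $p^*_{\mathcal S}[D]$ in $\mathcal S^1(\tilde V,\mathcal F)$. -/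

import Mathlib

open scoped ContDiff Topology

attribute [local instance 100] LieRing.ofAssociativeRing

/-- The Euclidean space `ℝⁿ`. -/
abbrev Euc (n : ℕ) : Type := EuclideanSpace ℝ (Fin n)

/-! ### Partial derivatives and operators in local form -/

section LocalForm

variable {n : ℕ}

/-- The partial derivative `∂_j f`. -/
noncomputable def partialDeriv (j : Fin n) (f : Euc n → ℝ) : Euc n → ℝ :=
  fun x => fderiv ℝ f x (EuclideanSpace.single j 1)

/-- The iterated partial derivative `∂^α f = ∂_1^{α_1} ⋯ ∂_n^{α_n} f`. -/
noncomputable def multiDeriv (α : Fin n → ℕ) (f : Euc n → ℝ) : Euc n → ℝ :=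
  (List.finRange n).foldr (fun j g => (partialDeriv j)^[α j] g) f

/-- The finite set of multi-indices `α` with `|α| ≤ k`. -/
def multiIndices (n k : ℕ) : Finset (Fin n → ℕ) :=
  (Fintype.piFinset fun _ : Fin n => Finset.range (k + 1)).filter fun α => ∑ j, α j ≤ k

/-- `F t ↦ G t` is, uniformly in the parameter `t`, given on the set `B` by a differential
operator `∑_{|α| ≤ k} c_α ∂^α` of order `k` with coefficients `c_α` smooth on `B`. -/
def HasLocalForm {T : Type*} (k : ℕ) (B : Set (Euc n)) (F G : T → Euc n → ℝ) : Prop :=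
  ∃ c : (Fin n → ℕ) → Euc n → ℝ, (∀ α, ContDiffOn ℝ ∞ (c α) B) ∧
    ∀ t, ∀ x ∈ B, G t x = ∑ α ∈ multiIndices n k, c α x * multiDeriv α (F t) x

theorem mem_multiIndices {k : ℕ} {α : Fin n → ℕ} : α ∈ multiIndices n k ↔ ∑ j, α j ≤ k := by
  simp only [multiIndices, Finset.mem_filter, Fintype.mem_piFinset, Finset.mem_range,
    and_iff_right_iff_imp]
  intro h j
  have := Finset.single_le_sum (f := α) (fun i _ => Nat.zero_le _) (Finset.mem_univ j)
  omega

theorem partialDeriv_contDiffOn {B : Set (Euc n)} (hB : IsOpen B) {f : Euc n → ℝ}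
    (hf : ContDiffOn ℝ ∞ f B) (j : Fin n) : ContDiffOn ℝ ∞ (partialDeriv j f) B := by
  have h : ContDiffOn ℝ ∞ (fderiv ℝ f) B := hf.fderiv_of_isOpen hB (by simp)
  exact h.clm_apply contDiffOn_const

theorem partialDeriv_congr {B : Set (Euc n)} (hB : IsOpen B) {f g : Euc n → ℝ}
    (h : Set.EqOn f g B) (j : Fin n) : Set.EqOn (partialDeriv j f) (partialDeriv j g) B := by
  intro x hx
  have : f =ᶠ[𝓝 x] g := Filter.eventuallyEq_of_mem (hB.mem_nhds hx) h
  simp only [partialDeriv, this.fderiv_eq]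

theorem partialDeriv_comm {B : Set (Euc n)} (hB : IsOpen B) {f : Euc n → ℝ}
    (hf : ContDiffOn ℝ ∞ f B) (i j : Fin n) :
    Set.EqOn (partialDeriv i (partialDeriv j f)) (partialDeriv j (partialDeriv i f)) B := by
  intro x hx
  have hfx : ContDiffAt ℝ ∞ f x := hf.contDiffAt (hB.mem_nhds hx)
  have hs : IsSymmSndFDerivAt ℝ f x := hfx.isSymmSndFDerivAt (by
    rw [minSmoothness_of_isRCLikeNormedField]; exact (WithTop.coe_le_coe.2 le_top : ((2 : ℕ∞) : WithTop ℕ∞) ≤ ∞))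
  have hd : DifferentiableAt ℝ (fderiv ℝ f) x :=
    (hfx.fderiv_right (m := ∞) (by simp)).differentiableAt (by simp)
  have key : ∀ v w : Euc n, fderiv ℝ (fun y => fderiv ℝ f y v) x w
      = fderiv ℝ (fderiv ℝ f) x w v := by
    intro v w
    rw [fderiv_clm_apply hd (differentiableAt_const v)]
    simp
  simp only [partialDeriv]
  unfold partialDeriv
  rw [key, key]
  exact hs _ _

theorem iterate_contDiffOn {B : Set (Euc n)} (hB : IsOpen B) (j : Fin n) (m : ℕ)
    {f : Euc n → ℝ} (hf : ContDiffOn ℝ ∞ f B) :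
    ContDiffOn ℝ ∞ ((partialDeriv j)^[m] f) B := by
  induction m with
  | zero => simpa using hf
  | succ m ih =>
    rw [Function.iterate_succ_apply']
    exact partialDeriv_contDiffOn hB ih j

theorem foldr_contDiffOn {B : Set (Euc n)} (hB : IsOpen B) (α : Fin n → ℕ) (l : List (Fin n))
    {f : Euc n → ℝ} (hf : ContDiffOn ℝ ∞ f B) :
    ContDiffOn ℝ ∞ (l.foldr (fun j g => (partialDeriv j)^[α j] g) f) B := by
  induction l with
  | nil => simpa using hf
  | cons a l ih => exact iterate_contDiffOn hB a (α a) ih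

theorem multiDeriv_contDiffOn {B : Set (Euc n)} (hB : IsOpen B) (α : Fin n → ℕ)
    {f : Euc n → ℝ} (hf : ContDiffOn ℝ ∞ f B) : ContDiffOn ℝ ∞ (multiDeriv α f) B :=
  foldr_contDiffOn hB α _ hf

theorem iterate_congr {B : Set (Euc n)} (hB : IsOpen B) (j : Fin n) (m : ℕ)
    {f g : Euc n → ℝ} (h : Set.EqOn f g B) :
    Set.EqOn ((partialDeriv j)^[m] f) ((partialDeriv j)^[m] g) B := by
  induction m with
  | zero => simpa using h
  | succ m ih =>
    rw [Function.iterate_succ_apply', Function.iterate_succ_apply']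
    exact partialDeriv_congr hB ih j

theorem foldr_congr {B : Set (Euc n)} (hB : IsOpen B) (α : Fin n → ℕ) (l : List (Fin n))
    {f g : Euc n → ℝ} (h : Set.EqOn f g B) :
    Set.EqOn (l.foldr (fun j u => (partialDeriv j)^[α j] u) f)
      (l.foldr (fun j u => (partialDeriv j)^[α j] u) g) B := by
  induction l with
  | nil => simpa using h
  | cons a l ih => exact iterate_congr hB a (α a) ih

theorem multiDeriv_congr {B : Set (Euc n)} (hB : IsOpen B) (α : Fin n → ℕ)
    {f g : Euc n → ℝ} (h : Set.EqOn f g B) : Set.EqOn (multiDeriv α f) (multiDeriv α g) B :=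
  foldr_congr hB α _ h

theorem iterate_comm {B : Set (Euc n)} (hB : IsOpen B) (i j : Fin n) (m : ℕ)
    {f : Euc n → ℝ} (hf : ContDiffOn ℝ ∞ f B) :
    Set.EqOn (partialDeriv i ((partialDeriv j)^[m] f)) ((partialDeriv j)^[m] (partialDeriv i f))
      B := by
  induction m with
  | zero => intro x _; rfl
  | succ m ih =>
    rw [Function.iterate_succ_apply', Function.iterate_succ_apply']
    exact (partialDeriv_comm hB (iterate_contDiffOn hB j m hf) i j).trans
      (partialDeriv_congr hB ih j)

theorem foldr_update_of_notMem (α : Fin n → ℕ) (i : Fin n) (m : ℕ) (l : List (Fin n))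
    (hi : i ∉ l) (f : Euc n → ℝ) :
    l.foldr (fun j g => (partialDeriv j)^[Function.update α i m j] g) f
      = l.foldr (fun j g => (partialDeriv j)^[α j] g) f := by
  induction l with
  | nil => rfl
  | cons a l ih =>
    simp only [List.mem_cons, not_or] at hi
    simp only [List.foldr_cons, ih hi.2, Function.update_of_ne (Ne.symm hi.1)]

theorem partialDeriv_foldr {B : Set (Euc n)} (hB : IsOpen B) (α : Fin n → ℕ) (i : Fin n)
    (l : List (Fin n)) (hl : l.Nodup) (hi : i ∈ l) {f : Euc n → ℝ} (hf : ContDiffOn ℝ ∞ f B) :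
    Set.EqOn (partialDeriv i (l.foldr (fun j g => (partialDeriv j)^[α j] g) f))
      (l.foldr (fun j g => (partialDeriv j)^[Function.update α i (α i + 1) j] g) f) B := by
  induction l with
  | nil => simp at hi
  | cons a l ih =>
    rw [List.nodup_cons] at hl
    by_cases hia : i = a
    · subst hia
      rw [List.foldr_cons, List.foldr_cons, foldr_update_of_notMem _ _ _ _ hl.1,
        Function.update_self, Function.iterate_succ_apply']
      exact fun x _ => rfl
    · have hil : i ∈ l := by simpa [hia] using hi
      rw [List.foldr_cons, List.foldr_cons, Function.update_of_ne (Ne.symm hia)]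
      exact (iterate_comm hB i a (α a) (foldr_contDiffOn hB α l hf)).trans
        (iterate_congr hB a (α a) (ih hl.2 hil))

theorem partialDeriv_multiDeriv {B : Set (Euc n)} (hB : IsOpen B) (α : Fin n → ℕ) (i : Fin n)
    {f : Euc n → ℝ} (hf : ContDiffOn ℝ ∞ f B) :
    Set.EqOn (partialDeriv i (multiDeriv α f))
      (multiDeriv (Function.update α i (α i + 1)) f) B :=
  partialDeriv_foldr hB α i _ (List.nodup_finRange n) (List.mem_finRange i) hf

theorem multiDeriv_zero (f : Euc n → ℝ) : multiDeriv (0 : Fin n → ℕ) f = f := by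
  unfold multiDeriv
  generalize List.finRange n = l
  induction l with
  | nil => rfl
  | cons a l ih => simpa using ih

namespace HasLocalForm

variable {T : Type*} {k l : ℕ} {B : Set (Euc n)} {F G H : T → Euc n → ℝ}

theorem mono (h : HasLocalForm k B F G) (hkl : k ≤ l) : HasLocalForm l B F G := by
  obtain ⟨c, hc, hG⟩ := h
  classical
  refine ⟨fun α => if ∑ j, α j ≤ k then c α else 0, fun α => ?_, fun t x hx => ?_⟩
  · dsimp only
    split_ifs
    · exact hc α
    · exact contDiffOn_const
  · rw [hG t x hx]
    have hsub : multiIndices n k ⊆ multiIndices n l := fun α hα =>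
      mem_multiIndices.2 ((mem_multiIndices.1 hα).trans hkl)
    rw [← Finset.sum_subset hsub]
    · refine Finset.sum_congr rfl fun α hα => ?_
      simp only [if_pos (mem_multiIndices.1 hα)]
    · intro α _ hα
      simp only [if_neg (fun h => hα (mem_multiIndices.2 h))]
      simp

theorem reindex {T' : Type*} (h : HasLocalForm k B F G) (e : T' → T) :
    HasLocalForm k B (fun t => F (e t)) (fun t => G (e t)) := by
  obtain ⟨c, hc, hG⟩ := h
  exact ⟨c, hc, fun t => hG (e t)⟩

theorem congr_right (h : HasLocalForm k B F G) (hGH : ∀ t, Set.EqOn (H t) (G t) B) :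
    HasLocalForm k B F H := by
  obtain ⟨c, hc, hG⟩ := h
  exact ⟨c, hc, fun t x hx => (hGH t hx).trans (hG t x hx)⟩

theorem zero : HasLocalForm k B F (fun _ => 0) :=
  ⟨fun _ => 0, fun _ => contDiffOn_const, fun t x _ => by simp⟩

theorem add (h : HasLocalForm k B F G) (h' : HasLocalForm k B F H) :
    HasLocalForm k B F (fun t => G t + H t) := by
  obtain ⟨c, hc, hG⟩ := h
  obtain ⟨d, hd, hH⟩ := h'
  refine ⟨fun α => c α + d α, fun α => (hc α).add (hd α), fun t x hx => ?_⟩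
  simp only [Pi.add_apply, hG t x hx, hH t x hx, add_mul, Finset.sum_add_distrib]

theorem mul_left (h : HasLocalForm k B F G) {a : Euc n → ℝ} (ha : ContDiffOn ℝ ∞ a B) :
    HasLocalForm k B F (fun t => a * G t) := by
  obtain ⟨c, hc, hG⟩ := h
  refine ⟨fun α => a * c α, fun α => ha.mul (hc α), fun t x hx => ?_⟩
  simp only [Pi.mul_apply, hG t x hx, Finset.mul_sum, mul_assoc]

theorem sum {ι : Type*} (s : Finset ι) {G : ι → T → Euc n → ℝ}
    (h : ∀ i ∈ s, HasLocalForm k B F (G i)) : HasLocalForm k B F (fun t => ∑ i ∈ s, G i t) := by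
  classical
  induction s using Finset.induction_on with
  | empty => simpa using (zero : HasLocalForm k B F _)
  | insert a s ha ih =>
    have h1 := (h a (Finset.mem_insert_self a s)).add
      (ih fun i hi => h i (Finset.mem_insert_of_mem hi))
    refine h1.congr_right fun t x _ => ?_
    rw [Finset.sum_insert ha]

theorem multiDeriv_self {α : Fin n → ℕ} (hα : ∑ j, α j ≤ k) :
    HasLocalForm k B F (fun t => multiDeriv α (F t)) := by
  classical
  refine ⟨fun β => if β = α then 1 else 0, fun β => ?_, fun t x _ => ?_⟩
  · dsimp only
    split_ifs <;> exact contDiffOn_const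
  · rw [Finset.sum_eq_single α]
    · simp
    · intro β _ hβ
      simp [hβ]
    · intro h
      exact absurd (mem_multiIndices.2 hα) h

theorem partialDeriv (hB : IsOpen B) (hF : ∀ t, ContDiffOn ℝ ∞ (F t) B)
    (h : HasLocalForm k B F G) (j : Fin n) :
    HasLocalForm (k + 1) B F (fun t => _root_.partialDeriv j (G t)) := by
  obtain ⟨c, hc, hG⟩ := h
  have h1 : HasLocalForm (k + 1) B F (fun t => ∑ α ∈ multiIndices n k,
      (_root_.partialDeriv j (c α) * multiDeriv α (F t)
        + c α * multiDeriv (Function.update α j (α j + 1)) (F t))) := by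
    refine HasLocalForm.sum _ fun α hα => HasLocalForm.add ?_ ?_
    · exact (multiDeriv_self ((mem_multiIndices.1 hα).trans (Nat.le_succ k))).mul_left
        (partialDeriv_contDiffOn hB (hc α) j)
    · refine (multiDeriv_self ?_).mul_left (hc α)
      have := mem_multiIndices.1 hα
      rw [Finset.sum_update_of_mem (Finset.mem_univ j)]
      rw [← Finset.add_sum_erase _ _ (Finset.mem_univ j)] at this
      rw [← Finset.erase_eq]
      omega
  refine h1.congr_right fun t x hx => ?_
  have e1 : Set.EqOn (G t) (fun y => ∑ α ∈ multiIndices n k, c α y * multiDeriv α (F t) y) B :=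
    fun y hy => hG t y hy
  rw [partialDeriv_congr hB e1 j hx]
  have hda : ∀ α, DifferentiableAt ℝ (c α) x := fun α =>
    ((hc α).contDiffAt (hB.mem_nhds hx)).differentiableAt (by simp)
  have hdm : ∀ α, DifferentiableAt ℝ (multiDeriv α (F t)) x := fun α =>
    ((multiDeriv_contDiffOn hB α (hF t)).contDiffAt (hB.mem_nhds hx)).differentiableAt (by simp)
  simp only [Finset.sum_apply, Pi.add_apply, Pi.mul_apply]
  conv_lhs => unfold _root_.partialDeriv
  rw [fderiv_fun_sum fun α _ => (hda α).fun_mul (hdm α), sum_apply]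
  refine Finset.sum_congr rfl fun α _ => ?_
  rw [fderiv_fun_mul (hda α) (hdm α)]
  have e2 := partialDeriv_multiDeriv hB α j (hF t) hx
  rw [← e2]
  simp only [_root_.partialDeriv, add_apply, smul_apply,
    smul_eq_mul]
  ring

theorem smooth_right (hB : IsOpen B) (hF : ∀ t, ContDiffOn ℝ ∞ (F t) B)
    (h : HasLocalForm k B F G) (t : T) : ContDiffOn ℝ ∞ (G t) B := by
  obtain ⟨c, hc, hG⟩ := h
  refine ContDiffOn.congr ?_ (fun x hx => hG t x hx)
  exact ContDiffOn.sum fun α _ => (hc α).mul (multiDeriv_contDiffOn hB α (hF t))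

theorem iterate (hB : IsOpen B) (hF : ∀ t, ContDiffOn ℝ ∞ (F t) B)
    (h : HasLocalForm k B F G) (j : Fin n) (m : ℕ) :
    HasLocalForm (k + m) B F (fun t => (_root_.partialDeriv j)^[m] (G t)) := by
  induction m with
  | zero => simpa using h
  | succ m ih =>
    simp only [Function.iterate_succ_apply']
    exact ih.partialDeriv hB hF j

theorem multiDeriv (hB : IsOpen B) (hF : ∀ t, ContDiffOn ℝ ∞ (F t) B)
    (h : HasLocalForm k B F G) (α : Fin n → ℕ) :
    HasLocalForm (k + ∑ j, α j) B F (fun t => _root_.multiDeriv α (G t)) := by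
  have key : ∀ l : List (Fin n), HasLocalForm (k + (l.map α).sum) B F
      (fun t => l.foldr (fun j g => (_root_.partialDeriv j)^[α j] g) (G t)) := by
    intro l
    induction l with
    | nil => simpa using h
    | cons a l ih =>
      have := ih.iterate hB hF a (α a)
      rw [List.map_cons, List.sum_cons, add_comm (α a), ← add_assoc]
      exact this
  have := key (List.finRange n)
  rwa [← List.ofFn_eq_map, List.sum_ofFn] at this

theorem comp (hB : IsOpen B) (hF : ∀ t, ContDiffOn ℝ ∞ (F t) B)
    (h : HasLocalForm k B F G) (h' : HasLocalForm l B G H) : HasLocalForm (k + l) B F H := by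
  obtain ⟨c, hc, hH⟩ := h'
  have h1 : HasLocalForm (k + l) B F (fun t => ∑ α ∈ multiIndices n l,
      c α * _root_.multiDeriv α (G t)) := by
    refine HasLocalForm.sum _ fun α hα => ?_
    exact ((h.multiDeriv hB hF α).mono
      (Nat.add_le_add_left (mem_multiIndices.1 hα) k)).mul_left (hc α)
  refine h1.congr_right fun t x hx => ?_
  rw [hH t x hx]
  simp

theorem exists_of_zero (h : HasLocalForm 0 B F G) :
    ∃ a : Euc n → ℝ, ContDiffOn ℝ ∞ a B ∧ ∀ t, ∀ x ∈ B, G t x = a x * F t x := by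
  obtain ⟨c, hc, hG⟩ := h
  refine ⟨c 0, hc 0, fun t x hx => ?_⟩
  have : multiIndices n 0 = {0} := by
    ext α
    rw [mem_multiIndices, Finset.mem_singleton, Nat.le_zero, Finset.sum_eq_zero_iff]
    exact ⟨fun h => funext fun j => h j (Finset.mem_univ j), fun h j _ => by rw [h]; rfl⟩
  rw [hG t x hx, this, Finset.sum_singleton, multiDeriv_zero]

theorem of_zero {a : Euc n → ℝ} (ha : ContDiffOn ℝ ∞ a B)
    (h : ∀ t, ∀ x ∈ B, G t x = a x * F t x) : HasLocalForm k B F G := by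
  have h0 : HasLocalForm k B F (fun t => _root_.multiDeriv 0 (F t)) :=
    multiDeriv_self (by simp)
  refine (h0.mul_left ha).congr_right fun t x hx => ?_
  rw [h t x hx, multiDeriv_zero]
  rfl

theorem multiDeriv_single (j : Fin n) (f : Euc n → ℝ) :
    _root_.multiDeriv (Pi.single j 1) f = _root_.partialDeriv j f := by
  have key : ∀ l : List (Fin n), l.Nodup →
      l.foldr (fun i g => (_root_.partialDeriv i)^[(Pi.single j 1 : Fin n → ℕ) i] g) f
        = if j ∈ l then _root_.partialDeriv j f else f := by
    intro l hl
    induction l with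
    | nil => simp
    | cons a l ih =>
      rw [List.nodup_cons] at hl
      rw [List.foldr_cons, ih hl.2]
      by_cases h : j = a
      · subst h
        simp [hl.1]
      · simp [h, Ne.symm h]
  have := key (List.finRange n) (List.nodup_finRange n)
  simpa [_root_.multiDeriv] using this

theorem exists_of_one (h : HasLocalForm 1 B F G) :
    ∃ (a : Euc n → ℝ) (ξ : Euc n → Euc n), ContDiffOn ℝ ∞ a B ∧ ContDiffOn ℝ ∞ ξ B ∧
      ∀ t, ∀ x ∈ B, G t x = a x * F t x + fderiv ℝ (F t) x (ξ x) := by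
  obtain ⟨c, hc, hG⟩ := h
  refine ⟨c 0, fun x => ∑ j, c (Pi.single j 1) x • EuclideanSpace.single j 1, hc 0,
    ContDiffOn.sum fun j _ => (hc _).smul contDiffOn_const, fun t x hx => ?_⟩
  have hset : multiIndices n 1
      = insert 0 (Finset.univ.image fun j : Fin n => (Pi.single j 1 : Fin n → ℕ)) := by
    ext α
    simp only [mem_multiIndices, Finset.mem_insert, Finset.mem_image, Finset.mem_univ, true_and]
    constructor
    · intro h
      by_cases h0 : α = 0
      · exact Or.inl h0
      · right
        obtain ⟨j, hj⟩ : ∃ j, α j ≠ 0 := by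
          by_contra hcon
          push Not at hcon
          exact h0 (funext hcon)
        refine ⟨j, funext fun i => ?_⟩
        rw [← Finset.add_sum_erase _ _ (Finset.mem_univ j)] at h
        by_cases hij : i = j
        · subst hij
          rw [Pi.single_eq_same]
          omega
        · rw [Pi.single_eq_of_ne hij]
          have := Finset.single_le_sum (f := α) (fun i _ => Nat.zero_le _)
            (Finset.mem_erase.2 ⟨hij, Finset.mem_univ i⟩)
          omega
    · rintro (h | ⟨j, rfl⟩)
      · subst h; simp
      · simp
  have hinj : Function.Injective fun j : Fin n => (Pi.single j 1 : Fin n → ℕ) := by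
    intro i j hij
    by_contra hne
    have := congrFun hij i
    simp [Pi.single_eq_of_ne hne] at this
  rw [hG t x hx, hset, Finset.sum_insert, Finset.sum_image fun a _ b _ h => hinj h,
    multiDeriv_zero, map_sum]
  · congr 1
    refine Finset.sum_congr rfl fun j _ => ?_
    rw [multiDeriv_single, map_smul, smul_eq_mul, _root_.partialDeriv]
  · simp only [Finset.mem_image, Finset.mem_univ, true_and, not_exists]
    intro j hj
    have := congrFun hj j
    simp at this

theorem of_one {a : Euc n → ℝ} {ξ : Euc n → Euc n} (ha : ContDiffOn ℝ ∞ a B)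
    (hξ : ContDiffOn ℝ ∞ ξ B)
    (h : ∀ t, ∀ x ∈ B, G t x = a x * F t x + fderiv ℝ (F t) x (ξ x)) :
    HasLocalForm 1 B F G := by
  have h1 : HasLocalForm 1 B F (fun t => a * _root_.multiDeriv 0 (F t)
      + ∑ j, (fun x => ξ x j) * _root_.multiDeriv (Pi.single j 1) (F t)) := by
    refine HasLocalForm.add ((multiDeriv_self (by simp)).mul_left ha)
      (HasLocalForm.sum _ fun j _ => (multiDeriv_self (by simp)).mul_left ?_)
    exact (contDiffOn_euclidean.1 hξ) j
  refine h1.congr_right fun t x hx => ?_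
  rw [h t x hx, multiDeriv_zero]
  simp only [Pi.add_apply, Pi.mul_apply, Finset.sum_apply, multiDeriv_single]
  congr 1
  have hξx : ξ x = ∑ j, ξ x j • EuclideanSpace.single j (1 : ℝ) := by
    ext i
    simp [Pi.single_apply]
  conv_lhs => rw [hξx]
  simp [_root_.partialDeriv]

end HasLocalForm

/-- The commutator of two first order operators is again of first order, with explicit
coefficients. -/
theorem first_order_commutator {W : Type*} [NormedAddCommGroup W] [NormedSpace ℝ W] {B : Set W}
    (hB : IsOpen B) {a b f : W → ℝ} {ξ η : W → W} (ha : ContDiffOn ℝ ∞ a B)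
    (hb : ContDiffOn ℝ ∞ b B) (hξ : ContDiffOn ℝ ∞ ξ B) (hη : ContDiffOn ℝ ∞ η B)
    (hf : ContDiffOn ℝ ∞ f B) {u v : W → ℝ}
    (hu : ∀ x ∈ B, u x = a x * f x + fderiv ℝ f x (ξ x))
    (hv : ∀ x ∈ B, v x = b x * f x + fderiv ℝ f x (η x)) {x : W} (hx : x ∈ B) :
    (a x * v x + fderiv ℝ v x (ξ x)) - (b x * u x + fderiv ℝ u x (η x))
      = (fderiv ℝ b x (ξ x) - fderiv ℝ a x (η x)) * f x
        + fderiv ℝ f x (fderiv ℝ η x (ξ x) - fderiv ℝ ξ x (η x)) := by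
  have hn := hB.mem_nhds hx
  have diff : ∀ {g : W → ℝ}, ContDiffOn ℝ ∞ g B → DifferentiableAt ℝ g x := fun hg =>
    (hg.contDiffAt hn).differentiableAt (by simp)
  have diff' : ∀ {g : W → W}, ContDiffOn ℝ ∞ g B → DifferentiableAt ℝ g x := fun hg =>
    (hg.contDiffAt hn).differentiableAt (by simp)
  have hfx : ContDiffAt ℝ ∞ f x := hf.contDiffAt hn
  have hs : IsSymmSndFDerivAt ℝ f x := hfx.isSymmSndFDerivAt (by
    rw [minSmoothness_of_isRCLikeNormedField]; exact (WithTop.coe_le_coe.2 le_top : ((2 : ℕ∞) : WithTop ℕ∞) ≤ ∞))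
  have hd : DifferentiableAt ℝ (fderiv ℝ f) x :=
    (hfx.fderiv_right (m := ∞) (by simp)).differentiableAt (by simp)
  have hfd := diff hf
  have key : ∀ {c w : W → ℝ} {ζ : W → W}, DifferentiableAt ℝ c x → DifferentiableAt ℝ ζ x →
      (∀ y ∈ B, w y = c y * f y + fderiv ℝ f y (ζ y)) → ∀ z,
      fderiv ℝ w x z = c x * fderiv ℝ f x z + f x * fderiv ℝ c x z
        + (fderiv ℝ (fderiv ℝ f) x z (ζ x) + fderiv ℝ f x (fderiv ℝ ζ x z)) := by
    intro c w ζ hc hζ hw z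
    have e : w =ᶠ[𝓝 x] fun y => c y * f y + fderiv ℝ f y (ζ y) :=
      Filter.eventuallyEq_of_mem hn hw
    rw [e.fderiv_eq, fderiv_fun_add (hc.fun_mul hfd) (hd.clm_apply hζ), fderiv_fun_mul hc hfd,
      fderiv_clm_apply hd hζ]
    simp
    ring
  rw [key (diff hb) (diff' hη) hv, key (diff ha) (diff' hξ) hu, hu x hx, hv x hx, map_sub,
    hs.eq (ξ x) (η x)]
  ring

end LocalForm

/-! ### Riemannian orbifolds -/

section Orbifold

/-- A smooth isometry `φ` from the open set `φ.source` with the metric `h` onto the open set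
`φ.target` with the metric `h'`. -/
structure IsRiemannianIsometry {n : ℕ} (h h' : Euc n → Euc n →L[ℝ] Euc n →L[ℝ] ℝ)
    (φ : OpenPartialHomeomorph (Euc n) (Euc n)) : Prop where
  contDiffOn : ContDiffOn ℝ ∞ φ φ.source
  contDiffOn_symm : ContDiffOn ℝ ∞ φ.symm φ.target
  metric : ∀ x ∈ φ.source, ∀ v w, h' (φ x) (fderiv ℝ φ x v) (fderiv ℝ φ x w) = h x v w

/-- An `n`-dimensional smooth Riemannian orbifold structure on the topological space `X`
(Hausdorff and second countable in the applications), with charts indexed by `ι`.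
The open cover is `V_i = q_i(U_i)`; only the values of `q_i` and of `h_i` on `U_i` matter. -/
structure RiemannianOrbifold (n : ℕ) (X : Type*) [TopologicalSpace X] (ι : Type*) where
  /-- the chart domains `U_i ⊆ ℝⁿ` -/
  U : ι → Set (Euc n)
  isOpen_U : ∀ i, IsOpen (U i)
  isConnected_U : ∀ i, IsConnected (U i)
  /-- the Riemannian metrics `h_i` -/
  h : ι → Euc n → Euc n →L[ℝ] Euc n →L[ℝ] ℝ
  contDiffOn_h : ∀ i, ContDiffOn ℝ ∞ (h i) (U i)
  symm_h : ∀ i, ∀ x ∈ U i, ∀ v w, h i x v w = h i x w v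
  pos_h : ∀ i, ∀ x ∈ U i, ∀ v, v ≠ 0 → 0 < h i x v v
  /-- the finite groups `Γ_i` of isometries of `(U_i, h_i)` -/
  Γ : ∀ i, Subgroup (Equiv.Perm (U i))
  finite_Γ : ∀ i, Finite (Γ i)
  isometry_Γ : ∀ i, ∀ g ∈ Γ i, ∃ φ : OpenPartialHomeomorph (Euc n) (Euc n),
    φ.source = U i ∧ φ.target = U i ∧ IsRiemannianIsometry (h i) (h i) φ ∧
      ∀ x : U i, ((g x : U i) : Euc n) = φ x
  /-- the local uniformizations `q_i`: continuous open maps whose fibres are the `Γ_i`-orbits,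
  that is, which induce homeomorphisms from `U_i / Γ_i` onto the open sets `q_i(U_i)` -/
  q : ι → Euc n → X
  continuousOn_q : ∀ i, ContinuousOn (q i) (U i)
  isOpen_q : ∀ i, ∀ O ⊆ U i, IsOpen O → IsOpen (q i '' O)
  q_eq_iff : ∀ i, ∀ x y : U i, q i x = q i y ↔ ∃ g ∈ Γ i, g x = y
  cover : ∀ p : X, ∃ i, ∃ x ∈ U i, q i x = p
  /-- existence of changes of charts `φ_ji : W_i → W_j` -/
  exists_change : ∀ i j, ∀ x ∈ U i, ∀ y ∈ U j, q i x = q j y →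
    ∃ φ : OpenPartialHomeomorph (Euc n) (Euc n),
      x ∈ φ.source ∧ y ∈ φ.target ∧ φ.source ⊆ U i ∧ φ.target ⊆ U j ∧
      IsConnected φ.source ∧ IsRiemannianIsometry (h i) (h j) φ ∧
      ∀ z ∈ φ.source, q j (φ z) = q i z

namespace RiemannianOrbifold

variable {n : ℕ} {X ι : Type*} [TopologicalSpace X] (V : RiemannianOrbifold n X ι)

/-! #### Functions and differential operators of an orbifold -/

/-- A real function `f` on the orbifold is smooth if around every point there is a chart
such that `f ∘ q_i` is smooth. -/
def IsSmooth (f : X → ℝ) : Prop :=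
  ∀ p : X, ∃ i, (∃ x ∈ V.U i, V.q i x = p) ∧ ContDiffOn ℝ ∞ (f ∘ V.q i) (V.U i)

variable {V} in
theorem IsSmooth.contDiffOn {f : X → ℝ} (hf : V.IsSmooth f) (i : ι) :
    ContDiffOn ℝ ∞ (f ∘ V.q i) (V.U i) := by
  intro x hx
  obtain ⟨j, ⟨y, hy, hxy⟩, hj⟩ := hf (V.q i x)
  obtain ⟨φ, hxs, -, -, hst, -, hφ, hq⟩ := V.exists_change i j x hx y hy hxy.symm
  have hmem : φ x ∈ V.U j := hst (φ.map_source hxs)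
  have h1 : ContDiffAt ℝ ∞ (f ∘ V.q j) (φ x) :=
    hj.contDiffAt ((V.isOpen_U j).mem_nhds hmem)
  have h2 : ContDiffAt ℝ ∞ φ x := hφ.contDiffOn.contDiffAt (φ.open_source.mem_nhds hxs)
  have h3 : ContDiffAt ℝ ∞ ((f ∘ V.q j) ∘ φ) x := h1.comp x h2
  refine (h3.congr_of_eventuallyEq ?_).contDiffWithinAt
  filter_upwards [φ.open_source.mem_nhds hxs] with z hz
  simp [hq z hz]

theorem isSmooth_iff {f : X → ℝ} :
    V.IsSmooth f ↔ ∀ i, ContDiffOn ℝ ∞ (f ∘ V.q i) (V.U i) := by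
  refine ⟨fun h => h.contDiffOn, fun h p => ?_⟩
  obtain ⟨i, x, hx, hp⟩ := V.cover p
  exact ⟨i, ⟨x, hx, hp⟩, h i⟩

/-- The algebra `C^∞(V)`. -/
def smooth : Subalgebra ℝ (X → ℝ) where
  carrier := {f | V.IsSmooth f}
  mul_mem' hf hg := V.isSmooth_iff.2 fun i => (hf.contDiffOn i).mul (hg.contDiffOn i)
  add_mem' hf hg := V.isSmooth_iff.2 fun i => (hf.contDiffOn i).add (hg.contDiffOn i)
  algebraMap_mem' _ := V.isSmooth_iff.2 fun _ => contDiffOn_const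

noncomputable instance : AddCommGroup V.smooth := inferInstance
noncomputable instance : AddCommMonoid V.smooth := AddCommGroup.toAddCommMonoid
noncomputable instance : Module ℝ V.smooth := inferInstance

/-- `D` is a differential operator of order `k` of the orbifold: on all `U_i`,
`(D f) ∘ q_i = ∑_{|α| ≤ k} D_α ∂^α (f ∘ q_i)` with smooth `D_α`. -/
def IsDiffOp (k : ℕ) (D : Module.End ℝ V.smooth) : Prop :=
  ∀ i, HasLocalForm k (V.U i) (fun (f : V.smooth) => (f : X → ℝ) ∘ V.q i)
    (fun f => (D f : X → ℝ) ∘ V.q i)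

theorem smooth_comp_q (i : ι) (f : V.smooth) :
    ContDiffOn ℝ ∞ ((f : X → ℝ) ∘ V.q i) (V.U i) :=
  IsSmooth.contDiffOn f.2 i

/-- The space `D^k(V)` of differential operators of order `k`. -/
noncomputable def diffOp (k : ℕ) : Submodule ℝ (Module.End ℝ V.smooth) where
  carrier := {D | V.IsDiffOp k D}
  zero_mem' _ := HasLocalForm.zero
  add_mem' h h' i := (h i).add (h' i)
  smul_mem' r _ h i := (h i).mul_left (a := fun _ => r) contDiffOn_const

theorem diffOp_mono {k l : ℕ} (h : k ≤ l) : V.diffOp k ≤ V.diffOp l :=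
  fun _ hD i => (hD i).mono h

theorem mul_mem_diffOp {k l : ℕ} {D E : Module.End ℝ V.smooth} (hD : D ∈ V.diffOp k)
    (hE : E ∈ V.diffOp l) : D * E ∈ V.diffOp (l + k) := fun i =>
  (hE i).comp (V.isOpen_U i) (V.smooth_comp_q i) ((hD i).reindex fun f => E f)

/-- The Lie algebra `D(V) = ⋃_k D^k(V)` of all differential operators, with the commutator
bracket. -/
noncomputable def diffOps : LieSubalgebra ℝ (Module.End ℝ V.smooth) where
  carrier := {D | ∃ k, D ∈ V.diffOp k}
  zero_mem' := ⟨0, zero_mem _⟩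
  add_mem' := by
    rintro D E ⟨k, hk⟩ ⟨l, hl⟩
    exact ⟨max k l, add_mem (V.diffOp_mono (le_max_left k l) hk)
      (V.diffOp_mono (le_max_right k l) hl)⟩
  smul_mem' := by
    rintro r D ⟨k, hk⟩
    exact ⟨k, Submodule.smul_mem _ r hk⟩
  lie_mem' := by
    rintro D E ⟨k, hk⟩ ⟨l, hl⟩
    refine ⟨k + l, ?_⟩
    have h1 := V.mul_mem_diffOp hk hl
    rw [add_comm l k] at h1
    exact sub_mem h1 (V.mul_mem_diffOp hl hk)

/-- The subspace `D^{k-1}(V)` of `D^k(V)`, where `D^{-1}(V) = 0`. -/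
noncomputable def lowerOp : ∀ k : ℕ, Submodule ℝ (V.diffOp k)
  | 0 => ⊥
  | k + 1 => (V.diffOp k).comap (V.diffOp (k + 1)).subtype

/-- The space of symbols `S^k(V) = D^k(V) / D^{k-1}(V)`. -/
abbrev Symbols (k : ℕ) : Type _ := V.diffOp k ⧸ V.lowerOp k

theorem commutator_mem_one {D E : Module.End ℝ V.smooth} (hD : D ∈ V.diffOp 1)
    (hE : E ∈ V.diffOp 1) : D * E - E * D ∈ V.diffOp 1 := by
  intro i
  obtain ⟨a, ξ, ha, hξ, hDf⟩ := (hD i).exists_of_one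
  obtain ⟨b, η, hb, hη, hEf⟩ := (hE i).exists_of_one
  have hO := V.isOpen_U i
  refine HasLocalForm.of_one (a := fun x => fderiv ℝ b x (ξ x) - fderiv ℝ a x (η x))
    (ξ := fun x => fderiv ℝ η x (ξ x) - fderiv ℝ ξ x (η x)) ?_ ?_ fun f x hx => ?_
  · exact ((hb.fderiv_of_isOpen hO (m := ∞) (by simp)).clm_apply hξ).sub
      ((ha.fderiv_of_isOpen hO (m := ∞) (by simp)).clm_apply hη)
  · exact ((hη.fderiv_of_isOpen hO (m := ∞) (by simp)).clm_apply hξ).sub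
      ((hξ.fderiv_of_isOpen hO (m := ∞) (by simp)).clm_apply hη)
  · have := first_order_commutator hO ha hb hξ hη (V.smooth_comp_q i f) (hDf f) (hEf f) hx
    rw [← this, ← hDf (E f) x hx, ← hEf (D f) x hx]
    rfl

theorem commutator_mem_zero {D E : Module.End ℝ V.smooth} (hD : D ∈ V.diffOp 1)
    (hE : E ∈ V.diffOp 0) : D * E - E * D ∈ V.diffOp 0 := by
  intro i
  obtain ⟨a, ξ, ha, hξ, hDf⟩ := (hD i).exists_of_one
  obtain ⟨b, hb, hEf⟩ := (hE i).exists_of_zero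
  have hO := V.isOpen_U i
  have hEf' : ∀ f : V.smooth, ∀ x ∈ V.U i, ((E f : X → ℝ) ∘ V.q i) x
      = b x * ((f : X → ℝ) ∘ V.q i) x
        + fderiv ℝ ((f : X → ℝ) ∘ V.q i) x ((fun _ => 0 : Euc n → Euc n) x) := by
    intro f x hx
    rw [hEf f x hx]
    simp
  refine HasLocalForm.of_zero (a := fun x => fderiv ℝ b x (ξ x)) ?_ fun f x hx => ?_
  · exact (hb.fderiv_of_isOpen hO (m := ∞) (by simp)).clm_apply hξ
  · have := first_order_commutator hO ha hb hξ (contDiffOn_const (c := (0 : Euc n)))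
      (V.smooth_comp_q i f) (hDf f) (hEf' f) hx
    have e : ((D * E - E * D) f : X → ℝ) (V.q i x)
        = ((D (E f) : V.smooth) : X → ℝ) (V.q i x) - ((E (D f) : V.smooth) : X → ℝ) (V.q i x) :=
      rfl
    have e1 := hDf (E f) x hx
    have e2 := hEf (D f) x hx
    simp only [Function.comp_apply, map_zero, add_zero, sub_zero] at this e1 e2 ⊢
    rw [e, e1, e2, this]
    simp

/-- `D^1(V)` as a Lie algebra. -/
noncomputable def diffOpOne : LieSubalgebra ℝ (Module.End ℝ V.smooth) where
  __ := V.diffOp 1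
  lie_mem' hD hE := V.commutator_mem_one hD hE

/-- `D^0(V)` as a Lie ideal of `D^1(V)`. -/
noncomputable def diffOpZero : LieIdeal ℝ V.diffOpOne where
  __ := (V.diffOp 0).comap V.diffOpOne.toSubmodule.subtype
  lie_mem {D _} hE := V.commutator_mem_zero D.2 hE

/-- The Lie algebra of vector fields `Vect(V) = S^1(V) = D^1(V) / D^0(V)`. -/
abbrev Vect : Type _ := V.diffOpOne ⧸ V.diffOpZero

/-! #### The foliated resolution -/

/-- The bundle `Ũ_i` of orthonormal frames `(x, (u_1, …, u_n))` of `(U_i, h_i)`. -/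
def frames (i : ι) : Set (Euc n × (Fin n → Euc n)) :=
  {z | z.1 ∈ V.U i ∧ ∀ a b, V.h i z.1 (z.2 a) (z.2 b) = if a = b then 1 else 0}

/-- `φ` is a change of charts from `U_i` to `U_j`. For `i = j`, the restrictions of elements of
`Γ_i` are changes of charts. -/
def IsChange (i j : ι) (φ : OpenPartialHomeomorph (Euc n) (Euc n)) : Prop :=
  φ.source ⊆ V.U i ∧ φ.target ⊆ V.U j ∧ IsRiemannianIsometry (V.h i) (V.h j) φ ∧
    ∀ z ∈ φ.source, V.q j (φ z) = V.q i z

/-- Two orthonormal frames, over points of `U_i` and `U_j`, are identified if the lift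
`(x, u) ↦ (φ x, φ_* u)` of some change of charts `φ` maps the first to the second. This comprises
the passage from `Ũ_i` to `Ũ_i / Γ_i` and the gluing of these quotients. -/
def FrameRel (a b : Σ i, V.frames i) : Prop :=
  ∃ φ : OpenPartialHomeomorph (Euc n) (Euc n), V.IsChange a.1 b.1 φ ∧
    a.2.1.1 ∈ φ.source ∧ b.2.1.1 = φ a.2.1.1 ∧
    ∀ c, b.2.1.2 c = fderiv ℝ φ a.2.1.1 (a.2.1.2 c)

theorem IsChange.refl (i : ι) : V.IsChange i i
    (OpenPartialHomeomorph.ofSet (V.U i) (V.isOpen_U i)) := by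
  refine ⟨by simp, by simp, ⟨?_, ?_, ?_⟩, ?_⟩
  · exact contDiffOn_id
  · exact contDiffOn_id
  · intro x _ v w
    simp
  · intro z _
    rfl

variable {V} in
theorem IsChange.fderiv_symm {i j : ι} {φ : OpenPartialHomeomorph (Euc n) (Euc n)}
    (h : V.IsChange i j φ) {x : Euc n} (hx : x ∈ φ.source) (v : Euc n) :
    fderiv ℝ φ.symm (φ x) (fderiv ℝ φ x v) = v := by
  have h1 : DifferentiableAt ℝ φ x :=
    (h.2.2.1.contDiffOn.contDiffAt (φ.open_source.mem_nhds hx)).differentiableAt (by simp)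
  have h2 : DifferentiableAt ℝ φ.symm (φ x) :=
    (h.2.2.1.contDiffOn_symm.contDiffAt
      (φ.open_target.mem_nhds (φ.map_source hx))).differentiableAt (by simp)
  have e : (φ.symm ∘ φ) =ᶠ[𝓝 x] id := φ.eventually_left_inverse hx
  have := fderiv_comp x h2 h1
  rw [e.fderiv_eq, fderiv_id] at this
  exact (congrArg (fun L : Euc n →L[ℝ] Euc n => L v) this).symm

variable {V} in
theorem IsChange.symm {i j : ι} {φ : OpenPartialHomeomorph (Euc n) (Euc n)}
    (h : V.IsChange i j φ) : V.IsChange j i φ.symm := by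
  refine ⟨h.2.1, h.1, ⟨h.2.2.1.contDiffOn_symm, ?_, ?_⟩, ?_⟩
  · simpa using h.2.2.1.contDiffOn
  · intro y hy v w
    have hy' : y ∈ φ.target := hy
    have hx := φ.map_target hy'
    have hinv : ∀ v, fderiv ℝ φ (φ.symm y) (fderiv ℝ φ.symm y v) = v := by
      intro v
      have h1 : DifferentiableAt ℝ φ (φ.symm y) :=
        (h.2.2.1.contDiffOn.contDiffAt (φ.open_source.mem_nhds hx)).differentiableAt (by simp)
      have h2 : DifferentiableAt ℝ φ.symm y :=
        (h.2.2.1.contDiffOn_symm.contDiffAt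
          (φ.open_target.mem_nhds hy')).differentiableAt (by simp)
      have e : (φ ∘ φ.symm) =ᶠ[𝓝 y] id := φ.eventually_right_inverse hy'
      have := fderiv_comp y h1 h2
      rw [e.fderiv_eq, fderiv_id] at this
      exact (congrArg (fun L : Euc n →L[ℝ] Euc n => L v) this).symm
    have := h.2.2.1.metric _ hx (fderiv ℝ φ.symm y v) (fderiv ℝ φ.symm y w)
    rw [hinv, hinv, φ.right_inv hy'] at this
    exact this.symm
  · intro z hz
    have hz' : z ∈ φ.target := hz
    have := h.2.2.2 _ (φ.map_target hz')
    rw [φ.right_inv hz'] at this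
    exact this.symm

variable {V} in
theorem IsChange.fderiv_trans {i j k : ι} {φ ψ : OpenPartialHomeomorph (Euc n) (Euc n)}
    (h : V.IsChange i j φ) (h' : V.IsChange j k ψ) {x : Euc n} (hx : x ∈ φ.source)
    (hx' : φ x ∈ ψ.source) (v : Euc n) :
    fderiv ℝ (φ.trans ψ) x v = fderiv ℝ ψ (φ x) (fderiv ℝ φ x v) := by
  have h1 : DifferentiableAt ℝ φ x :=
    (h.2.2.1.contDiffOn.contDiffAt (φ.open_source.mem_nhds hx)).differentiableAt (by simp)
  have h2 : DifferentiableAt ℝ ψ (φ x) :=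
    (h'.2.2.1.contDiffOn.contDiffAt (ψ.open_source.mem_nhds hx')).differentiableAt (by simp)
  have := fderiv_comp x h2 h1
  rw [OpenPartialHomeomorph.coe_trans, this]
  rfl

variable {V} in
theorem IsChange.trans {i j k : ι} {φ ψ : OpenPartialHomeomorph (Euc n) (Euc n)}
    (h : V.IsChange i j φ) (h' : V.IsChange j k ψ) : V.IsChange i k (φ.trans ψ) := by
  have hs : ∀ x ∈ (φ.trans ψ).source, x ∈ φ.source ∧ φ x ∈ ψ.source := fun x hx => by
    rw [OpenPartialHomeomorph.trans_source] at hx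
    exact hx
  have ht : ∀ x ∈ (φ.trans ψ).target, x ∈ ψ.target ∧ ψ.symm x ∈ φ.target := fun x hx => by
    rw [OpenPartialHomeomorph.trans_target] at hx
    exact hx
  refine ⟨fun x hx => h.1 (hs x hx).1, fun x hx => h'.2.1 (ht x hx).1, ⟨?_, ?_, ?_⟩, ?_⟩
  · exact h'.2.2.1.contDiffOn.comp (h.2.2.1.contDiffOn.mono fun x hx => (hs x hx).1)
      fun x hx => (hs x hx).2
  · exact h.2.2.1.contDiffOn_symm.comp (h'.2.2.1.contDiffOn_symm.mono fun x hx => (ht x hx).1)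
      fun x hx => (ht x hx).2
  · intro x hx v w
    rw [h.fderiv_trans h' (hs x hx).1 (hs x hx).2, h.fderiv_trans h' (hs x hx).1 (hs x hx).2]
    exact (h'.2.2.1.metric _ (hs x hx).2 _ _).trans (h.2.2.1.metric _ (hs x hx).1 _ _)
  · intro z hz
    exact (h'.2.2.2 _ (hs z hz).2).trans (h.2.2.2 _ (hs z hz).1)

/-- The identification of frames is an equivalence relation. -/
def frameSetoid : Setoid (Σ i, V.frames i) where
  r := V.FrameRel
  iseqv := by
    refine ⟨fun a => ?_, ?_, ?_⟩
    · exact ⟨_, IsChange.refl V a.1, a.2.2.1, rfl, fun c => by simp⟩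
    · rintro a b ⟨φ, hφ, ha, hb, hd⟩
      refine ⟨φ.symm, hφ.symm, ?_, ?_, fun c => ?_⟩
      · rw [hb]
        exact φ.map_source ha
      · rw [hb, φ.left_inv ha]
      · rw [hb, hd, hφ.fderiv_symm ha]
    · rintro a b c ⟨φ, hφ, ha, hb, hd⟩ ⟨ψ, hψ, hb', hc, hd'⟩
      rw [hb] at hb' hc hd'
      refine ⟨φ.trans ψ, hφ.trans hψ, ?_, hc, fun e => ?_⟩
      · rw [OpenPartialHomeomorph.trans_source]
        exact ⟨ha, hb'⟩
      · rw [hd', hd, hφ.fderiv_trans hψ ha hb']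

/-- The resolution `Ṽ`, with the quotient topology: the spaces `Ũ_i / Γ_i` glued along the lifts
of the changes of charts. -/
abbrev Resolution : Type _ := Quotient V.frameSetoid

/-- The class in `Ṽ` of an orthonormal frame of `U_i`. -/
def cls (i : ι) (u : V.frames i) : V.Resolution := Quotient.mk V.frameSetoid ⟨i, u⟩

/-- The projection `p : Ṽ → V`. Its fibres are the orbits of the right action of `O(n)` on
`Ṽ`, that is, the leaves of the foliation `F`. -/
def proj : V.Resolution → X :=
  Quotient.lift (fun a : Σ i, V.frames i => V.q a.1 a.2.1.1) (by
    rintro a b ⟨φ, hφ, ha, hb, -⟩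
    exact (hφ.2.2.2 _ ha).symm.trans (congrArg _ hb.symm))

/-- A map `g` defined on a subset `S` of a normed space is smooth near `z` if near `z` it is the
restriction of a smooth map defined on an open set of the ambient space. -/
def SmoothNear {E F : Type*} [NormedAddCommGroup E] [NormedSpace ℝ E]
    [NormedAddCommGroup F] [NormedSpace ℝ F] {S : Set E} (g : S → F) (z : S) : Prop :=
  ∃ O : Set E, IsOpen O ∧ (z : E) ∈ O ∧ ∃ G : E → F, ContDiffOn ℝ ∞ G O ∧
    ∀ w : S, (w : E) ∈ O → g w = G w

/-- The algebra `C^∞(Ṽ)` of smooth functions on the manifold `Ṽ`: functions whose pullbacks to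
the submanifolds `Ũ_i` of `ℝⁿ × (ℝⁿ)ⁿ` (which cover `Ṽ` by local diffeomorphisms) are smooth. -/
def totSmooth : Subalgebra ℝ (V.Resolution → ℝ) where
  carrier := {g | ∀ i, ∀ z : V.frames i, SmoothNear (fun u => g (V.cls i u)) z}
  mul_mem' hf hg i z := by
    obtain ⟨O, hO, hz, G, hG, h⟩ := hf i z
    obtain ⟨O', hO', hz', G', hG', h'⟩ := hg i z
    refine ⟨O ∩ O', hO.inter hO', ⟨hz, hz'⟩, fun w => G w * G' w,
      (hG.mono Set.inter_subset_left).mul (hG'.mono Set.inter_subset_right), fun w hw => ?_⟩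
    exact congrArg₂ (· * ·) (h w hw.1) (h' w hw.2)
  add_mem' hf hg i z := by
    obtain ⟨O, hO, hz, G, hG, h⟩ := hf i z
    obtain ⟨O', hO', hz', G', hG', h'⟩ := hg i z
    refine ⟨O ∩ O', hO.inter hO', ⟨hz, hz'⟩, fun w => G w + G' w,
      (hG.mono Set.inter_subset_left).add (hG'.mono Set.inter_subset_right), fun w hw => ?_⟩
    exact congrArg₂ (· + ·) (h w hw.1) (h' w hw.2)
  algebraMap_mem' r _ z :=
    ⟨Set.univ, isOpen_univ, trivial, fun _ => r, contDiffOn_const, fun _ _ => rfl⟩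

noncomputable instance : AddCommGroup V.totSmooth := inferInstance
noncomputable instance : AddCommMonoid V.totSmooth := AddCommGroup.toAddCommMonoid
noncomputable instance : Module ℝ V.totSmooth := inferInstance

/-- The algebra `C^∞(Ṽ, F)` of foliated functions: the smooth functions on `Ṽ` that are constant
along the leaves, that is, along the fibres of `p`. -/
def folFun : Subalgebra ℝ V.totSmooth where
  carrier := {g | ∀ v w, V.proj v = V.proj w → (g : V.Resolution → ℝ) v = (g : V.Resolution → ℝ) w}
  mul_mem' hf hg v w h := congrArg₂ (· * ·) (hf v w h) (hg v w h)
  add_mem' hf hg v w h := congrArg₂ (· + ·) (hf v w h) (hg v w h)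
  algebraMap_mem' _ _ _ _ := rfl

noncomputable instance : AddCommGroup V.folFun := inferInstance
noncomputable instance : AddCommMonoid V.folFun := AddCommGroup.toAddCommMonoid
noncomputable instance : Module ℝ V.folFun := inferInstance

/-- A system of adapted coordinates `(x, y)` of `(Ṽ, F)`: a smooth chart of `Ṽ` onto a product
`A × B` of open sets, `A` connected, such that the plaques `y = const` lie in leaves.
The leaves have dimension `n(n-1)/2` and codimension `n`. -/
structure AdaptedChart where
  /-- the coordinate map -/
  ψ : OpenPartialHomeomorph V.Resolution (Euc (n * (n - 1) / 2) × Euc n)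
  /-- the range of the leaf coordinates `x` -/
  A : Set (Euc (n * (n - 1) / 2))
  /-- the range of the transverse coordinates `y` -/
  B : Set (Euc n)
  isOpen_A : IsOpen A
  isPreconnected_A : IsPreconnected A
  isOpen_B : IsOpen B
  target_eq : ψ.target = A ×ˢ B
  /-- `ψ` is smooth: so are its pullbacks to the frame bundles `Ũ_i`. -/
  smooth : ∀ i, ∀ u : V.frames i, V.cls i u ∈ ψ.source →
    SmoothNear (fun w : V.frames i => ψ (V.cls i w)) u
  /-- `ψ⁻¹` is smooth: it lifts locally to smooth maps into the frame bundles `Ũ_i`. -/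
  smooth_symm : ∀ z ∈ ψ.target, ∃ i, ∃ O, IsOpen O ∧ z ∈ O ∧ O ⊆ ψ.target ∧
    ∃ s : Euc (n * (n - 1) / 2) × Euc n → Euc n × (Fin n → Euc n), ContDiffOn ℝ ∞ s O ∧
      ∀ w ∈ O, ∃ hw : s w ∈ V.frames i, V.cls i ⟨s w, hw⟩ = ψ.symm w
  /-- The plaques lie in leaves. -/
  proj_eq : ∀ x ∈ A, ∀ x' ∈ A, ∀ y ∈ B, V.proj (ψ.symm (x, y)) = V.proj (ψ.symm (x', y))

variable {V} in
theorem AdaptedChart.contDiffOn (κ : V.AdaptedChart) (g : V.totSmooth) :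
    ContDiffOn ℝ ∞ (fun z => (g : V.Resolution → ℝ) (κ.ψ.symm z)) κ.ψ.target := by
  intro z hz
  obtain ⟨i, O, hO, hzO, -, s, hs, hcls⟩ := κ.smooth_symm z hz
  obtain ⟨hsz, -⟩ := hcls z hzO
  obtain ⟨O', hO', hz', G, hG, hgG⟩ := g.2 i ⟨s z, hsz⟩
  have h1 : ContDiffAt ℝ ∞ s z := hs.contDiffAt (hO.mem_nhds hzO)
  have h2 : ContDiffAt ℝ ∞ G (s z) := hG.contDiffAt (hO'.mem_nhds hz')
  refine ((h2.comp z h1).congr_of_eventuallyEq ?_).contDiffWithinAt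
  filter_upwards [hO.mem_nhds hzO, h1.continuousAt.preimage_mem_nhds (hO'.mem_nhds hz')]
    with w hw hw'
  obtain ⟨hsw, hw2⟩ := hcls w hw
  rw [← hw2]
  exact hgG ⟨s w, hsw⟩ hw'

variable {V} in
theorem AdaptedChart.contDiffOn_slice (κ : V.AdaptedChart) (g : V.totSmooth) (x : κ.A) :
    ContDiffOn ℝ ∞ (fun y => (g : V.Resolution → ℝ) (κ.ψ.symm (x, y))) κ.B := by
  refine (κ.contDiffOn g).comp (f := fun y : Euc n => ((x : Euc (n * (n - 1) / 2)), y))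
    (contDiffOn_const.prodMk contDiffOn_id) fun y hy => ?_
  rw [κ.target_eq]
  exact ⟨x.2, hy⟩

/-- `D` is a foliated differential operator of order `k`: in all adapted coordinates `(x, y)`,
`D = ∑_{|α| ≤ k} D_α ∂_y^α`, the coefficients `D_α` being foliated, that is, smooth functions of
the transverse coordinates `y` only. -/
def IsFolDiffOp (k : ℕ) (D : Module.End ℝ V.folFun) : Prop :=
  ∀ κ : V.AdaptedChart, HasLocalForm k κ.B
    (fun (t : κ.A × V.folFun) y => ((t.2 : V.totSmooth) : V.Resolution → ℝ) (κ.ψ.symm (t.1, y)))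
    (fun t y => ((D t.2 : V.totSmooth) : V.Resolution → ℝ) (κ.ψ.symm (t.1, y)))

/-- The space `D^k(Ṽ, F)` of foliated differential operators of order `k`. -/
noncomputable def folDiffOp (k : ℕ) : Submodule ℝ (Module.End ℝ V.folFun) where
  carrier := {D | V.IsFolDiffOp k D}
  zero_mem' _ := HasLocalForm.zero
  add_mem' h h' κ := (h κ).add (h' κ)
  smul_mem' r _ h κ := (h κ).mul_left (a := fun _ => r) contDiffOn_const

theorem folDiffOp_mono {k l : ℕ} (h : k ≤ l) : V.folDiffOp k ≤ V.folDiffOp l :=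
  fun _ hD κ => (hD κ).mono h

theorem mul_mem_folDiffOp {k l : ℕ} {D E : Module.End ℝ V.folFun} (hD : D ∈ V.folDiffOp k)
    (hE : E ∈ V.folDiffOp l) : D * E ∈ V.folDiffOp (l + k) := fun κ =>
  (hE κ).comp κ.isOpen_B (fun t => κ.contDiffOn_slice t.2 t.1)
    ((hD κ).reindex fun t : κ.A × V.folFun => (t.1, E t.2))

/-- The Lie algebra `D(Ṽ, F) = ⋃_k D^k(Ṽ, F)` of all foliated differential operators, with the
commutator bracket. -/
noncomputable def folDiffOps : LieSubalgebra ℝ (Module.End ℝ V.folFun) where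
  carrier := {D | ∃ k, D ∈ V.folDiffOp k}
  zero_mem' := ⟨0, zero_mem _⟩
  add_mem' := by
    rintro D E ⟨k, hk⟩ ⟨l, hl⟩
    exact ⟨max k l, add_mem (V.folDiffOp_mono (le_max_left k l) hk)
      (V.folDiffOp_mono (le_max_right k l) hl)⟩
  smul_mem' := by
    rintro r D ⟨k, hk⟩
    exact ⟨k, Submodule.smul_mem _ r hk⟩
  lie_mem' := by
    rintro D E ⟨k, hk⟩ ⟨l, hl⟩
    refine ⟨k + l, ?_⟩
    have h1 := V.mul_mem_folDiffOp hk hl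
    rw [add_comm l k] at h1
    exact sub_mem h1 (V.mul_mem_folDiffOp hl hk)

/-- The subspace `D^{k-1}(Ṽ, F)` of `D^k(Ṽ, F)`, where `D^{-1}(Ṽ, F) = 0`. -/
noncomputable def lowerFolOp : ∀ k : ℕ, Submodule ℝ (V.folDiffOp k)
  | 0 => ⊥
  | k + 1 => (V.folDiffOp k).comap (V.folDiffOp (k + 1)).subtype

/-- The space of foliated symbols `S^k(Ṽ, F) = D^k(Ṽ, F) / D^{k-1}(Ṽ, F)`. -/
abbrev FolSymbols (k : ℕ) : Type _ := V.folDiffOp k ⧸ V.lowerFolOp k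

/-! #### Vector fields on the resolution -/

/-- `X` is a smooth vector field on `Ṽ`, acting on functions: in all adapted coordinates it is
the derivative in the direction of a smooth map `ξ`. -/
def IsVectorField (X : Module.End ℝ V.totSmooth) : Prop :=
  ∀ κ : V.AdaptedChart,
    ∃ ξ : Euc (n * (n - 1) / 2) × Euc n → Euc (n * (n - 1) / 2) × Euc n,
      ContDiffOn ℝ ∞ ξ κ.ψ.target ∧ ∀ g : V.totSmooth, ∀ z ∈ κ.ψ.target,
        (X g : V.Resolution → ℝ) (κ.ψ.symm z)
          = fderiv ℝ (fun z => (g : V.Resolution → ℝ) (κ.ψ.symm z)) z (ξ z)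

/-- `X` is a smooth vector field on `Ṽ` tangent to the leaves, an element of `Γ(TF)`: in all
adapted coordinates `(x, y)` its `y`-component vanishes. -/
def IsTangent (X : Module.End ℝ V.totSmooth) : Prop :=
  ∀ κ : V.AdaptedChart,
    ∃ ξ : Euc (n * (n - 1) / 2) × Euc n → Euc (n * (n - 1) / 2) × Euc n,
      ContDiffOn ℝ ∞ ξ κ.ψ.target ∧ (∀ z ∈ κ.ψ.target, (ξ z).2 = 0) ∧
      ∀ g : V.totSmooth, ∀ z ∈ κ.ψ.target,
        (X g : V.Resolution → ℝ) (κ.ψ.symm z)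
          = fderiv ℝ (fun z => (g : V.Resolution → ℝ) (κ.ψ.symm z)) z (ξ z)

/-- The space `Γ(TF)` of vector fields tangent to the leaves. -/
noncomputable def tangent : Submodule ℝ (Module.End ℝ V.totSmooth) where
  carrier := {X | V.IsTangent X}
  zero_mem' κ := ⟨fun _ => 0, contDiffOn_const, fun _ _ => rfl, fun g z _ => by simp⟩
  add_mem' hX hY κ := by
    obtain ⟨ξ, hξ, hξ0, h⟩ := hX κ
    obtain ⟨η, hη, hη0, h'⟩ := hY κ
    refine ⟨fun z => ξ z + η z, hξ.add hη, fun z hz => ?_, fun g z hz => ?_⟩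
    · rw [Prod.snd_add, hξ0 z hz, hη0 z hz, add_zero]
    · rw [map_add, ← h g z hz, ← h' g z hz]
      rfl
  smul_mem' r X hX κ := by
    obtain ⟨ξ, hξ, hξ0, h⟩ := hX κ
    refine ⟨fun z => r • ξ z, hξ.const_smul r, fun z hz => ?_, fun g z hz => ?_⟩
    · rw [Prod.smul_snd, hξ0 z hz, smul_zero]
    · rw [map_smul, ← h g z hz]
      rfl

variable {V} in
theorem IsVectorField.commutator {X Y : Module.End ℝ V.totSmooth} (hX : V.IsVectorField X)
    (hY : V.IsVectorField Y) : V.IsVectorField (X * Y - Y * X) := by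
  intro κ
  obtain ⟨ξ, hξ, h⟩ := hX κ
  obtain ⟨η, hη, h'⟩ := hY κ
  have hO : IsOpen κ.ψ.target := κ.ψ.open_target
  refine ⟨fun z => fderiv ℝ η z (ξ z) - fderiv ℝ ξ z (η z), ?_, fun g z hz => ?_⟩
  · exact ((hη.fderiv_of_isOpen hO (m := ∞) (by simp)).clm_apply hξ).sub
      ((hξ.fderiv_of_isOpen hO (m := ∞) (by simp)).clm_apply hη)
  · have := first_order_commutator hO (contDiffOn_const (c := (0 : ℝ)))
      (contDiffOn_const (c := (0 : ℝ))) hξ hη (κ.contDiffOn g)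
      (u := fun z => (X g : V.Resolution → ℝ) (κ.ψ.symm z))
      (v := fun z => (Y g : V.Resolution → ℝ) (κ.ψ.symm z))
      (fun z hz => by rw [h g z hz]; simp) (fun z hz => by rw [h' g z hz]; simp) hz
    have e : ((X * Y - Y * X) g : V.Resolution → ℝ) (κ.ψ.symm z)
        = (X (Y g) : V.Resolution → ℝ) (κ.ψ.symm z)
          - (Y (X g) : V.Resolution → ℝ) (κ.ψ.symm z) := rfl
    rw [e, h (Y g) z hz, h' (X g) z hz]
    simpa using this

/-- The Lie algebra `Vect_F(Ṽ)` of adapted vector fields: those vector fields `X` on `Ṽ` with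
`[X, Γ(TF)] ⊆ Γ(TF)` that preserve the foliated functions (the latter accounts for leaves that
are not connected). -/
noncomputable def adapted : LieSubalgebra ℝ (Module.End ℝ V.totSmooth) where
  carrier := {X | V.IsVectorField X ∧ (∀ Y ∈ V.tangent, X * Y - Y * X ∈ V.tangent) ∧
    ∀ f ∈ V.folFun, X f ∈ V.folFun}
  zero_mem' := by
    refine ⟨fun κ => ⟨fun _ => 0, contDiffOn_const, fun g z _ => by simp⟩, fun Y _ => ?_,
      fun f _ => ?_⟩
    · rw [zero_mul, mul_zero, sub_zero]
      exact zero_mem _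
    · exact zero_mem _
  add_mem' := by
    rintro X Y ⟨h1, h2, h3⟩ ⟨h1', h2', h3'⟩
    refine ⟨fun κ => ?_, fun Z hZ => ?_, fun f hf => add_mem (h3 f hf) (h3' f hf)⟩
    · obtain ⟨ξ, hξ, h⟩ := h1 κ
      obtain ⟨η, hη, h'⟩ := h1' κ
      refine ⟨fun z => ξ z + η z, hξ.add hη, fun g z hz => ?_⟩
      rw [map_add, ← h g z hz, ← h' g z hz]
      rfl
    · have : (X + Y) * Z - Z * (X + Y) = (X * Z - Z * X) + (Y * Z - Z * Y) := by
        rw [add_mul, mul_add]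
        abel
      rw [this]
      exact add_mem (h2 Z hZ) (h2' Z hZ)
  smul_mem' := by
    rintro r X ⟨h1, h2, h3⟩
    refine ⟨fun κ => ?_, fun Z hZ => ?_, fun f hf => Subalgebra.smul_mem _ (h3 f hf) r⟩
    · obtain ⟨ξ, hξ, h⟩ := h1 κ
      refine ⟨fun z => r • ξ z, hξ.const_smul r, fun g z hz => ?_⟩
      rw [map_smul, ← h g z hz]
      rfl
    · have : (r • X) * Z - Z * (r • X) = r • (X * Z - Z * X) := by
        rw [smul_mul_assoc, mul_smul_comm, smul_sub]
      rw [this]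
      exact Submodule.smul_mem _ r (h2 Z hZ)
  lie_mem' := by
    rintro X Y ⟨h1, h2, h3⟩ ⟨h1', h2', h3'⟩
    refine ⟨h1.commutator h1', fun Z hZ => ?_, fun f hf =>
      sub_mem (h3 _ (h3' f hf)) (h3' _ (h3 f hf))⟩
    have : (X * Y - Y * X) * Z - Z * (X * Y - Y * X)
        = (X * (Y * Z - Z * Y) - (Y * Z - Z * Y) * X)
          - (Y * (X * Z - Z * X) - (X * Z - Z * X) * Y) := by
      noncomm_ring
    exact this ▸ sub_mem (h2 _ (h2' Z hZ)) (h2' _ (h2 Z hZ))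

/-- `Γ(TF)` as a Lie ideal of `Vect_F(Ṽ)`. -/
noncomputable def tangentIdeal : LieIdeal ℝ V.adapted where
  __ := V.tangent.comap V.adapted.toSubmodule.subtype
  lie_mem {X Y} hY := X.2.2.1 Y hY

/-- The Lie algebra of foliated vector fields `Vect(Ṽ, F) = Vect_F(Ṽ) / Γ(TF)`. -/
abbrev FolVect : Type _ := V.adapted ⧸ V.tangentIdeal

/-- The action of an adapted vector field on the foliated functions. -/
noncomputable def adaptedAction (X : V.adapted) : Module.End ℝ V.folFun where
  toFun f := ⟨(X : Module.End ℝ V.totSmooth) f, X.2.2.2 f f.2⟩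
  map_add' f g := Subtype.ext (map_add (X : Module.End ℝ V.totSmooth) (f : V.totSmooth) g)
  map_smul' r f := Subtype.ext (map_smul (X : Module.End ℝ V.totSmooth) r (f : V.totSmooth))

end RiemannianOrbifold

end Orbifold

/-! Locally, orbifold functions and foliated functions are the same functions of `n` transverse
variables, and the proof makes this precise. An element of `Γ_i` that fixes an orthonormal frame is
the identity near its base point, because it has finite order and is the identity to first order.
Every change of charts of `U_i` to itself has the 1-jet of such an element at each point. Hence the
frame bundle of `U_i` maps locally injectively to the resolution (`exists_isOpen_injOn_cls`), and
every frame lies in an adapted chart whose transverse coordinates are those of `U_i`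
(`exists_adaptedChart`). Conversely, in an arbitrary adapted chart the projection reads `(x, y) ↦
q_i (σ y)` locally, with `σ` a local diffeomorphism (`AdaptedChart.exists_transverse`).

The first kind of chart lets foliated functions and operators descend to the orbifold. The second
kind carries orbifold operators up, since composition with a local diffeomorphism preserves the
order (`HasLocalForm.comp_right`). Local coefficients are patched by a partition of unity
(`HasLocalForm.of_local`), so their uniqueness is never needed. This settles functions, operators of
each order, and symbols.

For vector fields, an adapted field acts on foliated functions as a first order operator without
zero order term. The kernel of the resulting symbol map consists of the tangent fields
(`adaptedAction_mem_zero_iff`): the differentials of smooth functions separate tangent vectors on a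
dense set of points (`exists_separating`), and continuity does the rest.

For surjectivity (`exists_adapted_symbol`), the first order part of an operator is a family of
fields on the `U_i`, invariant under changes of charts by the same density argument. Its complete
lift to tuples of vectors commutes with changes of charts but need not be tangent to the orthonormal
frames. Subtracting half of the variation of the Gram matrix makes it tangent, and isometries
respect this correction. So the lift descends to a field on the resolution (`InvariantField.lift`).
-/

/-! ### Local analysis -/

section LocalAnalysis

/-- Smooth local selections of a family of convex sets over an open set can be patched. -/
theorem exists_contDiffOn_forall_mem_convex_of_local {E F : Type*} [NormedAddCommGroup E]
    [NormedSpace ℝ E] [FiniteDimensional ℝ E] [NormedAddCommGroup F] [NormedSpace ℝ F]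
    {O : Set E} (hO : IsOpen O) (t : E → Set F) (ht : ∀ x, Convex ℝ (t x))
    (h : ∀ x ∈ O, ∃ N, IsOpen N ∧ x ∈ N ∧ ∃ g : E → F, ContDiffOn ℝ ∞ g N ∧
      ∀ y ∈ N, y ∈ O → g y ∈ t y) :
    ∃ g : E → F, ContDiffOn ℝ ∞ g O ∧ ∀ x ∈ O, g x ∈ t x := by
  classical
  -- The partition of unity lives on `O` regarded as a manifold, which is σ-compact; the local data
  -- need not extend beyond `O`.
  let M : TopologicalSpace.Opens E := ⟨O, hO⟩
  have : ProperSpace E := FiniteDimensional.proper ℝ E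
  have : LocallyCompactSpace M := hO.locallyCompactSpace
  have : SigmaCompactSpace M := sigmaCompactSpace_of_locallyCompact_secondCountable
  obtain ⟨g, hg⟩ := exists_contMDiffMap_forall_mem_convex_of_local (n := ((⊤ : ℕ∞) : ℕ∞))
    (modelWithCornersSelf ℝ E) (M := M) (t := fun x => t x) (fun x => ht x) (by
      intro x
      obtain ⟨N, hN, hxN, g, hg, hgt⟩ := h x x.2
      refine ⟨Subtype.val ⁻¹' N, (hN.preimage continuous_subtype_val).mem_nhds hxN,
        fun y => g y, ?_, fun y hy => hgt y hy y.2⟩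
      exact (contMDiffOn_iff_contDiffOn.2 hg).comp contMDiff_subtype_val.contMDiffOn
        fun y hy => hy)
  refine ⟨fun x => if hx : x ∈ O then g ⟨x, hx⟩ else 0, fun x hx => ?_, fun x hx => ?_⟩
  · refine ContDiffAt.contDiffWithinAt ?_
    rw [← contMDiffAt_iff_contDiffAt]
    have := g.contMDiff.contMDiffAt (x := (⟨x, hx⟩ : M))
    refine (contMDiffAt_subtype_iff (U := M) (x := ⟨x, hx⟩)).1 ?_
    refine this.congr_of_eventuallyEq (Filter.Eventually.of_forall fun y => ?_)
    exact dif_pos y.2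
  · simp only [dif_pos hx]
    exact hg ⟨x, hx⟩

/-- The coefficient vectors valid at a given point, for all parameters at once, solve a system of
affine equations and so form a convex set. Local coefficients can therefore be averaged, even where
they are not determined by the operator. -/
theorem HasLocalForm.of_local {n k : ℕ} {T : Type*} {B : Set (Euc n)} (hB : IsOpen B)
    {F G : T → Euc n → ℝ}
    (h : ∀ y ∈ B, ∃ B', IsOpen B' ∧ y ∈ B' ∧ HasLocalForm k B' F G) : HasLocalForm k B F G := by
  let S : Euc n → Set (multiIndices n k → ℝ) := fun y =>
    {c | ∀ t, G t y = ∑ α : multiIndices n k, c α * _root_.multiDeriv α.1 (F t) y}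
  have hconv : ∀ y, Convex ℝ (S y) := by
    intro y c hc d hd a b _ _ hab t
    have h1 := hc t
    have h2 := hd t
    calc G t y = a * G t y + b * G t y := by rw [← add_mul, hab, one_mul]
      _ = _ := by
        conv_lhs => rw [h1]
        conv_lhs => enter [2]; rw [← h1, h2]
        simp only [Finset.mul_sum, ← Finset.sum_add_distrib, Pi.add_apply, Pi.smul_apply,
          smul_eq_mul]
        exact Finset.sum_congr rfl fun α _ => by ring
  have hloc : ∀ y ∈ B, ∃ N, IsOpen N ∧ y ∈ N ∧ ∃ g : Euc n → multiIndices n k → ℝ,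
      ContDiffOn ℝ ∞ g N ∧ ∀ x ∈ N, x ∈ B → g x ∈ S x := by
    intro y hy
    obtain ⟨B', hB', hyB', c, hc, hG⟩ := h y hy
    refine ⟨B', hB', hyB', fun x α => c α.1 x, contDiffOn_pi.2 fun α => hc α, fun x hx _ t => ?_⟩
    rw [hG t x hx]
    exact (Finset.sum_coe_sort (multiIndices n k) fun α => c α x * _root_.multiDeriv α (F t) x).symm
  obtain ⟨g, hg, hgt⟩ := exists_contDiffOn_forall_mem_convex_of_local hB S hconv hloc
  classical
  refine ⟨fun α y => if hα : α ∈ multiIndices n k then g y ⟨α, hα⟩ else 0, fun α => ?_,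
    fun t x hx => ?_⟩
  · by_cases hα : α ∈ multiIndices n k
    · simp only [dif_pos hα]
      exact contDiffOn_pi.1 hg ⟨α, hα⟩
    · simp only [dif_neg hα]
      exact contDiffOn_const
  · rw [hgt x hx t, ← Finset.sum_attach (multiIndices n k)]
    refine Finset.sum_congr rfl fun α _ => ?_
    simp only [dif_pos α.2]

theorem ContinuousLinearMap.isInvertible_of_injective {E F : Type*} [NormedAddCommGroup E]
    [NormedSpace ℝ E] [FiniteDimensional ℝ E] [NormedAddCommGroup F] [NormedSpace ℝ F]
    [FiniteDimensional ℝ F] (hd : Module.finrank ℝ E = Module.finrank ℝ F) (L : E →L[ℝ] F)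
    (hL : Function.Injective L) : L.IsInvertible :=
  ⟨(LinearMap.linearEquivOfInjective (L : E →ₗ[ℝ] F) hL hd).toContinuousLinearEquiv, by
    ext x
    rfl⟩

/-! ### Differential operators under local diffeomorphisms -/

section ChangeOfVariables

variable {n : ℕ} {T : Type*} {k : ℕ} {B U : Set (Euc n)} {F E : T → Euc n → ℝ}
  {σ : Euc n → Euc n}

/-- This is the chain rule solved for the inner derivative: `(∂_j E) ∘ σ = ∑_l w_l ∂_l (E ∘ σ)`,
where `w = (Dσ)⁻¹ e_j` depends smoothly on the point. -/
theorem HasLocalForm.partialDeriv_comp (hB : IsOpen B) (hU : IsOpen U)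
    (hσ : ContDiffOn ℝ ∞ σ B) (hm : Set.MapsTo σ B U)
    (hinj : ∀ y ∈ B, Function.Injective (fderiv ℝ σ y))
    (hF : ∀ t, ContDiffOn ℝ ∞ (F t) U) (hE : ∀ t, ContDiffOn ℝ ∞ (E t) U)
    (h : HasLocalForm k B (fun t => F t ∘ σ) (fun t => E t ∘ σ)) (j : Fin n) :
    HasLocalForm (k + 1) B (fun t => F t ∘ σ) (fun t => _root_.partialDeriv j (E t) ∘ σ) := by
  have hinv : ∀ y ∈ B, (fderiv ℝ σ y).IsInvertible := fun y hy =>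
    ContinuousLinearMap.isInvertible_of_injective rfl _ (hinj y hy)
  have hc : ContDiffOn ℝ ∞ (fun y => (fderiv ℝ σ y).inverse (EuclideanSpace.single j 1)) B := by
    have h1 : ContDiffOn ℝ ∞ (fderiv ℝ σ) B := hσ.fderiv_of_isOpen hB (by simp)
    have h2 : ContDiffOn ℝ ∞ (fun y => (fderiv ℝ σ y).inverse) B := fun y hy =>
      ((hinv y hy).contDiffAt_map_inverse).comp_contDiffWithinAt y (h1 y hy)
    exact h2.clm_apply contDiffOn_const
  have key : HasLocalForm (k + 1) B (fun t => F t ∘ σ) (fun t => ∑ l,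
      (fun y => (fderiv ℝ σ y).inverse (EuclideanSpace.single j 1) l)
        * _root_.partialDeriv l (E t ∘ σ)) := by
    refine HasLocalForm.sum _ fun l _ => ?_
    exact (h.partialDeriv hB (fun t => (hF t).comp hσ hm) l).mul_left (contDiffOn_euclidean.1 hc l)
  refine key.congr_right fun t y hy => ?_
  have h1 : DifferentiableAt ℝ (E t) (σ y) :=
    ((hE t).contDiffAt (hU.mem_nhds (hm hy))).differentiableAt (by simp)
  have h2 : DifferentiableAt ℝ σ y := (hσ.contDiffAt (hB.mem_nhds hy)).differentiableAt (by simp)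
  obtain ⟨e, he⟩ := hinv y hy
  set w := (fderiv ℝ σ y).inverse (EuclideanSpace.single j 1) with hw
  have hw' : fderiv ℝ σ y w = EuclideanSpace.single j 1 := by
    rw [hw, ← he, ContinuousLinearMap.inverse_equiv]
    simp
  have hsum : w = ∑ l, w l • EuclideanSpace.single l (1 : ℝ) := by
    ext i
    simp [Pi.single_apply]
  simp only [Finset.sum_apply, Pi.mul_apply, Function.comp_apply, _root_.partialDeriv]
  rw [fderiv_comp y h1 h2, ← hw']
  conv_lhs => rw [hsum]
  rw [hw', ← hw]
  simp

/-- Each derivative `∂^α` pulls back to an operator of order `|α|` by iterating the chain rule. Only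
the differential of `σ` has to be injective, not `σ` itself. -/
theorem HasLocalForm.comp_right {G : T → Euc n → ℝ} (hB : IsOpen B) (hU : IsOpen U)
    (hσ : ContDiffOn ℝ ∞ σ B) (hm : Set.MapsTo σ B U)
    (hinj : ∀ y ∈ B, Function.Injective (fderiv ℝ σ y))
    (hF : ∀ t, ContDiffOn ℝ ∞ (F t) U) (h : HasLocalForm k U F G) :
    HasLocalForm k B (fun t => F t ∘ σ) (fun t => G t ∘ σ) := by
  have h0 : HasLocalForm 0 B (fun t => F t ∘ σ) (fun t => F t ∘ σ) :=
    HasLocalForm.of_zero (a := fun _ => 1) contDiffOn_const fun t x _ => by simp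
  have hit : ∀ (m l : ℕ) (j : Fin n) (E : T → Euc n → ℝ), (∀ t, ContDiffOn ℝ ∞ (E t) U) →
      HasLocalForm l B (fun t => F t ∘ σ) (fun t => E t ∘ σ) →
      HasLocalForm (l + m) B (fun t => F t ∘ σ)
        (fun t => (_root_.partialDeriv j)^[m] (E t) ∘ σ) := by
    intro m l j E hE hl
    induction m with
    | zero => simpa using hl
    | succ m ih =>
      simp only [Function.iterate_succ_apply']
      exact ih.partialDeriv_comp hB hU hσ hm hinj hF (fun t => iterate_contDiffOn hU j m (hE t)) j
  have key : ∀ (α : Fin n → ℕ) (l : List (Fin n)), HasLocalForm (l.map α).sum B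
      (fun t => F t ∘ σ)
      (fun t => l.foldr (fun j g => (_root_.partialDeriv j)^[α j] g) (F t) ∘ σ) := by
    intro α l
    induction l with
    | nil => simpa using h0
    | cons a l ih =>
      have := hit (α a) _ a _ (fun t => foldr_contDiffOn hU α l (hF t)) ih
      rw [List.map_cons, List.sum_cons, add_comm (α a)]
      exact this
  have key' : ∀ α : Fin n → ℕ, HasLocalForm (∑ j, α j) B (fun t => F t ∘ σ)
      (fun t => _root_.multiDeriv α (F t) ∘ σ) := by
    intro α
    have := key α (List.finRange n)
    rwa [← List.ofFn_eq_map, List.sum_ofFn] at this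
  obtain ⟨c, hc, hG⟩ := h
  have h1 : HasLocalForm k B (fun t => F t ∘ σ) (fun t => ∑ α ∈ multiIndices n k,
      (c α ∘ σ) * (_root_.multiDeriv α (F t) ∘ σ)) := by
    refine HasLocalForm.sum _ fun α hα => ?_
    exact ((key' α).mono (mem_multiIndices.1 hα)).mul_left ((hc α).comp hσ hm)
  refine h1.congr_right fun t x hx => ?_
  simp [hG t (σ x) (hm hx)]

end ChangeOfVariables

/-! ### Generic alternatives and rigidity of periodic maps -/

/-- Finitely many pairs of continuous functions: on some smaller open set the members of each pair
agree identically or differ everywhere. -/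
theorem exists_open_eqOn_or_ne {E F ι : Type*} [TopologicalSpace E] [TopologicalSpace F] [T2Space F]
    (s : Finset ι) (f g : ι → E → F) {N : Set E} (hN : IsOpen N) (hne : N.Nonempty)
    (hf : ∀ i ∈ s, ContinuousOn (f i) N) (hg : ∀ i ∈ s, ContinuousOn (g i) N) :
    ∃ N' ⊆ N, IsOpen N' ∧ N'.Nonempty ∧ ∀ i ∈ s,
      Set.EqOn (f i) (g i) N' ∨ ∀ z ∈ N', f i z ≠ g i z := by
  classical
  induction s using Finset.induction_on with
  | empty => exact ⟨N, subset_rfl, hN, hne, by simp⟩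
  | insert a s ha ih =>
    obtain ⟨N', hsub, hN', hne', h⟩ := ih
      (fun i hi => hf i (Finset.mem_insert_of_mem hi))
      (fun i hi => hg i (Finset.mem_insert_of_mem hi))
    by_cases hall : Set.EqOn (f a) (g a) N'
    · refine ⟨N', hsub, hN', hne', fun i hi => ?_⟩
      rcases Finset.mem_insert.1 hi with rfl | hi
      · exact Or.inl hall
      · exact h i hi
    · obtain ⟨z, hz, hzne⟩ : ∃ z ∈ N', f a z ≠ g a z := by
        simpa [Set.EqOn] using hall
      have hopen : IsOpen (N' ∩ (fun z => (f a z, g a z)) ⁻¹' {p | p.1 ≠ p.2}) :=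
        (((hf a (Finset.mem_insert_self a s)).mono hsub).prodMk
          ((hg a (Finset.mem_insert_self a s)).mono hsub)).isOpen_inter_preimage hN'
          (isOpen_ne_fun continuous_fst continuous_snd)
      refine ⟨_, Set.inter_subset_left.trans hsub, hopen, ⟨z, hz, hzne⟩, fun i hi => ?_⟩
      rcases Finset.mem_insert.1 hi with rfl | hi
      · exact Or.inr fun w hw => hw.2
      · exact (h i hi).imp (fun h => h.mono Set.inter_subset_left) fun h w hw => h w hw.1

/-- A periodic smooth map which agrees with the identity to first order at a fixed point is the
identity near that point. -/
theorem eventually_eq_self_of_periodic {E : Type*} [NormedAddCommGroup E] [NormedSpace ℝ E]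
    [CompleteSpace E] {U : Set E} (hU : IsOpen U) {g : E → E} (hg : ContDiffOn ℝ ∞ g U)
    {m : ℕ} (hm0 : 0 < m) (hper : ∀ z ∈ U, g^[m] z = z) {x : E}
    (hx : x ∈ U) (hgx : g x = x) (hd : fderiv ℝ g x = ContinuousLinearMap.id ℝ E) :
    ∀ᶠ z in 𝓝 x, g z = z := by
  have hgd : HasStrictFDerivAt g (ContinuousLinearMap.id ℝ E) x := by
    have := (hg.contDiffAt (hU.mem_nhds hx)).hasStrictFDerivAt (by simp)
    rwa [hd] at this
  have hit : ∀ k : ℕ, g^[k] x = x := fun k => Function.iterate_fixed hgx k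
  have hitd : ∀ k : ℕ, HasStrictFDerivAt g^[k] (ContinuousLinearMap.id ℝ E) x := by
    intro k
    induction k with
    | zero => exact hasStrictFDerivAt_id x
    | succ k ih =>
      rw [Function.iterate_succ']
      have h1 : HasStrictFDerivAt g (ContinuousLinearMap.id ℝ E) (g^[k] x) := by rwa [hit k]
      exact h1.comp x ih
  -- The orbit sum `T = ∑_{k<m} g^k` has derivative `m • id` at `x`, so it is injective near `x`.
  -- Periodicity gives `T ∘ g = T`, and injectivity then forces `g z = z`.
  have hT : HasStrictFDerivAt (fun z => ∑ k ∈ Finset.range m, g^[k] z)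
      (∑ _k ∈ Finset.range m, ContinuousLinearMap.id ℝ E) x :=
    HasStrictFDerivAt.fun_sum fun k _ => hitd k
  have hm' : (m : ℝ) ≠ 0 := by exact_mod_cast hm0.ne'
  let e : E ≃L[ℝ] E := ContinuousLinearEquiv.smulLeft (Units.mk0 (m : ℝ) hm')
  have he : (∑ _k ∈ Finset.range m, ContinuousLinearMap.id ℝ E) = (e : E →L[ℝ] E) := by
    ext v
    simp [e, Units.smul_def, Nat.cast_smul_eq_nsmul]
  rw [he] at hT
  obtain ⟨s, hs, hsx, hinj⟩ : ∃ s, IsOpen s ∧ x ∈ s ∧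
      Set.InjOn (fun z => ∑ k ∈ Finset.range m, g^[k] z) s :=
    ⟨(hT.toOpenPartialHomeomorph _).source, (hT.toOpenPartialHomeomorph _).open_source,
      hT.mem_toOpenPartialHomeomorph_source, (hT.toOpenPartialHomeomorph _).injOn⟩
  have hcont : Filter.Tendsto g (𝓝 x) (𝓝 x) := by
    have := hgd.hasFDerivAt.continuousAt
    rwa [ContinuousAt, hgx] at this
  filter_upwards [hs.mem_nhds hsx, hcont (hs.mem_nhds hsx), hU.mem_nhds hx] with z hz hgz hzU
  refine hinj hgz hz ?_
  show ∑ k ∈ Finset.range m, g^[k] (g z) = ∑ k ∈ Finset.range m, g^[k] z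
  -- The sum of `m + 1` iterates is split off at either end; the two extreme terms, `g^m z` and `z`,
  -- cancel.
  have h1 := Finset.sum_range_succ (fun k => g^[k] z) m
  rw [Finset.sum_range_succ', hper z hzU] at h1
  simpa using h1

end LocalAnalysis

section Orbifold

namespace RiemannianOrbifold

variable {n : ℕ} {X ι : Type*} [TopologicalSpace X] (V : RiemannianOrbifold n X ι)

/-! ### Frames and the lifts of changes of charts -/

/-- The lift `(x, u) ↦ (φ x, φ_* u)` of a map to tuples of tangent vectors. -/
noncomputable def jetLift (φ : Euc n → Euc n) (z : Euc n × (Fin n → Euc n)) :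
    Euc n × (Fin n → Euc n) :=
  (φ z.1, fun a => fderiv ℝ φ z.1 (z.2 a))

theorem contDiffOn_jetLift {φ : Euc n → Euc n} {S : Set (Euc n)} (hS : IsOpen S)
    (hφ : ContDiffOn ℝ ∞ φ S) : ContDiffOn ℝ ∞ (jetLift φ) (S ×ˢ Set.univ) := by
  have hm : Set.MapsTo (Prod.fst : Euc n × (Fin n → Euc n) → Euc n) (S ×ˢ Set.univ) S :=
    fun z hz => hz.1
  have h1 : ContDiffOn ℝ ∞ (fun z : Euc n × (Fin n → Euc n) => φ z.1) (S ×ˢ Set.univ) :=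
    hφ.comp contDiff_fst.contDiffOn hm
  have h2 : ContDiffOn ℝ ∞ (fun z : Euc n × (Fin n → Euc n) => fderiv ℝ φ z.1)
      (S ×ˢ Set.univ) :=
    (hφ.fderiv_of_isOpen hS (m := ∞) (by simp)).comp contDiff_fst.contDiffOn hm
  refine h1.prodMk (contDiffOn_pi.2 fun a => h2.clm_apply ?_)
  fun_prop

variable {V} in
theorem IsChange.jetLift_mem {i j : ι} {φ : OpenPartialHomeomorph (Euc n) (Euc n)}
    (h : V.IsChange i j φ) {z : Euc n × (Fin n → Euc n)} (hz : z ∈ V.frames i)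
    (hs : z.1 ∈ φ.source) : jetLift φ z ∈ V.frames j :=
  ⟨h.2.1 (φ.map_source hs), fun a b => (h.2.2.1.metric _ hs _ _).trans (hz.2 a b)⟩

theorem cls_eq_cls_iff {i j : ι} (u : V.frames i) (w : V.frames j) :
    V.cls i u = V.cls j w ↔ ∃ φ : OpenPartialHomeomorph (Euc n) (Euc n), V.IsChange i j φ ∧
      u.1.1 ∈ φ.source ∧ w.1 = jetLift φ u.1 := by
  refine Quotient.eq.trans (exists_congr fun φ => and_congr_right fun _ => and_congr_right
    fun _ => ?_)
  exact ⟨fun h => Prod.ext h.1 (funext h.2), fun h =>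
    ⟨congrArg Prod.fst h, fun c => congrFun (congrArg Prod.snd h) c⟩⟩

variable {V} in
theorem IsChange.cls_jetLift {i j : ι} {φ : OpenPartialHomeomorph (Euc n) (Euc n)}
    (h : V.IsChange i j φ) (z : V.frames i) (hs : z.1.1 ∈ φ.source) :
    V.cls j ⟨jetLift φ z.1, h.jetLift_mem z.2 hs⟩ = V.cls i z :=
  ((V.cls_eq_cls_iff z _).2 ⟨φ, h, hs, rfl⟩).symm

theorem proj_cls (i : ι) (u : V.frames i) : V.proj (V.cls i u) = V.q i u.1.1 := rfl

theorem exists_cls_eq (v : V.Resolution) : ∃ i, ∃ u : V.frames i, V.cls i u = v := by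
  obtain ⟨⟨i, u⟩, rfl⟩ := Quotient.exists_rep v
  exact ⟨i, u, rfl⟩

theorem linearIndependent_frame {i : ι} {z : Euc n × (Fin n → Euc n)} (hz : z ∈ V.frames i) :
    LinearIndependent ℝ z.2 := by
  rw [Fintype.linearIndependent_iff]
  intro g hg b
  have h1 : V.h i z.1 (∑ a, g a • z.2 a) (z.2 b) = g b := by
    rw [map_sum, sum_apply]
    simp [hz.2]
  rw [hg] at h1
  simpa using h1.symm

theorem span_frame {i : ι} {z : Euc n × (Fin n → Euc n)} (hz : z ∈ V.frames i) :
    Submodule.span ℝ (Set.range z.2) = ⊤ :=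
  (V.linearIndependent_frame hz).span_eq_top_of_card_eq_finrank' (by simp)

theorem eq_of_frame {i : ι} {z : Euc n × (Fin n → Euc n)} (hz : z ∈ V.frames i)
    {F : Type*} [NormedAddCommGroup F] [NormedSpace ℝ F] {L M : Euc n →L[ℝ] F}
    (h : ∀ a, L (z.2 a) = M (z.2 a)) : L = M :=
  ContinuousLinearMap.coe_injective (LinearMap.ext_on_range (V.span_frame hz) h)

theorem eq_zero_of_frame {i : ι} {z : Euc n × (Fin n → Euc n)} (hz : z ∈ V.frames i)
    {w : Euc n} (h : ∀ a, V.h i z.1 (z.2 a) w = 0) : w = 0 := by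
  by_contra hw
  have h1 : (V.h i z.1).flip w = 0 := V.eq_of_frame hz fun a => by simpa using h a
  have h2 := congrArg (fun L : Euc n →L[ℝ] ℝ => L w) h1
  exact (V.pos_h i z.1 hz.1 w hw).ne' (by simpa using h2)

/-- An orthogonal basis of the form `h_i x` can be normalised because the form is positive definite.
This makes the projection of the resolution surjective. -/
theorem exists_frame {i : ι} {x : Euc n} (hx : x ∈ V.U i) : ∃ u, (x, u) ∈ V.frames i := by
  let B : LinearMap.BilinForm ℝ (Euc n) := LinearMap.mk₂ ℝ (fun v w => V.h i x v w)
    (by simp) (by simp) (by simp) (by simp)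
  have hB : LinearMap.IsSymm B := ⟨fun v w => V.symm_h i x hx v w⟩
  obtain ⟨v, hv⟩ := LinearMap.BilinForm.exists_orthogonal_basis hB
  let e : Fin n ≃ Fin (Module.finrank ℝ (Euc n)) := finCongr (by simp)
  have hpos : ∀ a, 0 < V.h i x (v a) (v a) := fun a => V.pos_h i x hx _ (v.ne_zero a)
  refine ⟨fun a => (√(V.h i x (v (e a)) (v (e a))))⁻¹ • v (e a), hx, fun a b => ?_⟩
  by_cases hab : a = b
  · subst hab
    have h1 := Real.mul_self_sqrt (hpos (e a)).le
    have h2 := (Real.sqrt_pos.2 (hpos (e a))).ne'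
    simp only [map_smul, smul_apply, smul_eq_mul, if_pos]
    rw [← mul_assoc, ← mul_inv, h1, inv_mul_cancel₀ (hpos (e a)).ne']
  · have h1 : V.h i x (v (e a)) (v (e b)) = 0 := hv (fun h => hab (e.injective h))
    simp [h1, hab]

theorem proj_surjective : Function.Surjective V.proj := by
  intro p
  obtain ⟨i, x, hx, rfl⟩ := V.cover p
  obtain ⟨u, hu⟩ := V.exists_frame hx
  exact ⟨V.cls i ⟨_, hu⟩, rfl⟩

/-! ### The groups `Γ_i` and local injectivity -/

/-- The action of an element of `Γ_i` as a local homeomorphism of `ℝⁿ`. -/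
noncomputable def gam (i : ι) (g : V.Γ i) : OpenPartialHomeomorph (Euc n) (Euc n) :=
  (V.isometry_Γ i g g.2).choose

theorem gam_source (i : ι) (g : V.Γ i) : (V.gam i g).source = V.U i :=
  (V.isometry_Γ i g g.2).choose_spec.1

theorem gam_target (i : ι) (g : V.Γ i) : (V.gam i g).target = V.U i :=
  (V.isometry_Γ i g g.2).choose_spec.2.1

theorem gam_isometry (i : ι) (g : V.Γ i) :
    IsRiemannianIsometry (V.h i) (V.h i) (V.gam i g) :=
  (V.isometry_Γ i g g.2).choose_spec.2.2.1

theorem gam_apply (i : ι) (g : V.Γ i) (x : V.U i) :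
    V.gam i g x = ((g : Equiv.Perm (V.U i)) x : Euc n) :=
  ((V.isometry_Γ i g g.2).choose_spec.2.2.2 x).symm

theorem gam_mem (i : ι) (g : V.Γ i) {x : Euc n} (hx : x ∈ V.U i) : V.gam i g x ∈ V.U i := by
  rw [V.gam_apply i g ⟨x, hx⟩]
  exact Subtype.prop _

theorem contDiffOn_gam (i : ι) (g : V.Γ i) : ContDiffOn ℝ ∞ (V.gam i g) (V.U i) := by
  have := (V.gam_isometry i g).contDiffOn
  rwa [V.gam_source] at this

theorem q_eq_q_iff (i : ι) {x y : Euc n} (hx : x ∈ V.U i) (hy : y ∈ V.U i) :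
    V.q i x = V.q i y ↔ ∃ g : V.Γ i, V.gam i g x = y := by
  rw [V.q_eq_iff i ⟨x, hx⟩ ⟨y, hy⟩]
  constructor
  · rintro ⟨g, hg, h⟩
    exact ⟨⟨g, hg⟩, by rw [V.gam_apply i ⟨g, hg⟩ ⟨x, hx⟩, h]⟩
  · rintro ⟨g, h⟩
    exact ⟨g, g.2, Subtype.ext (by rw [← V.gam_apply i g ⟨x, hx⟩, h])⟩

theorem gam_iterate (i : ι) (g : V.Γ i) (m : ℕ) (x : V.U i) :
    (V.gam i g)^[m] x = (((g : Equiv.Perm (V.U i)) ^ m) x : Euc n) := by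
  induction m with
  | zero => rfl
  | succ m ih => rw [Function.iterate_succ_apply', ih, V.gam_apply, pow_succ']; rfl

/-- Rigidity comes from the finite order of `g`, through the orbit sum argument, and not from
geodesics. -/
theorem eventually_gam_eq (i : ι) (g : V.Γ i) {x : Euc n} (hx : x ∈ V.U i)
    (hgx : V.gam i g x = x) (hd : fderiv ℝ (V.gam i g) x = ContinuousLinearMap.id ℝ (Euc n)) :
    ∀ᶠ z in 𝓝 x, V.gam i g z = z := by
  have := V.finite_Γ i
  refine eventually_eq_self_of_periodic (V.isOpen_U i) (V.contDiffOn_gam i g)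
    (orderOf_pos g) (fun z hz => ?_) hx hgx hd
  have h1 := V.gam_iterate i g (orderOf g) ⟨z, hz⟩
  have h2 : (g : Equiv.Perm (V.U i)) ^ orderOf g = 1 := by
    rw [← Subgroup.coe_pow, pow_orderOf_eq_one, Subgroup.coe_one]
  rw [h1, h2]
  rfl

theorem isChange_gam (i : ι) (g : V.Γ i) : V.IsChange i i (V.gam i g) := by
  refine ⟨(V.gam_source i g).le, (V.gam_target i g).le, V.gam_isometry i g, fun z hz => ?_⟩
  rw [V.gam_source] at hz
  exact ((V.q_eq_q_iff i hz (V.gam_mem i g hz)).2 ⟨g, rfl⟩).symm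

/-- The changes of charts of the orbifold structure need not map `x` to `y`. The image of `x` and
the point `y` lie in one fibre of `q_j`, so following with an element of `Γ_j` corrects this. -/
theorem exists_isChange_map_eq {i j : ι} {x y : Euc n} (hx : x ∈ V.U i) (hy : y ∈ V.U j)
    (h : V.q i x = V.q j y) : ∃ φ : OpenPartialHomeomorph (Euc n) (Euc n),
      V.IsChange i j φ ∧ x ∈ φ.source ∧ φ x = y := by
  obtain ⟨χ, hxs, -, hs, ht, -, hχ, hq⟩ := V.exists_change i j x hx y hy h
  have hχc : V.IsChange i j χ := ⟨hs, ht, hχ, hq⟩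
  have hm : χ x ∈ V.U j := ht (χ.map_source hxs)
  obtain ⟨g, hg⟩ := (V.q_eq_q_iff j hm hy).1 ((hq x hxs).trans h)
  refine ⟨χ.trans (V.gam j g), hχc.trans (V.isChange_gam j g), ?_, hg⟩
  rw [OpenPartialHomeomorph.trans_source, V.gam_source]
  exact ⟨hxs, hm⟩

variable {V} in
/-- A change of charts from `U_i` to itself has the first order jet of an element of `Γ_i`. -/
theorem IsChange.exists_gam {i : ι} {φ : OpenPartialHomeomorph (Euc n) (Euc n)}
    (h : V.IsChange i i φ) {x : Euc n} (hx : x ∈ φ.source) :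
    ∃ g : V.Γ i, φ x = V.gam i g x ∧ fderiv ℝ φ x = fderiv ℝ (V.gam i g) x := by
  have := V.finite_Γ i
  have := Fintype.ofFinite (V.Γ i)
  by_contra hcon
  push Not at hcon
  have hxU : x ∈ V.U i := h.1 hx
  have hφ := h.2.2.1.contDiffOn
  -- If the 1-jet of `φ` at `x` differs from that of every element of the finite group, it does so
  -- on a whole neighbourhood of `x`.
  have hne : ∀ g : V.Γ i, ∀ᶠ z in 𝓝 x,
      (φ z, fderiv ℝ φ z) ≠ (V.gam i g z, fderiv ℝ (V.gam i g) z) := by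
    intro g
    have h1 : ContinuousAt (fun z => (φ z, fderiv ℝ φ z)) x :=
      ((hφ.continuousOn.prodMk ((hφ.fderiv_of_isOpen φ.open_source (m := ∞)
        (by simp)).continuousOn)).continuousAt (φ.open_source.mem_nhds hx))
    have h2 : ContinuousAt (fun z => (V.gam i g z, fderiv ℝ (V.gam i g) z)) x :=
      (((V.contDiffOn_gam i g).continuousOn.prodMk (((V.contDiffOn_gam i g).fderiv_of_isOpen
        (V.isOpen_U i) (m := ∞) (by simp)).continuousOn)).continuousAt
        ((V.isOpen_U i).mem_nhds hxU))
    refine (h1.prodMk h2).eventually (IsOpen.mem_nhds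
      (isOpen_ne_fun continuous_fst continuous_snd) (?_ : _ ≠ _))
    intro heq
    exact hcon g (congrArg Prod.fst heq) (congrArg Prod.snd heq)
  obtain ⟨N, hN, hNo, hxN⟩ := mem_nhds_iff.1
    (Filter.inter_mem (Filter.eventually_all.2 hne) (φ.open_source.mem_nhds hx))
  -- On a smaller open set each group element agrees with `φ` everywhere or nowhere. Since `φ`
  -- preserves the fibres of `q_i`, some element agrees at a point, hence on an open set, and there
  -- the 1-jets coincide: a contradiction.
  obtain ⟨N', hN'N, hN'o, ⟨z, hz⟩, hN'⟩ := exists_open_eqOn_or_ne (Finset.univ : Finset (V.Γ i))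
    (fun _ => φ) (fun g => V.gam i g) hNo ⟨x, hxN⟩
    (fun _ _ => hφ.continuousOn.mono fun y hy => (hN hy).2)
    (fun g _ => (V.contDiffOn_gam i g).continuousOn.mono fun y hy => h.1 (hN hy).2)
  have hzs : z ∈ φ.source := (hN (hN'N hz)).2
  obtain ⟨g, hg⟩ := (V.q_eq_q_iff i (h.1 hzs) (h.2.1 (φ.map_source hzs))).1 (h.2.2.2 z hzs).symm
  have heq : Set.EqOn φ (V.gam i g) N' :=
    (hN' g (Finset.mem_univ g)).resolve_right fun hn => hn z hz hg.symm
  have hev : φ =ᶠ[𝓝 z] V.gam i g := Filter.eventuallyEq_of_mem (hN'o.mem_nhds hz) heq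
  exact (hN (hN'N hz)).1 g (Prod.ext hg.symm hev.fderiv_eq)

/-- `Ũ_i → Ṽ` is locally injective. -/
theorem exists_isOpen_injOn_cls {i : ι} {z : Euc n × (Fin n → Euc n)} (hz : z ∈ V.frames i) :
    ∃ O, IsOpen O ∧ z ∈ O ∧ ∀ u w : V.frames i, u.1 ∈ O → w.1 ∈ O →
      V.cls i u = V.cls i w → u = w := by
  have := V.finite_Γ i
  have := Fintype.ofFinite (V.Γ i)
  have key : ∀ g : V.Γ i, ∃ O, IsOpen O ∧ z ∈ O ∧ ∀ w ∈ O, jetLift (V.gam i g) w ∈ O →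
      jetLift (V.gam i g) w = w := by
    intro g
    have hzs : z ∈ V.U i ×ˢ (Set.univ : Set (Fin n → Euc n)) := ⟨hz.1, trivial⟩
    have hc : ContinuousAt (jetLift (V.gam i g)) z :=
      ((contDiffOn_jetLift (V.isOpen_U i) (V.contDiffOn_gam i g)).continuousOn).continuousAt
        (((V.isOpen_U i).prod isOpen_univ).mem_nhds hzs)
    by_cases hgz : jetLift (V.gam i g) z = z
    · have hgz1 : V.gam i g z.1 = z.1 := congrArg Prod.fst hgz
      have hd : fderiv ℝ (V.gam i g) z.1 = ContinuousLinearMap.id ℝ (Euc n) :=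
        V.eq_of_frame hz fun a => congrFun (congrArg Prod.snd hgz) a
      have hev := (V.eventually_gam_eq i g hz.1 hgz1 hd).eventually_nhds
      obtain ⟨N, hN, hNo, hxN⟩ := mem_nhds_iff.1 hev
      refine ⟨Prod.fst ⁻¹' N, hNo.preimage continuous_fst, hxN, fun w hw _ => ?_⟩
      have h1 : ∀ᶠ y in 𝓝 w.1, V.gam i g y = y := hN hw
      have h2 : V.gam i g =ᶠ[𝓝 w.1] id := h1
      refine Prod.ext h1.self_of_nhds (funext fun a => ?_)
      show fderiv ℝ (V.gam i g) w.1 (w.2 a) = w.2 a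
      rw [h2.fderiv_eq, fderiv_id]
      rfl
    · obtain ⟨A, B, hA, hB, hzA, hzB, hAB⟩ := t2_separation hgz
      obtain ⟨N, hN, hNo, hzN⟩ := mem_nhds_iff.1
        (Filter.inter_mem (hc.preimage_mem_nhds (hA.mem_nhds hzA)) (hB.mem_nhds hzB))
      refine ⟨N, hNo, hzN, fun w hw hgw => ?_⟩
      exact absurd (hN hgw).2 (Set.disjoint_left.1 hAB (hN hw).1)
  choose O hO hzO hOg using key
  refine ⟨⋂ g, O g, isOpen_iInter_of_finite hO, Set.mem_iInter.2 hzO, fun u w hu hw huw => ?_⟩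
  -- The lift of a change of charts to frames only sees its 1-jet, so an identification inside one
  -- frame bundle is always made by an element of `Γ_i`.
  obtain ⟨φ, hφ, hus, hwu⟩ := (V.cls_eq_cls_iff u w).1 huw
  obtain ⟨g, hg, hgd⟩ := hφ.exists_gam hus
  have hj : jetLift (V.gam i g) u.1 = w.1 := by
    rw [hwu]
    refine Prod.ext hg.symm (funext fun a => ?_)
    show fderiv ℝ (V.gam i g) u.1.1 (u.1.2 a) = fderiv ℝ φ u.1.1 (u.1.2 a)
    rw [hgd]
  refine Subtype.ext ?_
  rw [← hj]
  refine (hOg g u.1 (Set.mem_iInter.1 hu g) ?_).symm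
  rw [hj]
  exact Set.mem_iInter.1 hw g

/-! ### Topology of the maps from the frame bundles to the resolution -/

theorem continuous_cls (i : ι) : Continuous (V.cls i) :=
  continuous_quotient_mk'.comp continuous_sigmaMk

/-- In each frame bundle the saturation of an open set is the union of its preimages under lifts of
changes of charts, and these lifts are continuous on open domains. -/
theorem isOpenMap_cls (i : ι) : IsOpenMap (V.cls i) := by
  intro O hO
  refine isQuotientMap_quotient_mk'.isOpen_preimage.1 (isOpen_sigma_iff.2 fun j => ?_)
  rw [isOpen_iff_mem_nhds]
  rintro w ⟨u, hu, huw⟩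
  obtain ⟨φ, hφ, hws, huφ⟩ := (V.cls_eq_cls_iff w u).1 huw.symm
  obtain ⟨O', hO', rfl⟩ := isOpen_induced_iff.1 hO
  have hc : ContinuousAt (jetLift φ) w.1 :=
    (contDiffOn_jetLift φ.open_source hφ.2.2.1.contDiffOn).continuousOn.continuousAt
      ((φ.open_source.prod isOpen_univ).mem_nhds ⟨hws, trivial⟩)
  have h1 : jetLift φ ⁻¹' O' ∈ 𝓝 w.1 := hc.preimage_mem_nhds (hO'.mem_nhds (by rw [← huφ]; exact hu))
  have h2 : Prod.fst ⁻¹' φ.source ∈ 𝓝 w.1 :=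
    (φ.open_source.preimage continuous_fst).mem_nhds hws
  filter_upwards [continuous_subtype_val.continuousAt.preimage_mem_nhds (Filter.inter_mem h1 h2)]
    with w' hw'
  exact ⟨⟨jetLift φ w'.1, hφ.jetLift_mem w'.2 hw'.2⟩, hw'.1, hφ.cls_jetLift w' hw'.2⟩

/-! ### Smooth functions separate tangent vectors at a dense set of points -/

/-- This is extension by zero. The set `q_i '' K` is compact, hence closed in the Hausdorff space
`X`. Near it, every chart reads the function through a change of charts to `U_i`; away from it the
function vanishes. -/
theorem exists_smooth_extension [T2Space X] {i : ι} {W : Set (Euc n)} (hW : IsOpen W)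
    (hWU : W ⊆ V.U i) (hinj : Set.InjOn (V.q i) W) {K : Set (Euc n)} (hK : IsCompact K)
    (hKW : K ⊆ W) {φ : Euc n → ℝ} (hφ : ContDiffOn ℝ ∞ φ W) (hφK : ∀ z ∈ W, z ∉ K → φ z = 0) :
    ∃ f : V.smooth, ∀ z ∈ W, (f : X → ℝ) (V.q i z) = φ z := by
  classical
  let f : X → ℝ := fun p => if h : ∃ z ∈ W, V.q i z = p then φ h.choose else 0
  have hf : ∀ z ∈ W, f (V.q i z) = φ z := by
    intro z hz
    have h : ∃ z' ∈ W, V.q i z' = V.q i z := ⟨z, hz, rfl⟩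
    show (if h : ∃ z' ∈ W, V.q i z' = V.q i z then φ h.choose else 0) = φ z
    rw [dif_pos h, hinj h.choose_spec.1 hz h.choose_spec.2]
  have hf0 : ∀ p, p ∉ V.q i '' K → f p = 0 := by
    intro p hp
    by_cases h : ∃ z ∈ W, V.q i z = p
    · obtain ⟨z, hz, rfl⟩ := h
      rw [hf z hz]
      exact hφK z hz fun hzK => hp ⟨z, hzK, rfl⟩
    · exact dif_neg h
  refine ⟨⟨f, V.isSmooth_iff.2 fun j y hy => ContDiffAt.contDiffWithinAt ?_⟩, hf⟩
  by_cases hyK : V.q j y ∈ V.q i '' K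
  · obtain ⟨z, hz, hzy⟩ := hyK
    obtain ⟨χ, hχ, hys, rfl⟩ := V.exists_isChange_map_eq hy (hWU (hKW hz)) hzy.symm
    have h1 : ContDiffAt ℝ ∞ χ y := hχ.2.2.1.contDiffOn.contDiffAt (χ.open_source.mem_nhds hys)
    have h2 : ContDiffAt ℝ ∞ φ (χ y) := hφ.contDiffAt (hW.mem_nhds (hKW hz))
    refine (h2.comp y h1).congr_of_eventuallyEq ?_
    filter_upwards [χ.open_source.mem_nhds hys,
      h1.continuousAt.preimage_mem_nhds (hW.mem_nhds (hKW hz))] with w hw hw'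
    rw [Function.comp_apply, Function.comp_apply, ← hχ.2.2.2 w hw, hf _ hw']
  · have hcl : IsClosed (V.q i '' K) :=
      (hK.image_of_continuousOn ((V.continuousOn_q i).mono (hKW.trans hWU))).isClosed
    have hc : ContinuousAt (V.q j) y :=
      (V.continuousOn_q j).continuousAt ((V.isOpen_U j).mem_nhds hy)
    refine (contDiffAt_const (c := (0 : ℝ))).congr_of_eventuallyEq ?_
    filter_upwards [hc.preimage_mem_nhds (hcl.isOpen_compl.mem_nhds hyK)] with w hw
    exact hf0 _ hw

/-- The points at which the differentials of smooth functions separate tangent vectors are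
dense in the charts. -/
theorem exists_separating [T2Space X] {i : ι} {N : Set (Euc n)} (hN : IsOpen N)
    (hne : N.Nonempty) (hNU : N ⊆ V.U i) :
    ∃ x ∈ N, ∀ v, (∀ f : V.smooth, fderiv ℝ ((f : X → ℝ) ∘ V.q i) x v = 0) → v = 0 := by
  have := V.finite_Γ i
  have := Fintype.ofFinite (V.Γ i)
  -- On `N'` each group element is the identity or has no fixed point. Either way a small enough
  -- ball around `x` meets its own image only in points that are not moved, so `q_i` is injective on
  -- that ball.
  obtain ⟨N', hN'N, hN'o, ⟨x, hx⟩, hN'⟩ := exists_open_eqOn_or_ne (Finset.univ : Finset (V.Γ i))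
    (fun g => V.gam i g) (fun _ => id) hN hne
    (fun g _ => (V.contDiffOn_gam i g).continuousOn.mono hNU) (fun _ _ => continuousOn_id)
  have hxU : x ∈ V.U i := hNU (hN'N hx)
  have key : ∀ g : V.Γ i, ∃ O, IsOpen O ∧ x ∈ O ∧ ∀ w ∈ O, V.gam i g w ∈ O →
      V.gam i g w = w := by
    intro g
    rcases hN' g (Finset.mem_univ g) with h | h
    · exact ⟨N', hN'o, hx, fun w hw _ => h hw⟩
    · obtain ⟨A, B, hA, hB, hzA, hzB, hAB⟩ := t2_separation (h x hx)
      have hc : ContinuousAt (V.gam i g) x :=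
        (V.contDiffOn_gam i g).continuousOn.continuousAt ((V.isOpen_U i).mem_nhds hxU)
      obtain ⟨N, hN, hNo, hzN⟩ := mem_nhds_iff.1
        (Filter.inter_mem (hc.preimage_mem_nhds (hA.mem_nhds hzA)) (hB.mem_nhds hzB))
      refine ⟨N, hNo, hzN, fun w hw hgw => ?_⟩
      exact absurd (hN hgw).2 (Set.disjoint_left.1 hAB (hN hw).1)
  choose O hO hxO hOg using key
  have hWo : IsOpen (N' ∩ ⋂ g, O g) := hN'o.inter (isOpen_iInter_of_finite hO)
  obtain ⟨r, hr, hball⟩ := Metric.isOpen_iff.1 hWo x ⟨hx, Set.mem_iInter.2 hxO⟩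
  have hWU : Metric.ball x r ⊆ V.U i := fun w hw => hNU (hN'N (hball hw).1)
  have hinj : Set.InjOn (V.q i) (Metric.ball x r) := by
    intro z hz w hw hzw
    obtain ⟨g, hg⟩ := (V.q_eq_q_iff i (hWU hz) (hWU hw)).1 hzw
    rw [← hg]
    refine (hOg g z (Set.mem_iInter.1 (hball hz).2 g) ?_).symm
    rw [hg]
    exact Set.mem_iInter.1 (hball hw).2 g
  -- A bump function times a coordinate is supported in the ball of injectivity and extends to the
  -- orbifold. Near `x` it equals that coordinate, so its differential reads off one component of
  -- `v`.
  let b : ContDiffBump x := ⟨r / 4, r / 2, by positivity, by linarith⟩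
  refine ⟨x, hN'N hx, fun v hv => ?_⟩
  ext a
  obtain ⟨f, hf⟩ := V.exists_smooth_extension Metric.isOpen_ball hWU hinj
    (isCompact_closedBall x (r / 2)) (Metric.closedBall_subset_ball (by linarith))
    (φ := fun z => b z * z a) (by
      refine (b.contDiff.mul ?_).contDiffOn
      exact contDiff_euclidean.1 contDiff_id a) (fun z _ hz => by
      have : b z = 0 := by
        by_contra h
        have hz' : z ∈ Function.support b := h
        rw [b.support_eq] at hz'
        exact hz (Metric.ball_subset_closedBall hz')
      simp [this])
  have h1 : (f : X → ℝ) ∘ V.q i =ᶠ[𝓝 x] fun z => EuclideanSpace.proj (𝕜 := ℝ) a z := by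
    filter_upwards [Metric.isOpen_ball.mem_nhds (Metric.mem_ball_self hr),
      b.eventuallyEq_one] with z hz hbz
    rw [Function.comp_apply, hf z hz, hbz]
    simp
  have h2 := hv f
  rw [h1.fderiv_eq] at h2
  have h3 : fderiv ℝ (fun z : Euc n => EuclideanSpace.proj (𝕜 := ℝ) a z) x
      = EuclideanSpace.proj (𝕜 := ℝ) a := ContinuousLinearMap.fderiv _
  rw [h3] at h2
  simpa using h2

end RiemannianOrbifold

end Orbifold

/-! ### The inverse function theorem and the dimension of the leaves -/

/-- The inverse function theorem, with smoothness of the inverse on its whole domain. -/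
theorem exists_openPartialHomeomorph_of_injective_fderiv {E F : Type*} [NormedAddCommGroup E]
    [NormedSpace ℝ E] [FiniteDimensional ℝ E] [NormedAddCommGroup F] [NormedSpace ℝ F]
    [FiniteDimensional ℝ F] (hd : Module.finrank ℝ E = Module.finrank ℝ F) {f : E → F}
    {S : Set E} (hS : IsOpen S) (hf : ContDiffOn ℝ ∞ f S) {x : E} (hx : x ∈ S)
    (hinj : Function.Injective (fderiv ℝ f x)) :
    ∃ e : OpenPartialHomeomorph E F, x ∈ e.source ∧ e.source ⊆ S ∧ (∀ z, e z = f z) ∧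
      ContDiffOn ℝ ∞ e.symm e.target := by
  have : CompleteSpace E := FiniteDimensional.complete ℝ E
  have hdiff : ∀ z ∈ S, HasFDerivAt f (fderiv ℝ f z) z := fun z hz =>
    ((hf.contDiffAt (hS.mem_nhds hz)).differentiableAt (by simp)).hasFDerivAt
  have hc : ContinuousOn (fderiv ℝ f) S :=
    (hf.fderiv_of_isOpen hS (m := ∞) (by simp)).continuousOn
  -- Invertibility of the derivative is an open condition; restricting the source to it makes the
  -- inverse smooth at every point of its target.
  have hR : IsOpen (S ∩ fderiv ℝ f ⁻¹' Set.range ((↑) : (E ≃L[ℝ] F) → E →L[ℝ] F)) :=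
    hc.isOpen_inter_preimage hS (ContinuousLinearEquiv.isOpen)
  obtain ⟨L, hL⟩ := ContinuousLinearMap.isInvertible_of_injective hd _ hinj
  have hfx := hf.contDiffAt (hS.mem_nhds hx)
  have hLx : HasFDerivAt f (L : E →L[ℝ] F) x := by rw [hL]; exact hdiff x hx
  let e := hfx.toOpenPartialHomeomorph f hLx (by simp)
  refine ⟨e.restrOpen _ hR, ?_, ?_, fun z => rfl, fun y hy => ?_⟩
  · rw [OpenPartialHomeomorph.restrOpen_source]
    exact ⟨hfx.mem_toOpenPartialHomeomorph_source hLx (by simp), hx, L, hL⟩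
  · rw [OpenPartialHomeomorph.restrOpen_source]
    exact fun z hz => hz.2.1
  · have hz := (e.restrOpen _ hR).map_target hy
    rw [OpenPartialHomeomorph.restrOpen_source] at hz
    obtain ⟨L', hL'⟩ := hz.2.2
    refine ContDiffAt.contDiffWithinAt (OpenPartialHomeomorph.contDiffAt_symm _ hy (f₀' := L') ?_ ?_)
    · rw [hL']
      exact hdiff _ hz.2.1
    · exact hf.contDiffAt (hS.mem_nhds hz.2.1)

/-- Pairs are grouped by their larger entry. The count matches the leaf dimension with the entries
above the diagonal of a skew matrix. -/
theorem card_lt_pairs (n : ℕ) :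
    Fintype.card {p : Fin n × Fin n // p.1 < p.2} = n * (n - 1) / 2 := by
  have h1 : Fintype.card {p : Fin n × Fin n // p.1 < p.2}
      = Fintype.card (Σ b : Fin n, {a : Fin n // a < b}) :=
    Fintype.card_congr
      { toFun := fun p => ⟨p.1.2, p.1.1, p.2⟩
        invFun := fun p => ⟨(p.2.1, p.1), p.2.2⟩
        left_inv := fun _ => rfl
        right_inv := fun _ => rfl }
  rw [h1, Fintype.card_sigma]
  have h2 : ∀ b ∈ (Finset.univ : Finset (Fin n)), Fintype.card {a : Fin n // a < b} = b := by
    intro b _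
    rw [← Fin.card_Iio b]
    exact Fintype.card_of_subtype _ (by simp)
  rw [Finset.sum_congr rfl h2, Fin.sum_univ_eq_sum_range (fun k => k) n, Finset.sum_range_id]

/-- An enumeration of the pairs `b < c`. -/
noncomputable def ltPairs (n : ℕ) : Fin (n * (n - 1) / 2) ≃ {p : Fin n × Fin n // p.1 < p.2} :=
  (Fintype.equivFinOfCardEq (card_lt_pairs n)).symm

section Orbifold

namespace RiemannianOrbifold

variable {n : ℕ} {X ι : Type*} [TopologicalSpace X] (V : RiemannianOrbifold n X ι)

/-! ### Gram matrices -/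

/-- An entry of the Gram matrix of a tuple of tangent vectors. -/
noncomputable def gram (i : ι) (a b : Fin n) (z : Euc n × (Fin n → Euc n)) : ℝ := V.h i z.1 (z.2 a) (z.2 b)

theorem contDiffOn_metric (i : ι) {v w : Euc n × (Fin n → Euc n) → Euc n} (hv : ContDiff ℝ ∞ v)
    (hw : ContDiff ℝ ∞ w) :
    ContDiffOn ℝ ∞ (fun z => V.h i z.1 (v z) (w z)) (V.U i ×ˢ Set.univ) := by
  have h1 : ContDiffOn ℝ ∞ (fun z : Euc n × (Fin n → Euc n) => V.h i z.1) (V.U i ×ˢ Set.univ) :=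
    (V.contDiffOn_h i).comp contDiff_fst.contDiffOn fun z hz => hz.1
  exact (h1.clm_apply hv.contDiffOn).clm_apply hw.contDiffOn

theorem fderiv_metric (i : ι) {v w : Euc n × (Fin n → Euc n) → Euc n}
    {z : Euc n × (Fin n → Euc n)} (hz : z.1 ∈ V.U i) (hv : DifferentiableAt ℝ v z)
    (hw : DifferentiableAt ℝ w z) (ζ : Euc n × (Fin n → Euc n)) :
    fderiv ℝ (fun z => V.h i z.1 (v z) (w z)) z ζ
      = fderiv ℝ (V.h i) z.1 ζ.1 (v z) (w z) + V.h i z.1 (fderiv ℝ v z ζ) (w z)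
        + V.h i z.1 (v z) (fderiv ℝ w z ζ) := by
  have hh : HasFDerivAt (V.h i) (fderiv ℝ (V.h i) z.1) z.1 :=
    (((V.contDiffOn_h i).contDiffAt ((V.isOpen_U i).mem_nhds hz)).differentiableAt
      (by simp)).hasFDerivAt
  have hf : HasFDerivAt (fun z : Euc n × (Fin n → Euc n) => z.1)
      (ContinuousLinearMap.fst ℝ (Euc n) (Fin n → Euc n)) z := hasFDerivAt_fst
  have h1 : HasFDerivAt (fun z : Euc n × (Fin n → Euc n) => V.h i z.1)
      ((fderiv ℝ (V.h i) z.1).comp (ContinuousLinearMap.fst ℝ _ _)) z :=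
    HasFDerivAt.comp (g := V.h i) (f := fun z : Euc n × (Fin n → Euc n) => z.1) z hh hf
  have h2 := (h1.clm_apply hv.hasFDerivAt).clm_apply hw.hasFDerivAt
  rw [h2.fderiv]
  simp
  ring

theorem contDiffOn_gram (i : ι) (a b : Fin n) :
    ContDiffOn ℝ ∞ (V.gram i a b) (V.U i ×ˢ Set.univ) :=
  V.contDiffOn_metric i (v := fun z => z.2 a) (w := fun z => z.2 b) (by fun_prop) (by fun_prop)

theorem fderiv_gram (i : ι) (a b : Fin n) {z : Euc n × (Fin n → Euc n)} (hz : z.1 ∈ V.U i)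
    (ζ : Euc n × (Fin n → Euc n)) :
    fderiv ℝ (V.gram i a b) z ζ = fderiv ℝ (V.h i) z.1 ζ.1 (z.2 a) (z.2 b)
      + V.h i z.1 (ζ.2 a) (z.2 b) + V.h i z.1 (z.2 a) (ζ.2 b) := by
  have hs : ∀ c, HasFDerivAt (fun z : Euc n × (Fin n → Euc n) => z.2 c)
      ((ContinuousLinearMap.proj c).comp (ContinuousLinearMap.snd ℝ (Euc n) (Fin n → Euc n))) z :=
    fun c => hasFDerivAt_pi'.1 hasFDerivAt_snd c
  have := V.fderiv_metric i hz (hs a).differentiableAt (hs b).differentiableAt ζ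
  rw [(hs a).fderiv, (hs b).fderiv] at this
  exact this

theorem mem_frames_iff_gram {i : ι} {z : Euc n × (Fin n → Euc n)} : z ∈ V.frames i ↔
    z.1 ∈ V.U i ∧ ∀ a b, V.gram i a b z = if a = b then 1 else 0 := Iff.rfl

/-- Coordinates near an orthonormal frame in which the frame bundle is a coordinate plane. -/
theorem exists_frameCoord {i : ι} {z₀ : Euc n × (Fin n → Euc n)} (hz₀ : z₀ ∈ V.frames i) :
    ∃ Θ : OpenPartialHomeomorph (Euc n × (Fin n → Euc n))
        ((Euc (n * (n - 1) / 2) × Euc n) × ({p : Fin n × Fin n // ¬ p.1 < p.2} → ℝ)),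
      z₀ ∈ Θ.source ∧ Θ.source ⊆ V.U i ×ˢ Set.univ ∧ ContDiffOn ℝ ∞ Θ Θ.source ∧
      ContDiffOn ℝ ∞ Θ.symm Θ.target ∧ (∀ z, (Θ z).1.2 = z.1) ∧
      ∀ z p, (Θ z).2 p = V.gram i p.1.1 p.1.2 z - if p.1.1 = p.1.2 then 1 else 0 := by
  -- With `M_bc = h(u⁰_b, u_c)`, where `u⁰` is the frame of `z₀`, the first block holds the skew
  -- part of `M` (leaf coordinates). Then come the base point and the defect of the Gram matrix from
  -- the identity, on and below the diagonal. The blocks have total dimension `n + n²`.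
  let f : Euc n × (Fin n → Euc n) →
      (Euc (n * (n - 1) / 2) × Euc n) × ({p : Fin n × Fin n // ¬ p.1 < p.2} → ℝ) := fun z =>
    ((WithLp.toLp 2 fun k => V.h i z.1 (z₀.2 (ltPairs n k).1.1) (z.2 (ltPairs n k).1.2)
      - V.h i z.1 (z₀.2 (ltPairs n k).1.2) (z.2 (ltPairs n k).1.1), z.1),
      fun p => V.gram i p.1.1 p.1.2 z - if p.1.1 = p.1.2 then 1 else 0)
  have hm : ∀ b c, ContDiffOn ℝ ∞ (fun z : Euc n × (Fin n → Euc n) => V.h i z.1 (z₀.2 b) (z.2 c))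
      (V.U i ×ˢ Set.univ) := fun b c =>
    V.contDiffOn_metric i (v := fun _ => z₀.2 b) (w := fun z => z.2 c) (by fun_prop) (by fun_prop)
  have hf1 : ∀ k, ContDiffOn ℝ ∞ (fun z => (f z).1.1 k) (V.U i ×ˢ Set.univ) := fun k =>
    (hm _ _).sub (hm _ _)
  have hf2 : ∀ p, ContDiffOn ℝ ∞ (fun z => (f z).2 p) (V.U i ×ˢ Set.univ) := fun p =>
    (V.contDiffOn_gram i _ _).sub contDiffOn_const
  have hfc : ContDiffOn ℝ ∞ f (V.U i ×ˢ Set.univ) :=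
    ((contDiffOn_euclidean.2 hf1).prodMk contDiff_fst.contDiffOn).prodMk (contDiffOn_pi.2 hf2)
  have hS : IsOpen (V.U i ×ˢ (Set.univ : Set (Fin n → Euc n))) := (V.isOpen_U i).prod isOpen_univ
  have hzS : z₀ ∈ V.U i ×ˢ (Set.univ : Set (Fin n → Euc n)) := ⟨hz₀.1, trivial⟩
  have hdf : DifferentiableAt ℝ f z₀ :=
    (hfc.contDiffAt (hS.mem_nhds hzS)).differentiableAt (by simp)
  have hdim : Module.finrank ℝ (Euc n × (Fin n → Euc n)) = Module.finrank ℝ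
      ((Euc (n * (n - 1) / 2) × Euc n) × ({p : Fin n × Fin n // ¬ p.1 < p.2} → ℝ)) := by
    have h1 := Fintype.card_subtype_compl (fun p : Fin n × Fin n => p.1 < p.2)
    have h2 := Fintype.card_subtype_le (fun p : Fin n × Fin n => p.1 < p.2)
    rw [card_lt_pairs, Fintype.card_prod, Fintype.card_fin] at h1 h2
    simp only [Module.finrank_prod, finrank_euclideanSpace, Fintype.card_fin,
      Module.finrank_pi_fintype, Finset.sum_const, Finset.card_univ, smul_eq_mul,
      Module.finrank_self, mul_one, h1]
    omega
  have hinj : Function.Injective (fderiv ℝ f z₀) := by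
    rw [injective_iff_map_eq_zero]
    intro v hv
    have hv1 : v.1 = 0 := by
      have h1 : HasFDerivAt (fun z => (f z).1.2) ((ContinuousLinearMap.snd ℝ _ _).comp
        ((ContinuousLinearMap.fst ℝ _ _).comp (fderiv ℝ f z₀))) z₀ :=
        hdf.hasFDerivAt.fst.snd
      have h2 : HasFDerivAt (fun z => (f z).1.2) (ContinuousLinearMap.fst ℝ _ _) z₀ :=
        hasFDerivAt_fst
      have h3 := congrArg (fun L : Euc n × (Fin n → Euc n) →L[ℝ] Euc n => L v) (h2.unique h1)
      simpa [hv] using h3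
    have hsym : ∀ b c, ¬ b < c → V.h i z₀.1 (v.2 b) (z₀.2 c) + V.h i z₀.1 (z₀.2 b) (v.2 c) = 0 := by
      intro b c hbc
      have h1 : HasFDerivAt (fun z => (f z).2 ⟨(b, c), hbc⟩) ((ContinuousLinearMap.proj _).comp
        ((ContinuousLinearMap.snd ℝ _ _).comp (fderiv ℝ f z₀))) z₀ :=
        hasFDerivAt_pi'.1 hdf.hasFDerivAt.snd _
      have h2 : HasFDerivAt (fun z => (f z).2 ⟨(b, c), hbc⟩) (fderiv ℝ (V.gram i b c) z₀) z₀ :=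
        ((((V.contDiffOn_gram i b c).contDiffAt (hS.mem_nhds hzS)).differentiableAt
          (by simp)).hasFDerivAt).sub_const _
      have h3 := congrArg (fun L : Euc n × (Fin n → Euc n) →L[ℝ] ℝ => L v) (h2.unique h1)
      simp only [V.fderiv_gram i b c hz₀.1, hv1] at h3
      simpa [hv] using h3
    have hanti : ∀ b c, b < c →
        V.h i z₀.1 (z₀.2 b) (v.2 c) - V.h i z₀.1 (z₀.2 c) (v.2 b) = 0 := by
      intro b c hbc
      obtain ⟨k, hk⟩ := (ltPairs n).surjective ⟨(b, c), hbc⟩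
      have h1 : HasFDerivAt (fun z => (f z).1.1 k) ((EuclideanSpace.proj k).comp
        ((ContinuousLinearMap.fst ℝ _ _).comp
          ((ContinuousLinearMap.fst ℝ _ _).comp (fderiv ℝ f z₀)))) z₀ :=
        (EuclideanSpace.proj (𝕜 := ℝ) k).hasFDerivAt.comp z₀ hdf.hasFDerivAt.fst.fst
      have hd : ∀ b c, DifferentiableAt ℝ
          (fun z : Euc n × (Fin n → Euc n) => V.h i z.1 (z₀.2 b) (z.2 c)) z₀ := fun b c =>
        ((hm b c).contDiffAt (hS.mem_nhds hzS)).differentiableAt (by simp)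
      have h2 : HasFDerivAt (fun z => (f z).1.1 k) _ z₀ :=
        (hd (ltPairs n k).1.1 (ltPairs n k).1.2).hasFDerivAt.sub
          (hd (ltPairs n k).1.2 (ltPairs n k).1.1).hasFDerivAt
      have hs : ∀ c, HasFDerivAt (fun z : Euc n × (Fin n → Euc n) => z.2 c)
          ((ContinuousLinearMap.proj c).comp
            (ContinuousLinearMap.snd ℝ (Euc n) (Fin n → Euc n))) z₀ :=
        fun c => hasFDerivAt_pi'.1 hasFDerivAt_snd c
      have hdv : ∀ b c, fderiv ℝ
          (fun z : Euc n × (Fin n → Euc n) => V.h i z.1 (z₀.2 b) (z.2 c)) z₀ v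
            = V.h i z₀.1 (z₀.2 b) (v.2 c) := by
        intro b c
        rw [V.fderiv_metric i hz₀.1 (differentiableAt_const _) (hs c).differentiableAt,
          (hs c).fderiv, hv1]
        simp
      have h3 := congrArg (fun L : Euc n × (Fin n → Euc n) →L[ℝ] ℝ => L v) (h2.unique h1)
      simp only [sub_apply, hdv, hk] at h3
      simpa [hv] using h3
    have hs : ∀ v w, V.h i z₀.1 v w = V.h i z₀.1 w v := V.symm_h i z₀.1 hz₀.1
    -- For a kernel vector the linearised Gram equations make the matrix `h(u⁰_b, v_c)` skew, while
    -- the leaf coordinates make it symmetric; hence it vanishes.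
    have hall : ∀ b c, V.h i z₀.1 (z₀.2 b) (v.2 c) = 0 := by
      intro b c
      rcases lt_trichotomy b c with h | h | h
      · have h1 := hanti b c h
        have h2 := hsym c b (not_lt.2 h.le)
        rw [hs (v.2 c)] at h2
        linarith
      · subst h
        have h2 := hsym b b (lt_irrefl b)
        rw [hs (v.2 b)] at h2
        linarith
      · have h1 := hanti c b h
        have h2 := hsym b c (not_lt.2 h.le)
        rw [hs (v.2 b)] at h2
        linarith
    exact Prod.ext hv1 (funext fun c => V.eq_zero_of_frame hz₀ fun b => hall b c)
  obtain ⟨e, hxe, heS, hef, hes⟩ := exists_openPartialHomeomorph_of_injective_fderiv hdim hS hfc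
    hzS hinj
  refine ⟨e, hxe, heS, (hfc.mono heS).congr fun z _ => hef z, hes, fun z => ?_, fun z p => ?_⟩
  · rw [hef]
  · rw [hef]

theorem mem_frames_of_gram {i : ι} {z : Euc n × (Fin n → Euc n)} (hz : z.1 ∈ V.U i)
    (h : ∀ p : {p : Fin n × Fin n // ¬ p.1 < p.2},
      V.gram i p.1.1 p.1.2 z = if p.1.1 = p.1.2 then 1 else 0) : z ∈ V.frames i := by
  refine ⟨hz, fun a b => ?_⟩
  by_cases hab : a < b
  · have := h ⟨(b, a), not_lt.2 hab.le⟩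
    rw [V.symm_h i z.1 hz]
    exact this.trans (by simp [hab.ne, hab.ne'])
  · exact h ⟨(a, b), hab⟩

/-- The derivative of a function on the frame bundle in the direction of a tangent vector does
not depend on the extension of the function to the ambient space. -/
theorem fderiv_eq_of_eqOn_frames {F : Type*} [NormedAddCommGroup F] [NormedSpace ℝ F] {i : ι}
    {z : Euc n × (Fin n → Euc n)} (hz : z ∈ V.frames i) {G G' : Euc n × (Fin n → Euc n) → F}
    (hG : DifferentiableAt ℝ G z) (hG' : DifferentiableAt ℝ G' z)
    (h : ∀ᶠ w in 𝓝 z, w ∈ V.frames i → G w = G' w) {ζ : Euc n × (Fin n → Euc n)}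
    (hζ : ∀ a b, fderiv ℝ (V.gram i a b) z ζ = 0) : fderiv ℝ G z ζ = fderiv ℝ G' z ζ := by
  obtain ⟨Θ, hzs, hS, hΘ, hΘs, hΘ1, hΘ2⟩ := V.exists_frameCoord hz
  have hdΘ : DifferentiableAt ℝ Θ z :=
    (hΘ.contDiffAt (Θ.open_source.mem_nhds hzs)).differentiableAt (by simp)
  have hdΘs : DifferentiableAt ℝ Θ.symm (Θ z) :=
    (hΘs.contDiffAt (Θ.open_target.mem_nhds (Θ.map_source hzs))).differentiableAt (by simp)
  have hz0 : (Θ z).2 = 0 := funext fun p => by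
    rw [hΘ2 z p, (V.mem_frames_iff_gram.1 hz).2]
    exact sub_self _
  -- A vector annihilated by the Gram differentials is tangent to the coordinate plane that
  -- represents the frame bundle. The derivative along it therefore involves only values on that
  -- plane, where `G` and `G'` agree.
  have hζ0 : (fderiv ℝ Θ z ζ).2 = 0 := by
    funext p
    have h1 : HasFDerivAt (fun w => (Θ w).2 p) ((ContinuousLinearMap.proj p).comp
        ((ContinuousLinearMap.snd ℝ _ _).comp (fderiv ℝ Θ z))) z :=
      hasFDerivAt_pi'.1 hdΘ.hasFDerivAt.snd p
    have h2 : HasFDerivAt (fun w => (Θ w).2 p) (fderiv ℝ (V.gram i p.1.1 p.1.2) z) z := by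
      simp only [hΘ2]
      exact ((((V.contDiffOn_gram i _ _).contDiffAt (((V.isOpen_U i).prod isOpen_univ).mem_nhds
        ⟨hz.1, trivial⟩)).differentiableAt (by simp)).hasFDerivAt).sub_const _
    have h3 := congrArg (fun L : Euc n × (Fin n → Euc n) →L[ℝ] ℝ => L ζ) (h2.unique h1)
    simpa [hζ] using h3.symm
  -- the curve in the frame bundle
  have hinc : HasFDerivAt (fun p : Euc (n * (n - 1) / 2) × Euc n =>
      (p, (0 : {p : Fin n × Fin n // ¬ p.1 < p.2} → ℝ)))
      (ContinuousLinearMap.inl ℝ _ _) (Θ z).1 :=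
    hasFDerivAt_prodMk_left _ _
  have hzz : ((Θ z).1, (0 : {p : Fin n × Fin n // ¬ p.1 < p.2} → ℝ)) = Θ z :=
    Prod.ext rfl hz0.symm
  have key : ∀ H : Euc n × (Fin n → Euc n) → F, DifferentiableAt ℝ H z →
      HasFDerivAt (fun p => H (Θ.symm (p, 0)))
        (((fderiv ℝ H z).comp (fderiv ℝ Θ.symm (Θ z))).comp (ContinuousLinearMap.inl ℝ _ _))
        (Θ z).1 := by
    intro H hH
    have h1 : HasFDerivAt H (fderiv ℝ H z) (Θ.symm (Θ z)) := by
      rw [Θ.left_inv hzs]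
      exact hH.hasFDerivAt
    have h2 : HasFDerivAt (H ∘ Θ.symm) ((fderiv ℝ H z).comp (fderiv ℝ Θ.symm (Θ z)))
        ((Θ z).1, 0) := by
      rw [hzz]
      exact h1.comp _ hdΘs.hasFDerivAt
    exact h2.comp (Θ z).1 hinc
  have hev : (fun p => G (Θ.symm (p, 0))) =ᶠ[𝓝 (Θ z).1] fun p => G' (Θ.symm (p, 0)) := by
    have hcinc : ContinuousAt (fun p : Euc (n * (n - 1) / 2) × Euc n =>
      (p, (0 : {p : Fin n × Fin n // ¬ p.1 < p.2} → ℝ))) (Θ z).1 := hinc.continuousAt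
    have h1 : Filter.Tendsto (fun p : Euc (n * (n - 1) / 2) × Euc n =>
      (p, (0 : {p : Fin n × Fin n // ¬ p.1 < p.2} → ℝ))) (𝓝 (Θ z).1) (𝓝 (Θ z)) := by
      have := hcinc.tendsto
      rwa [hzz] at this
    have h2 : Filter.Tendsto (fun p : Euc (n * (n - 1) / 2) × Euc n =>
      Θ.symm (p, (0 : {p : Fin n × Fin n // ¬ p.1 < p.2} → ℝ))) (𝓝 (Θ z).1) (𝓝 z) := by
      have := hdΘs.continuousAt.tendsto.comp h1
      rwa [Θ.left_inv hzs] at this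
    filter_upwards [h2.eventually h, h1 (Θ.open_target.mem_nhds (Θ.map_source hzs))] with p hp hpt
    refine hp (V.mem_frames_of_gram (hS (Θ.map_target hpt)).1 fun q => ?_)
    have := hΘ2 (Θ.symm (p, 0)) q
    rw [Θ.right_inv hpt] at this
    exact (sub_eq_zero.1 this.symm)
  have hinv : fderiv ℝ Θ.symm (Θ z) (fderiv ℝ Θ z ζ) = ζ := by
    have h1 := hdΘs.hasFDerivAt.comp z hdΘ.hasFDerivAt
    have h2 : HasFDerivAt (Θ.symm ∘ Θ) (ContinuousLinearMap.id ℝ _) z :=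
      (hasFDerivAt_id z).congr_of_eventuallyEq (Θ.eventually_left_inverse hzs)
    exact congrArg (fun L : Euc n × (Fin n → Euc n) →L[ℝ] Euc n × (Fin n → Euc n) => L ζ)
      (h1.unique h2)
  have h3 := ((key G hG).congr_of_eventuallyEq hev.symm).unique (key G' hG')
  have h4 := congrArg (fun L => L (fderiv ℝ Θ z ζ).1) h3
  have h5 : (ContinuousLinearMap.inl ℝ (Euc (n * (n - 1) / 2) × Euc n)
      ({p : Fin n × Fin n // ¬ p.1 < p.2} → ℝ)) (fderiv ℝ Θ z ζ).1 = fderiv ℝ Θ z ζ :=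
    Prod.ext rfl hζ0.symm
  simp only [ContinuousLinearMap.comp_apply, h5, hinv] at h4
  exact h4

/-! ### Adapted charts -/

/-- Every orthonormal frame lies in an adapted chart whose transverse coordinates are those
of `U_i`. -/
theorem exists_adaptedChart {i : ι} {z₀ : Euc n × (Fin n → Euc n)} (hz₀ : z₀ ∈ V.frames i) :
    ∃ κ : V.AdaptedChart, V.cls i ⟨z₀, hz₀⟩ ∈ κ.ψ.source ∧ z₀.1 ∈ κ.B ∧ κ.A.Nonempty ∧
      ∀ x ∈ κ.A, ∀ y ∈ κ.B, y ∈ V.U i ∧ V.proj (κ.ψ.symm (x, y)) = V.q i y := by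
  classical
  obtain ⟨Θ, hzs, hS, hΘ, hΘs, hΘ1, hΘ2⟩ := V.exists_frameCoord hz₀
  obtain ⟨O, hO, hzO, hinj⟩ := V.exists_isOpen_injOn_cls hz₀
  have hmem0 : ∀ z ∈ Θ.source, z ∈ V.frames i → (Θ z).2 = 0 := fun z _ hz => funext fun p => by
    rw [hΘ2 z p, (V.mem_frames_iff_gram.1 hz).2]
    exact sub_self _
  let s : Euc (n * (n - 1) / 2) × Euc n → Euc n × (Fin n → Euc n) := fun p => Θ.symm (p, 0)
  have hinc : Continuous fun p : Euc (n * (n - 1) / 2) × Euc n =>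
      (p, (0 : {p : Fin n × Fin n // ¬ p.1 < p.2} → ℝ)) := by fun_prop
  have hN : IsOpen ((fun p : Euc (n * (n - 1) / 2) × Euc n =>
      (p, (0 : {p : Fin n × Fin n // ¬ p.1 < p.2} → ℝ))) ⁻¹' (Θ.target ∩ Θ.symm ⁻¹' O)) :=
    (Θ.symm.continuousOn.isOpen_inter_preimage Θ.open_target hO).preimage hinc
  have hzz : ((Θ z₀).1, (0 : {p : Fin n × Fin n // ¬ p.1 < p.2} → ℝ)) = Θ z₀ :=
    Prod.ext rfl (hmem0 z₀ hzs hz₀).symm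
  obtain ⟨r, hr, hball⟩ := Metric.isOpen_iff.1 hN (Θ z₀).1 (by
    rw [Set.mem_preimage, hzz]
    exact ⟨Θ.map_source hzs, by rw [Set.mem_preimage, Θ.left_inv hzs]; exact hzO⟩)
  -- A ball for the maximum norm is a product of balls, which gives the shape `A × B` with `A`
  -- convex.
  rw [← ball_prod_same] at hball
  set A := Metric.ball (Θ z₀).1.1 r with hA
  set B := Metric.ball (Θ z₀).1.2 r with hB
  have hAo : IsOpen A := Metric.isOpen_ball
  have hBo : IsOpen B := Metric.isOpen_ball
  have ht : ∀ p ∈ A ×ˢ B, (p, (0 : {p : Fin n × Fin n // ¬ p.1 < p.2} → ℝ)) ∈ Θ.target :=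
    fun p hp => (hball hp).1
  have hsO : ∀ p ∈ A ×ˢ B, s p ∈ O := fun p hp => (hball hp).2
  have hss : ∀ p ∈ A ×ˢ B, s p ∈ Θ.source := fun p hp => Θ.map_target (ht p hp)
  have hΘs' : ∀ p ∈ A ×ˢ B, Θ (s p) = (p, 0) := fun p hp => Θ.right_inv (ht p hp)
  have hs1 : ∀ p ∈ A ×ˢ B, (s p).1 = p.2 := fun p hp => by rw [← hΘ1, hΘs' p hp]
  have hsf : ∀ p ∈ A ×ˢ B, s p ∈ V.frames i := by
    intro p hp
    refine V.mem_frames_of_gram (hS (hss p hp)).1 fun q => ?_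
    have := hΘ2 (s p) q
    rw [hΘs' p hp] at this
    exact sub_eq_zero.1 this.symm
  have hsinv : ∀ z ∈ Θ.source, z ∈ V.frames i → s (Θ z).1 = z := by
    intro z hz hzf
    have : ((Θ z).1, (0 : {p : Fin n × Fin n // ¬ p.1 < p.2} → ℝ)) = Θ z :=
      Prod.ext rfl (hmem0 z hz hzf).symm
    show Θ.symm ((Θ z).1, 0) = z
    rw [this, Θ.left_inv hz]
  have hscont : ContDiffOn ℝ ∞ s (A ×ˢ B) := by
    refine hΘs.comp (f := fun p : Euc (n * (n - 1) / 2) × Euc n =>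
      (p, (0 : {p : Fin n × Fin n // ¬ p.1 < p.2} → ℝ))) ?_ ht
    exact contDiffOn_id.prodMk contDiffOn_const
  let j : Euc (n * (n - 1) / 2) × Euc n → V.Resolution := fun p =>
    if h : s p ∈ V.frames i then V.cls i ⟨s p, h⟩ else V.cls i ⟨z₀, hz₀⟩
  have hj : ∀ p (hp : p ∈ A ×ˢ B), j p = V.cls i ⟨s p, hsf p hp⟩ := fun p hp => dif_pos _
  have hjinj : Set.InjOn j (A ×ˢ B) := by
    intro p hp p' hp' h
    rw [hj p hp, hj p' hp'] at h
    have h1 := congrArg Subtype.val (hinj _ _ (hsO p hp) (hsO p' hp') h)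
    have h2 := congrArg (fun z => (Θ z).1) h1
    simpa only [hΘs' p hp, hΘs' p' hp'] using h2
  have hjcont : ContinuousOn j (A ×ˢ B) := by
    rw [continuousOn_iff_continuous_domRestrict]
    have h1 : Continuous fun p : ↥(A ×ˢ B) => V.cls i ⟨s p, hsf p p.2⟩ :=
      (V.continuous_cls i).comp
        ((continuousOn_iff_continuous_domRestrict.1 hscont.continuousOn).subtype_mk _)
    exact h1.congr fun p => (hj p p.2).symm
  have hjopen : IsOpenMap ((A ×ˢ B).domRestrict j) := by
    intro W hW
    obtain ⟨W', hW', rfl⟩ := isOpen_induced_iff.1 hW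
    -- Images under `j` are classes of open sets of frames, cut out by the coordinates `Θ`; openness
    -- of `cls` then applies.
    have himg : (A ×ˢ B).domRestrict j '' (Subtype.val ⁻¹' W')
        = V.cls i '' (Subtype.val ⁻¹' (Θ.source ∩ Θ ⁻¹' ((W' ∩ A ×ˢ B) ×ˢ Set.univ))) := by
      ext v
      constructor
      · rintro ⟨p, hp, rfl⟩
        refine ⟨⟨s p, hsf p p.2⟩, ⟨hss p p.2, ?_⟩, (hj p p.2).symm⟩
        rw [Set.mem_preimage, hΘs' p p.2]
        exact ⟨⟨hp, p.2⟩, trivial⟩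
      · rintro ⟨u, ⟨hus, huW, -⟩, rfl⟩
        refine ⟨⟨(Θ u.1).1, huW.2⟩, huW.1, ?_⟩
        show j (Θ u.1).1 = _
        rw [hj _ huW.2]
        congr 1
        exact Subtype.ext (hsinv u.1 hus u.2)
    rw [himg]
    refine V.isOpenMap_cls i _ (IsOpen.preimage continuous_subtype_val ?_)
    exact Θ.continuousOn.isOpen_inter_preimage Θ.open_source
      ((hW'.inter (hAo.prod hBo)).prod isOpen_univ)
  let ψ := (OpenPartialHomeomorph.ofContinuousOpenRestrict (hjinj.toPartialEquiv j (A ×ˢ B))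
    hjcont hjopen (hAo.prod hBo)).symm
  have hψt : ψ.target = A ×ˢ B := rfl
  have hψs : ψ.source = j '' (A ×ˢ B) := rfl
  have hψsymm : ∀ p, ψ.symm p = j p := fun p => rfl
  have hψj : ∀ p ∈ A ×ˢ B, ψ (j p) = p := fun p hp => ψ.right_inv (x := p) hp
  have hz₀A : (Θ z₀).1 ∈ A ×ˢ B := ⟨Metric.mem_ball_self hr, Metric.mem_ball_self hr⟩
  have hproj : ∀ p ∈ A ×ˢ B, p.2 ∈ V.U i ∧ V.proj (ψ.symm p) = V.q i p.2 := by
    intro p hp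
    rw [← hs1 p hp, hψsymm, hj p hp]
    exact ⟨(hsf p hp).1, rfl⟩
  refine ⟨{ ψ := ψ, A := A, B := B, isOpen_A := hAo, isPreconnected_A := ?_, isOpen_B := hBo,
            target_eq := hψt, smooth := ?_, smooth_symm := ?_, proj_eq := ?_ }, ?_, ?_, ?_, ?_⟩
  · exact (convex_ball _ _).isPreconnected
  · intro k u hu
    obtain ⟨p, hp, hpu⟩ := hu
    rw [hj p hp] at hpu
    -- Near a frame of another `U_k`, the chart is the lift of a change of charts to `U_i` followed
    -- by the coordinates `Θ`, which is smooth on an ambient open set.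
    obtain ⟨φ, hφ, hus, hφu⟩ := (V.cls_eq_cls_iff u _).1 hpu.symm
    have hφu : s p = jetLift φ u.1 := hφu
    have hJ := contDiffOn_jetLift φ.open_source hφ.2.2.1.contDiffOn
    have hJo := φ.open_source.prod (isOpen_univ (X := Fin n → Euc n))
    have hO1 : IsOpen ((φ.source ×ˢ Set.univ) ∩ jetLift φ ⁻¹' Θ.source) :=
      hJ.continuousOn.isOpen_inter_preimage hJo Θ.open_source
    have hG : ContDiffOn ℝ ∞ (fun w => (Θ (jetLift φ w)).1)
        ((φ.source ×ˢ Set.univ) ∩ jetLift φ ⁻¹' Θ.source) :=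
      contDiff_fst.comp_contDiffOn (hΘ.comp (hJ.mono Set.inter_subset_left) fun w hw => hw.2)
    refine ⟨_, hG.continuousOn.isOpen_inter_preimage hO1 (hAo.prod hBo), ⟨⟨⟨hus, trivial⟩, ?_⟩, ?_⟩,
      _, hG.mono Set.inter_subset_left, fun w hw => ?_⟩
    · rw [Set.mem_preimage, ← hφu]
      exact hss p hp
    · rw [Set.mem_preimage, ← hφu, hΘs' p hp]
      exact hp
    · have h1 := hφ.cls_jetLift w hw.1.1.1
      have h2 := hψj _ hw.2
      rw [hj _ hw.2] at h2
      show ψ (V.cls k w) = _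
      rw [← h1]
      refine Eq.trans ?_ h2
      congr 2
      exact Subtype.ext (hsinv _ hw.1.2 (hφ.jetLift_mem w.2 hw.1.1.1)).symm
  · intro z hz
    exact ⟨i, _, hAo.prod hBo, hz, subset_rfl, s, hscont, fun w hw => ⟨hsf w hw, (hj w hw).symm⟩⟩
  · intro x hx x' hx' y hy
    rw [(hproj (x, y) ⟨hx, hy⟩).2, (hproj (x', y) ⟨hx', hy⟩).2]
  · refine ⟨_, hz₀A, ?_⟩
    rw [hj _ hz₀A]
    congr 1
    exact Subtype.ext (hsinv z₀ hzs hz₀)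
  · rw [← hΘ1 z₀]
    exact hz₀A.2
  · exact ⟨_, hz₀A.1⟩
  · exact fun x hx y hy => hproj (x, y) ⟨hx, hy⟩

theorem exists_adaptedChart_mem (v : V.Resolution) :
    ∃ κ : V.AdaptedChart, v ∈ κ.ψ.source := by
  obtain ⟨i, u, rfl⟩ := V.exists_cls_eq v
  obtain ⟨κ, hκ, -⟩ := V.exists_adaptedChart u.2
  exact ⟨κ, hκ⟩

variable {V} in
theorem AdaptedChart.mem_target_iff (κ : V.AdaptedChart) {x : Euc (n * (n - 1) / 2)} {y : Euc n} :
    (x, y) ∈ κ.ψ.target ↔ x ∈ κ.A ∧ y ∈ κ.B := by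
  rw [κ.target_eq]
  exact Iff.rfl

variable {V} in
/-- A local lift of the projection to frames has injective transverse derivative. -/
theorem AdaptedChart.fderiv_lift_injective (κ : V.AdaptedChart) {i : ι}
    {O : Set (Euc (n * (n - 1) / 2) × Euc n)} (hO : IsOpen O) (hOt : O ⊆ κ.ψ.target)
    {s : Euc (n * (n - 1) / 2) × Euc n → Euc n × (Fin n → Euc n)} (hs : ContDiffOn ℝ ∞ s O)
    (hcls : ∀ w ∈ O, ∃ hw : s w ∈ V.frames i, V.cls i ⟨s w, hw⟩ = κ.ψ.symm w)
    {z : Euc (n * (n - 1) / 2) × Euc n} (hz : z ∈ O) {v : Euc n}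
    (hv : (fderiv ℝ s z (0, v)).1 = 0) : v = 0 := by
  have hsd : HasFDerivAt s (fderiv ℝ s z) z :=
    ((hs.contDiffAt (hO.mem_nhds hz)).differentiableAt (by simp)).hasFDerivAt
  have hsf : ∀ w ∈ O, s w ∈ V.frames i := fun w hw => (hcls w hw).1
  -- the derivative of the lift is injective
  have hinj : ∀ w, fderiv ℝ s z w = 0 → w = 0 := by
    obtain ⟨hsz, hszc⟩ := hcls z hz
    obtain ⟨O', hO', hz', G, hG, hGe⟩ := κ.smooth i ⟨s z, hsz⟩
      (by rw [hszc]; exact κ.ψ.map_target (hOt hz))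
    have hGd : HasFDerivAt G (fderiv ℝ G (s z)) (s z) :=
      ((hG.contDiffAt (hO'.mem_nhds hz')).differentiableAt (by simp)).hasFDerivAt
    have h1 : (G ∘ s) =ᶠ[𝓝 z] id := by
      filter_upwards [hO.mem_nhds hz, hsd.continuousAt.preimage_mem_nhds (hO'.mem_nhds hz')]
        with w hw hw'
      obtain ⟨hsw, hswc⟩ := hcls w hw
      have : κ.ψ (V.cls i ⟨s w, hsw⟩) = G (s w) := hGe ⟨s w, hsw⟩ hw'
      rw [hswc, κ.ψ.right_inv (hOt hw)] at this
      exact this.symm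
    have h2 := (hGd.comp z hsd).unique ((hasFDerivAt_id z).congr_of_eventuallyEq h1)
    intro w hw
    have h3 := congrArg (fun L : _ →L[ℝ] Euc (n * (n - 1) / 2) × Euc n => L w) h2
    simpa [hw] using h3.symm
  -- leaf directions are vertical
  have hvert : ∀ a, (fderiv ℝ s z (a, 0)).1 = 0 := by
    have hev : (fun x => (s (x, z.2)).1) =ᶠ[𝓝 z.1] fun _ => (s z).1 := by
      have hpre : IsOpen ((fun x : Euc (n * (n - 1) / 2) => (x, z.2)) ⁻¹' O) :=
        hO.preimage (by fun_prop)
      obtain ⟨r, hr, hball⟩ := Metric.isOpen_iff.1 hpre z.1 hz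
      have := V.finite_Γ i
      have hcont : ContinuousOn (fun x => (s (x, z.2)).1) (Metric.ball z.1 r) :=
        (continuous_fst.comp_continuousOn hs.continuousOn).comp
          (f := fun x : Euc (n * (n - 1) / 2) => (x, z.2)) (by fun_prop) hball
      -- Along a plaque the base points stay in one fibre of `q_i`, a finite orbit of `Γ_i`. Being a
      -- connected set as well, they reduce to a single point.
      have hfin : ((fun x => (s (x, z.2)).1) '' Metric.ball z.1 r).Finite := by
        refine (Set.finite_range fun g : V.Γ i => V.gam i g (s z).1).subset ?_
        rintro _ ⟨x, hx, rfl⟩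
        obtain ⟨h1, h1c⟩ := hcls (x, z.2) (hball hx)
        obtain ⟨h2, h2c⟩ := hcls z hz
        refine (V.q_eq_q_iff i h2.1 h1.1).1 ?_
        have e1 : V.q i (s (x, z.2)).1 = V.proj (κ.ψ.symm (x, z.2)) := by rw [← h1c]; rfl
        have e2 : V.q i (s z).1 = V.proj (κ.ψ.symm (z.1, z.2)) := by rw [← h2c]; rfl
        have m1 := κ.mem_target_iff.1 (hOt (hball hx))
        have m2 := κ.mem_target_iff.1 (show (z.1, z.2) ∈ κ.ψ.target from hOt hz)
        rw [e1, e2]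
        exact κ.proj_eq _ m2.1 _ m1.1 _ m1.2
      have hsub : ((fun x => (s (x, z.2)).1) '' Metric.ball z.1 r).Subsingleton :=
        Set.not_nontrivial_iff.1 fun hnt =>
          (((convex_ball z.1 r).isPreconnected.image _ hcont).infinite_of_nontrivial hnt) hfin
      filter_upwards [Metric.ball_mem_nhds z.1 hr] with x hx
      exact hsub ⟨x, hx, rfl⟩ ⟨z.1, Metric.mem_ball_self hr, rfl⟩
    intro a
    have h1 : HasFDerivAt (fun x : Euc (n * (n - 1) / 2) => (x, z.2))
        (ContinuousLinearMap.inl ℝ _ (Euc n)) z.1 := hasFDerivAt_prodMk_left _ _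
    have h1' : HasFDerivAt (fun x => (s (x, z.2)).1) (((ContinuousLinearMap.fst ℝ _ _).comp
        (fderiv ℝ s z)).comp (ContinuousLinearMap.inl ℝ _ (Euc n))) z.1 :=
      HasFDerivAt.comp (g := fun w => (s w).1) (f := fun x => (x, z.2)) z.1 hsd.fst h1
    have h2 := h1'.unique ((hasFDerivAt_const (𝕜 := ℝ) (s z).1 z.1).congr_of_eventuallyEq hev)
    have h3 := congrArg (fun L : _ →L[ℝ] Euc n => L a) h2
    simpa using h3
  have hgram : ∀ a b w, fderiv ℝ (V.gram i a b) (s z) (fderiv ℝ s z w) = 0 := by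
    intro a b w
    have h1 : HasFDerivAt (V.gram i a b) (fderiv ℝ (V.gram i a b) (s z)) (s z) :=
      (((V.contDiffOn_gram i a b).contDiffAt (((V.isOpen_U i).prod isOpen_univ).mem_nhds
        ⟨(hsf z hz).1, trivial⟩)).differentiableAt (by simp)).hasFDerivAt
    have h2 : (V.gram i a b ∘ s) =ᶠ[𝓝 z] fun _ => if a = b then (1 : ℝ) else 0 := by
      filter_upwards [hO.mem_nhds hz] with w hw
      exact (hsf w hw).2 a b
    have h3 := (h1.comp z hsd).unique ((hasFDerivAt_const _ z).congr_of_eventuallyEq h2)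
    exact congrArg (fun L : _ →L[ℝ] ℝ => L w) h3
  -- a vertical vector is determined by its components with `b < c`
  have hdet : ∀ w, (fderiv ℝ s z w).1 = 0 → (∀ k, V.h i (s z).1 ((s z).2 (ltPairs n k).1.1)
      ((fderiv ℝ s z w).2 (ltPairs n k).1.2) = 0) → w = 0 := by
    intro w hw hk
    have hsymm := V.symm_h i _ (hsf z hz).1
    have hg : ∀ a b, V.h i (s z).1 ((s z).2 b) ((fderiv ℝ s z w).2 a)
        + V.h i (s z).1 ((s z).2 a) ((fderiv ℝ s z w).2 b) = 0 := by
      intro a b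
      have := hgram a b w
      rw [V.fderiv_gram i a b (hsf z hz).1, hw, hsymm ((fderiv ℝ s z w).2 a)] at this
      simpa using this
    have hlt : ∀ b c, b < c → V.h i (s z).1 ((s z).2 b) ((fderiv ℝ s z w).2 c) = 0 := by
      intro b c hbc
      obtain ⟨k, hk'⟩ := (ltPairs n).surjective ⟨(b, c), hbc⟩
      have := hk k
      rwa [hk'] at this
    refine hinj w (Prod.ext hw (funext fun c => V.eq_zero_of_frame (hsf z hz) fun b => ?_))
    rcases lt_trichotomy b c with h | h | h
    · exact hlt b c h
    · subst h
      have := hg b b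
      linarith
    · have h1 := hlt c b h
      have h2 := hg b c
      linarith
  -- By dimension count, `T` restricted to the leaf directions is bijective. If `(0, v)` is sent to
  -- a vertical vector, some `(a, 0)` has the same image under `T`; the difference of the two is
  -- vertical with zero `T`, so it vanishes and `v = 0`.
  let T : Euc (n * (n - 1) / 2) × Euc n →ₗ[ℝ] (Fin (n * (n - 1) / 2) → ℝ) :=
    LinearMap.pi fun k => ((V.h i (s z).1 ((s z).2 (ltPairs n k).1.1)).comp
      ((ContinuousLinearMap.proj (ltPairs n k).1.2).comp
        ((ContinuousLinearMap.snd ℝ _ _).comp (fderiv ℝ s z)))).toLinearMap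
  have hT : ∀ w k, T w k = V.h i (s z).1 ((s z).2 (ltPairs n k).1.1)
      ((fderiv ℝ s z w).2 (ltPairs n k).1.2) := fun w k => rfl
  have hTinj : Function.Injective (T ∘ₗ LinearMap.inl ℝ (Euc (n * (n - 1) / 2)) (Euc n)) := by
    rw [injective_iff_map_eq_zero]
    intro a ha
    have := hdet (a, 0) (hvert a) fun k => by
      rw [← hT]
      exact congrFun ha k
    exact congrArg Prod.fst this
  have hTsurj := (LinearMap.injective_iff_surjective_of_finrank_eq_finrank (by simp)).1 hTinj
  obtain ⟨a, ha⟩ := hTsurj (T (0, v))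
  have h1 := hdet ((0, v) - (a, 0)) (by rw [map_sub, Prod.fst_sub, hv, hvert, sub_zero]) fun k => by
    rw [← hT, map_sub]
    exact congrFun (sub_eq_zero.2 ha.symm) k
  simpa using congrArg Prod.snd h1

variable {V} in
/-- In adapted coordinates, the projection to the orbifold is locally a local diffeomorphism of
the transverse coordinates to a chart. -/
theorem AdaptedChart.exists_transverse (κ : V.AdaptedChart)
    {x : Euc (n * (n - 1) / 2)} (hx : x ∈ κ.A) {y : Euc n} (hy : y ∈ κ.B) :
    ∃ i, ∃ B, IsOpen B ∧ y ∈ B ∧ B ⊆ κ.B ∧ ∃ σ : Euc n → Euc n, ContDiffOn ℝ ∞ σ B ∧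
      Set.MapsTo σ B (V.U i) ∧ (∀ w ∈ B, Function.Injective (fderiv ℝ σ w)) ∧
      ∀ x' ∈ κ.A, ∀ w ∈ B, V.proj (κ.ψ.symm (x', w)) = V.q i (σ w) := by
  obtain ⟨i, O, hO, hzO, hOt, s, hs, hcls⟩ :=
    κ.smooth_symm (x, y) (κ.mem_target_iff.2 ⟨hx, hy⟩)
  have hpre : IsOpen ((fun w : Euc n => (x, w)) ⁻¹' O) := hO.preimage (by fun_prop)
  have hmem : ∀ w, (x, w) ∈ O → w ∈ κ.B := fun w hw => (κ.mem_target_iff.1 (hOt hw)).2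
  -- The map `σ` is the base point of a lift along the single slice through `x`. It serves all
  -- slices because plaques lie in leaves.
  refine ⟨i, _, hpre, hzO, hmem, fun w => (s (x, w)).1, ?_, fun w hw => ?_, fun w hw => ?_,
    fun x' hx' w hw => ?_⟩
  · exact contDiff_fst.comp_contDiffOn (hs.comp (f := fun w : Euc n => (x, w))
      (contDiffOn_const.prodMk contDiffOn_id) fun w hw => hw)
  · exact (hcls _ hw).1.1
  · rw [injective_iff_map_eq_zero]
    intro v hv
    refine κ.fderiv_lift_injective hO hOt hs hcls hw ?_
    have h1 : HasFDerivAt (fun w : Euc n => (x, w)) (ContinuousLinearMap.inr ℝ _ (Euc n)) w :=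
      hasFDerivAt_prodMk_right _ _
    have hsd : HasFDerivAt s (fderiv ℝ s (x, w)) (x, w) :=
      ((hs.contDiffAt (hO.mem_nhds hw)).differentiableAt (by simp)).hasFDerivAt
    have h2 : HasFDerivAt (fun w => (s (x, w)).1) _ w := hsd.fst.comp w h1
    rw [h2.fderiv] at hv
    simpa using hv
  · obtain ⟨h1, h2⟩ := hcls _ hw
    rw [κ.proj_eq x' hx' x hx w (hmem w hw), ← h2]
    rfl

end RiemannianOrbifold

end Orbifold

theorem HasLocalForm.congr_left {n k : ℕ} {T : Type*} {B : Set (Euc n)} (hB : IsOpen B)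
    {F F' G : T → Euc n → ℝ} (h : HasLocalForm k B F G) (hF : ∀ t, Set.EqOn (F' t) (F t) B) :
    HasLocalForm k B F' G := by
  obtain ⟨c, hc, hG⟩ := h
  refine ⟨c, hc, fun t x hx => ?_⟩
  rw [hG t x hx]
  exact Finset.sum_congr rfl fun α _ => by rw [multiDeriv_congr hB α (hF t) hx]

section Orbifold

namespace RiemannianOrbifold

variable {n : ℕ} {X ι : Type*} [TopologicalSpace X] (V : RiemannianOrbifold n X ι)

/-! ### Functions -/

/-- The pullback `p^* : C^∞(V) → C^∞(Ṽ, F)`. -/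
noncomputable def pullbackHom : V.smooth →ₐ[ℝ] V.folFun where
  toFun f := ⟨⟨fun v => (f : X → ℝ) (V.proj v), fun i z =>
      ⟨V.U i ×ˢ Set.univ, (V.isOpen_U i).prod isOpen_univ, ⟨z.2.1, trivial⟩,
        fun w => (f : X → ℝ) (V.q i w.1),
        (V.smooth_comp_q i f).comp contDiff_fst.contDiffOn fun _ hw => hw.1, fun _ _ => rfl⟩⟩,
    fun _ _ h => congrArg (f : X → ℝ) h⟩
  map_one' := rfl
  map_mul' _ _ := rfl
  map_zero' := rfl
  map_add' _ _ := rfl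
  commutes' _ := rfl

/-- Injectivity is surjectivity of the projection. A foliated function descends as a map by
constancy on fibres, and its expression in `U_i` is its restriction to a slice of an adapted chart
with the transverse coordinates of `U_i`, hence smooth. -/
theorem pullbackHom_bijective : Function.Bijective V.pullbackHom := by
  constructor
  · intro f g h
    refine Subtype.ext (funext fun p => ?_)
    obtain ⟨v, rfl⟩ := V.proj_surjective p
    exact congrFun (congrArg (fun g : V.folFun => ((g : V.totSmooth) : V.Resolution → ℝ)) h) v
  · intro g
    have hg : ∀ v, ((g : V.totSmooth) : V.Resolution → ℝ)
        (Function.surjInv V.proj_surjective (V.proj v))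
          = ((g : V.totSmooth) : V.Resolution → ℝ) v :=
      fun v => g.2 _ _ (Function.surjInv_eq V.proj_surjective _)
    refine ⟨⟨fun p => ((g : V.totSmooth) : V.Resolution → ℝ)
      (Function.surjInv V.proj_surjective p), V.isSmooth_iff.2 fun i y hy => ?_⟩,
      Subtype.ext (Subtype.ext (funext hg))⟩
    obtain ⟨u, hu⟩ := V.exists_frame hy
    obtain ⟨κ, -, hyB, ⟨x, hx⟩, hκ⟩ := V.exists_adaptedChart hu
    have h1 := (κ.contDiffOn_slice (g : V.totSmooth) ⟨x, hx⟩).contDiffAt (κ.isOpen_B.mem_nhds hyB)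
    refine (h1.congr_of_eventuallyEq ?_).contDiffWithinAt
    filter_upwards [κ.isOpen_B.mem_nhds hyB] with w hw
    rw [Function.comp_apply, ← (hκ x hx w hw).2]
    exact hg _

/-- The isomorphism `p^* : C^∞(V) ≅ C^∞(Ṽ, F)`. -/
noncomputable def pullback : V.smooth ≃ₐ[ℝ] V.folFun :=
  AlgEquiv.ofBijective V.pullbackHom V.pullbackHom_bijective

theorem pullback_apply (f : V.smooth) (v : V.Resolution) :
    ((V.pullback f : V.totSmooth) : V.Resolution → ℝ) v = (f : X → ℝ) (V.proj v) := rfl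

theorem folFun_apply (g : V.folFun) (v : V.Resolution) :
    ((g : V.totSmooth) : V.Resolution → ℝ) v = (V.pullback.symm g : X → ℝ) (V.proj v) := by
  rw [← V.pullback_apply, AlgEquiv.apply_symm_apply]

/-! ### Operators -/

/-- Conjugation with `p^*`. -/
noncomputable def conjPull : Module.End ℝ V.smooth ≃ₗ[ℝ] Module.End ℝ V.folFun :=
  V.pullback.toLinearEquiv.conj

theorem conjPull_apply (D : Module.End ℝ V.smooth) (g : V.folFun) :
    V.conjPull D g = V.pullback (D (V.pullback.symm g)) := rfl

theorem conjPull_symm_apply (D : Module.End ℝ V.folFun) (f : V.smooth) :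
    V.conjPull.symm D f = V.pullback.symm (D (V.pullback f)) := rfl

/-- Downwards, a slice of an adapted chart with the coordinates of `U_i` gives the coefficients near
each point. Upwards, the projection in any adapted chart is `q_i ∘ σ`, and the operator is pulled
back by `σ`; the coefficients depend on `y` only, since `σ` does. -/
theorem conjPull_mem_iff {k : ℕ} {D : Module.End ℝ V.smooth} :
    V.conjPull D ∈ V.folDiffOp k ↔ D ∈ V.diffOp k := by
  constructor
  · intro h i
    refine HasLocalForm.of_local (V.isOpen_U i) fun y hy => ?_
    obtain ⟨u, hu⟩ := V.exists_frame hy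
    obtain ⟨κ, -, hyB, ⟨x, hx⟩, hκ⟩ := V.exists_adaptedChart hu
    refine ⟨κ.B, κ.isOpen_B, hyB, ?_⟩
    have h1 := (h κ).reindex fun f : V.smooth => ((⟨x, hx⟩, V.pullback f) : κ.A × V.folFun)
    refine (h1.congr_left κ.isOpen_B fun f w hw => ?_).congr_right fun f w hw => ?_
    · rw [Function.comp_apply, V.pullback_apply, (hκ x hx w hw).2]
    · show _ = ((V.conjPull D (V.pullback f) : V.totSmooth) : V.Resolution → ℝ) (κ.ψ.symm (x, w))
      rw [Function.comp_apply, V.conjPull_apply, V.pullback_apply, (hκ x hx w hw).2,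
        AlgEquiv.symm_apply_apply]
  · intro h κ
    -- An adapted chart may be empty, since `A` is only required to be preconnected; then there is
    -- no parameter to check.
    rcases κ.A.eq_empty_or_nonempty with hA | ⟨x, hx⟩
    · exact ⟨fun _ => 0, fun _ => contDiffOn_const, fun t => (Set.eq_empty_iff_forall_notMem.1 hA _ t.1.2).elim⟩
    · refine HasLocalForm.of_local κ.isOpen_B fun y hy => ?_
      obtain ⟨i, B, hB, hyB, hBB, σ, hσ, hm, hinj, hp⟩ := κ.exists_transverse hx hy
      refine ⟨B, hB, hyB, ?_⟩
      have h1 := ((h i).comp_right hB (V.isOpen_U i) hσ hm hinj (V.smooth_comp_q i)).reindex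
        fun t : κ.A × V.folFun => V.pullback.symm t.2
      refine (h1.congr_left hB fun t w hw => ?_).congr_right fun t w hw => ?_
      · rw [V.folFun_apply, hp t.1 t.1.2 w hw]
        rfl
      · rw [V.conjPull_apply, V.pullback_apply, hp t.1 t.1.2 w hw]
        rfl

theorem conjPull_symm_mem_iff {k : ℕ} {D : Module.End ℝ V.folFun} :
    V.conjPull.symm D ∈ V.diffOp k ↔ D ∈ V.folDiffOp k := by
  rw [← V.conjPull_mem_iff, LinearEquiv.apply_symm_apply]

/-- The isomorphism `D^k(V) ≅ D^k(Ṽ, F)`. -/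
noncomputable def diffOpEquiv (k : ℕ) : V.diffOp k ≃ₗ[ℝ] V.folDiffOp k :=
  V.conjPull.ofSubmodules _ _ <| by
    ext D
    rw [Submodule.mem_map]
    constructor
    · rintro ⟨E, hE, rfl⟩
      exact V.conjPull_mem_iff.2 hE
    · intro hD
      exact ⟨V.conjPull.symm D, V.conjPull_symm_mem_iff.2 hD, V.conjPull.apply_symm_apply D⟩

/-- The isomorphism `D(V) ≅ D(Ṽ, F)` of Lie algebras. -/
noncomputable def diffOpsEquiv : V.diffOps ≃ₗ⁅ℝ⁆ V.folDiffOps :=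
  LieEquiv.ofSubalgebras _ _ (LinearEquiv.lieConj V.pullback.toLinearEquiv) <| by
    ext D
    rw [LieSubalgebra.mem_map]
    constructor
    · rintro ⟨E, ⟨k, hE⟩, rfl⟩
      exact ⟨k, V.conjPull_mem_iff.2 hE⟩
    · rintro ⟨k, hD⟩
      exact ⟨V.conjPull.symm D, ⟨k, V.conjPull_symm_mem_iff.2 hD⟩,
        V.conjPull.apply_symm_apply D⟩

theorem mem_lowerFolOp_diffOpEquiv {k : ℕ} {D : V.diffOp k} :
    V.diffOpEquiv k D ∈ V.lowerFolOp k ↔ D ∈ V.lowerOp k := by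
  cases k with
  | zero =>
    show V.diffOpEquiv 0 D ∈ (⊥ : Submodule ℝ _) ↔ D ∈ (⊥ : Submodule ℝ _)
    rw [Submodule.mem_bot, Submodule.mem_bot, LinearEquiv.map_eq_zero_iff]
  | succ k => exact V.conjPull_mem_iff

/-- The isomorphism `S^k(V) ≅ S^k(Ṽ, F)`. -/
noncomputable def symbolsEquiv (k : ℕ) : V.Symbols k ≃ₗ[ℝ] V.FolSymbols k :=
  Submodule.Quotient.equiv _ _ (V.diffOpEquiv k) <| by
    ext D
    rw [Submodule.mem_map]
    constructor
    · rintro ⟨E, hE, rfl⟩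
      exact V.mem_lowerFolOp_diffOpEquiv.2 hE
    · intro hD
      refine ⟨(V.diffOpEquiv k).symm D, ?_, (V.diffOpEquiv k).apply_symm_apply D⟩
      rw [← V.mem_lowerFolOp_diffOpEquiv, LinearEquiv.apply_symm_apply]
      exact hD

/-! ### Vector fields on the resolution and foliated functions -/

variable {V} in
-- In adapted coordinates a foliated function factors through the transverse coordinates, so only
-- the `y`-component of a direction matters.
theorem AdaptedChart.fderiv_folFun (κ : V.AdaptedChart) (g : V.folFun)
    {z : Euc (n * (n - 1) / 2) × Euc n} (hz : z ∈ κ.ψ.target)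
    (w : Euc (n * (n - 1) / 2) × Euc n) :
    fderiv ℝ (fun z => ((g : V.totSmooth) : V.Resolution → ℝ) (κ.ψ.symm z)) z w
      = fderiv ℝ (fun y => ((g : V.totSmooth) : V.Resolution → ℝ) (κ.ψ.symm (z.1, y))) z.2 w.2 := by
  have hzm : z.1 ∈ κ.A ∧ z.2 ∈ κ.B := κ.mem_target_iff.1 hz
  have h1 : (fun z => ((g : V.totSmooth) : V.Resolution → ℝ) (κ.ψ.symm z)) =ᶠ[𝓝 z]
      (fun y => ((g : V.totSmooth) : V.Resolution → ℝ) (κ.ψ.symm (z.1, y))) ∘ Prod.snd := by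
    filter_upwards [κ.ψ.open_target.mem_nhds hz] with z' hz'
    have hz'm : z'.1 ∈ κ.A ∧ z'.2 ∈ κ.B := κ.mem_target_iff.1 hz'
    exact g.2 _ _ (κ.proj_eq z'.1 hz'm.1 z.1 hzm.1 z'.2 hz'm.2)
  have h2 : DifferentiableAt ℝ
      (fun y => ((g : V.totSmooth) : V.Resolution → ℝ) (κ.ψ.symm (z.1, y))) z.2 :=
    ((κ.contDiffOn_slice (g : V.totSmooth) ⟨z.1, hzm.1⟩).contDiffAt
      (κ.isOpen_B.mem_nhds hzm.2)).differentiableAt (by simp)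
  rw [h1.fderiv_eq, fderiv_comp z h2 differentiableAt_snd, fderiv_snd]
  rfl

/-- The coefficients are read on one slice. They hold on all slices because both the function and
its derivative along `Y` are constant on the leaves. -/
theorem adaptedAction_mem (Y : V.adapted) : V.adaptedAction Y ∈ V.folDiffOp 1 := by
  intro κ
  obtain ⟨ξ, hξ, h⟩ := Y.2.1 κ
  rcases κ.A.eq_empty_or_nonempty with hA | ⟨x, hx⟩
  · exact ⟨fun _ => 0, fun _ => contDiffOn_const, fun t => (Set.eq_empty_iff_forall_notMem.1 hA _ t.1.2).elim⟩
  · refine HasLocalForm.of_one (a := fun _ => 0) (ξ := fun y => (ξ (x, y)).2) contDiffOn_const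
      ?_ fun t y hy => ?_
    · refine contDiff_snd.comp_contDiffOn (hξ.comp (f := fun y : Euc n => (x, y))
        (contDiffOn_const.prodMk contDiffOn_id) fun y hy => κ.mem_target_iff.2 ⟨hx, hy⟩)
    · have hz : (x, y) ∈ κ.ψ.target := κ.mem_target_iff.2 ⟨hx, hy⟩
      have h1 := h (t.2 : V.totSmooth) (x, y) hz
      rw [κ.fderiv_folFun t.2 hz] at h1
      have h2 : ((V.adaptedAction Y t.2 : V.totSmooth) : V.Resolution → ℝ) (κ.ψ.symm (t.1, y))
          = ((V.adaptedAction Y t.2 : V.totSmooth) : V.Resolution → ℝ) (κ.ψ.symm (x, y)) :=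
        (V.adaptedAction Y t.2).2 _ _ (κ.proj_eq _ t.1.2 _ hx _ hy)
      have h3 : Set.EqOn
          (fun y => ((t.2 : V.totSmooth) : V.Resolution → ℝ) (κ.ψ.symm (t.1, y)))
          (fun y => ((t.2 : V.totSmooth) : V.Resolution → ℝ) (κ.ψ.symm (x, y))) κ.B :=
        fun w hw => t.2.2 _ _ (κ.proj_eq _ t.1.2 _ hx _ hw)
      have h4 := Filter.eventuallyEq_of_mem (κ.isOpen_B.mem_nhds hy) h3
      rw [h2, h4.fderiv_eq, zero_mul, zero_add]
      exact h1

variable {V} in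
theorem IsTangent.apply_folFun {Y : Module.End ℝ V.totSmooth} (hY : V.IsTangent Y)
    (g : V.folFun) : Y g = 0 := by
  refine Subtype.ext (funext fun v => ?_)
  obtain ⟨κ, hκ⟩ := V.exists_adaptedChart_mem v
  obtain ⟨ξ, hξ, h0, h⟩ := hY κ
  have hz := κ.ψ.map_source hκ
  have := h g _ hz
  rw [κ.fderiv_folFun g hz, h0 _ hz, map_zero, κ.ψ.left_inv hκ] at this
  exact this

/-- If `η` were nonzero somewhere, it would be so on an open set. Its image under the open map `σ`
would contain a point where differentials separate tangent vectors, a contradiction. -/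
theorem eq_zero_of_forall_fderiv_eq_zero [T2Space X] {i : ι} {B : Set (Euc n)} (hB : IsOpen B)
    {σ η : Euc n → Euc n} (hσ : ContDiffOn ℝ ∞ σ B) (hm : Set.MapsTo σ B (V.U i))
    (hinj : ∀ w ∈ B, Function.Injective (fderiv ℝ σ w)) (hη : ContinuousOn η B)
    (h : ∀ f : V.smooth, ∀ w ∈ B, fderiv ℝ ((f : X → ℝ) ∘ V.q i) (σ w) (η w) = 0) :
    ∀ w ∈ B, η w = 0 := by
  intro w hw
  by_contra hne
  have h1 : IsOpen (B ∩ η ⁻¹' {0}ᶜ) := hη.isOpen_inter_preimage hB isOpen_compl_singleton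
  have hopen : IsOpen (σ '' (B ∩ η ⁻¹' {0}ᶜ)) := by
    rw [isOpen_iff_mem_nhds]
    rintro _ ⟨w', hw', rfl⟩
    obtain ⟨e, he⟩ := ContinuousLinearMap.isInvertible_of_injective rfl _ (hinj w' hw'.1)
    have hst : HasStrictFDerivAt σ (e : Euc n →L[ℝ] Euc n) w' := by
      rw [he]
      exact (hσ.contDiffAt (hB.mem_nhds hw'.1)).hasStrictFDerivAt (by simp)
    rw [← hst.map_nhds_eq_of_equiv]
    exact Filter.image_mem_map (h1.mem_nhds hw')
  obtain ⟨_, ⟨w', hw', rfl⟩, hsep⟩ := V.exists_separating hopen ⟨_, w, ⟨hw, hne⟩, rfl⟩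
    (by rintro _ ⟨w', hw', rfl⟩; exact hm hw'.1)
  exact hw'.2 (hsep _ fun f => h f w' hw'.1)

variable {V} in
/-- A vector field on `Ṽ` which annihilates the foliated functions is tangent to the leaves. -/
theorem IsVectorField.isTangent [T2Space X] {Y : Module.End ℝ V.totSmooth}
    (hY : V.IsVectorField Y) (h0 : ∀ g : V.folFun, Y g = 0) : V.IsTangent Y := by
  intro κ
  obtain ⟨ξ, hξ, h⟩ := hY κ
  refine ⟨ξ, hξ, fun z hz => ?_, h⟩
  have hzm : z.1 ∈ κ.A ∧ z.2 ∈ κ.B := κ.mem_target_iff.1 hz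
  obtain ⟨i, B, hB, hyB, hBB, σ, hσ, hm, hinj, hp⟩ := κ.exists_transverse hzm.1 hzm.2
  have hmem : ∀ w ∈ B, (z.1, w) ∈ κ.ψ.target := fun w hw => κ.mem_target_iff.2 ⟨hzm.1, hBB hw⟩
  have hξB : ContinuousOn (fun w => (ξ (z.1, w)).2) B :=
    continuous_snd.comp_continuousOn (hξ.continuousOn.comp (f := fun w : Euc n => (z.1, w))
      (by fun_prop) hmem)
  have hσd : ContinuousOn (fderiv ℝ σ) B :=
    (hσ.fderiv_of_isOpen hB (m := ∞) (by simp)).continuousOn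
  -- The vector to be killed is the image under `Dσ` of the transverse component of the field: its
  -- derivative of any `f ∘ q_i` is that of the pullback of `f` along the field, which is zero.
  have key := V.eq_zero_of_forall_fderiv_eq_zero hB hσ hm hinj
    (η := fun w => fderiv ℝ σ w (ξ (z.1, w)).2) (hσd.clm_apply hξB) fun f w hw => ?_
  · refine hinj z.2 hyB ?_
    rw [map_zero]
    exact key z.2 hyB
  · have h1 := h (V.pullback f : V.folFun) (z.1, w) (hmem w hw)
    rw [h0, κ.fderiv_folFun _ (hmem w hw)] at h1
    have h2 : (fun y => ((V.pullback f : V.totSmooth) : V.Resolution → ℝ) (κ.ψ.symm (z.1, y)))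
        =ᶠ[𝓝 w] ((f : X → ℝ) ∘ V.q i) ∘ σ := by
      filter_upwards [hB.mem_nhds hw] with w' hw'
      rw [V.pullback_apply, hp z.1 hzm.1 w' hw']
      rfl
    have h3 : DifferentiableAt ℝ ((f : X → ℝ) ∘ V.q i) (σ w) :=
      ((V.smooth_comp_q i f).contDiffAt ((V.isOpen_U i).mem_nhds (hm hw))).differentiableAt (by simp)
    have h4 : DifferentiableAt ℝ σ w := (hσ.contDiffAt (hB.mem_nhds hw)).differentiableAt (by simp)
    rw [h2.fderiv_eq, fderiv_comp w h3 h4] at h1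
    exact h1.symm

/-! ### Lifting vector fields to the frame bundles -/

/-- The complete lift of a vector field to tuples of tangent vectors. -/
noncomputable def completeLift (ξ : Euc n → Euc n) (z : Euc n × (Fin n → Euc n)) :
    Euc n × (Fin n → Euc n) :=
  (ξ z.1, fun a => fderiv ℝ ξ z.1 (z.2 a))

/-- The part of the complete lift of `ξ` that is transverse to the orthonormal frames. -/
noncomputable def gramCorrection (i : ι) (ξ : Euc n → Euc n) (z : Euc n × (Fin n → Euc n)) :
    Fin n → Euc n :=
  fun a => (2⁻¹ : ℝ) • ∑ c, fderiv ℝ (V.gram i a c) z (completeLift ξ z) • z.2 c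

/-- The projection of the complete lift of `ξ` to the tangent spaces of the orthonormal frame
bundle. -/
noncomputable def frameLift (i : ι) (ξ : Euc n → Euc n) (z : Euc n × (Fin n → Euc n)) :
    Euc n × (Fin n → Euc n) :=
  completeLift ξ z - (0, V.gramCorrection i ξ z)

theorem isOpen_frameDomain (i : ι) : IsOpen (V.U i ×ˢ (Set.univ : Set (Fin n → Euc n))) :=
  (V.isOpen_U i).prod isOpen_univ

theorem contDiffOn_frameLift {i : ι} {ξ : Euc n → Euc n} (hξ : ContDiffOn ℝ ∞ ξ (V.U i)) :
    ContDiffOn ℝ ∞ (V.frameLift i ξ) (V.U i ×ˢ Set.univ) := by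
  have hm : Set.MapsTo (Prod.fst : Euc n × (Fin n → Euc n) → Euc n) (V.U i ×ˢ Set.univ) (V.U i) :=
    fun z hz => hz.1
  have h2 : ContDiffOn ℝ ∞ (fun z : Euc n × (Fin n → Euc n) => fderiv ℝ ξ z.1)
      (V.U i ×ˢ Set.univ) :=
    (hξ.fderiv_of_isOpen (V.isOpen_U i) (m := ∞) (by simp)).comp contDiff_fst.contDiffOn hm
  have hp : ∀ a, ContDiffOn ℝ ∞ (fun z : Euc n × (Fin n → Euc n) => z.2 a) (V.U i ×ˢ Set.univ) :=
    fun a => ContDiff.contDiffOn (by fun_prop)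
  have h3 : ContDiffOn ℝ ∞ (completeLift ξ) (V.U i ×ˢ Set.univ) :=
    (hξ.comp contDiff_fst.contDiffOn hm).prodMk (contDiffOn_pi.2 fun a => h2.clm_apply (hp a))
  refine h3.sub (contDiffOn_const.prodMk (contDiffOn_pi.2 fun a => ?_))
  refine ContDiffOn.const_smul _ (ContDiffOn.sum fun c _ => ContDiffOn.fun_smul ?_ (hp c))
  exact ((V.contDiffOn_gram i a c).fderiv_of_isOpen (V.isOpen_frameDomain i) (m := ∞)
    (by simp)).clm_apply h3

theorem gram_comm {i : ι} (a b : Fin n) {z : Euc n × (Fin n → Euc n)} (hz : z.1 ∈ V.U i) :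
    V.gram i a b z = V.gram i b a z := V.symm_h i _ hz _ _

theorem fderiv_gram_comm {i : ι} (a b : Fin n) {z : Euc n × (Fin n → Euc n)}
    (hz : z.1 ∈ V.U i) : fderiv ℝ (V.gram i a b) z = fderiv ℝ (V.gram i b a) z := by
  refine Filter.EventuallyEq.fderiv_eq ?_
  filter_upwards [(V.isOpen_frameDomain i).mem_nhds ⟨hz, trivial⟩] with w hw
  exact V.gram_comm a b hw.1

/-- By orthonormality the correction pairs with `u_b` to half the variation of the Gram entry `(a,
b)`. The variation is symmetric, so the two halves cancel it exactly. -/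
theorem fderiv_gram_frameLift {i : ι} (ξ : Euc n → Euc n) {z : Euc n × (Fin n → Euc n)}
    (hz : z ∈ V.frames i) (a b : Fin n) :
    fderiv ℝ (V.gram i a b) z (V.frameLift i ξ z) = 0 := by
  have h1 : ∀ a b, V.h i z.1 (V.gramCorrection i ξ z a) (z.2 b)
      = 2⁻¹ * fderiv ℝ (V.gram i a b) z (completeLift ξ z) := by
    intro a b
    rw [gramCorrection, map_smul, smul_apply, map_sum, sum_apply]
    simp [hz.2]
  rw [frameLift, map_sub, V.fderiv_gram i a b hz.1 (0, V.gramCorrection i ξ z)]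
  simp only [map_zero, zero_apply, zero_add]
  rw [V.symm_h i _ hz.1 (z.2 a), h1, h1, V.fderiv_gram_comm b a hz.1]
  ring

theorem fderiv_jetLift {φ : Euc n → Euc n} {S : Set (Euc n)} (hS : IsOpen S)
    (hφ : ContDiffOn ℝ ∞ φ S) {z : Euc n × (Fin n → Euc n)} (hz : z.1 ∈ S)
    (ζ : Euc n × (Fin n → Euc n)) : fderiv ℝ (jetLift φ) z ζ
      = (fderiv ℝ φ z.1 ζ.1, fun a => fderiv ℝ (fderiv ℝ φ) z.1 ζ.1 (z.2 a)
        + fderiv ℝ φ z.1 (ζ.2 a)) := by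
  have h1 : HasFDerivAt φ (fderiv ℝ φ z.1) z.1 :=
    ((hφ.contDiffAt (hS.mem_nhds hz)).differentiableAt (by simp)).hasFDerivAt
  have h2 : HasFDerivAt (fderiv ℝ φ) (fderiv ℝ (fderiv ℝ φ) z.1) z.1 :=
    (((hφ.fderiv_of_isOpen hS (m := ∞) (by simp)).contDiffAt
      (hS.mem_nhds hz)).differentiableAt (by simp)).hasFDerivAt
  have hf : HasFDerivAt (fun z : Euc n × (Fin n → Euc n) => z.1)
      (ContinuousLinearMap.fst ℝ (Euc n) (Fin n → Euc n)) z := hasFDerivAt_fst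
  have hs : ∀ c, HasFDerivAt (fun z : Euc n × (Fin n → Euc n) => z.2 c)
      ((ContinuousLinearMap.proj c).comp (ContinuousLinearMap.snd ℝ (Euc n) (Fin n → Euc n))) z :=
    fun c => hasFDerivAt_pi'.1 hasFDerivAt_snd c
  have h3 : HasFDerivAt (fun z : Euc n × (Fin n → Euc n) => φ z.1)
      ((fderiv ℝ φ z.1).comp (ContinuousLinearMap.fst ℝ _ _)) z :=
    HasFDerivAt.comp (g := φ) (f := fun z : Euc n × (Fin n → Euc n) => z.1) z h1 hf
  have h4 : HasFDerivAt (fun z : Euc n × (Fin n → Euc n) => fderiv ℝ φ z.1)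
      ((fderiv ℝ (fderiv ℝ φ) z.1).comp (ContinuousLinearMap.fst ℝ _ _)) z :=
    HasFDerivAt.comp (g := fderiv ℝ φ) (f := fun z : Euc n × (Fin n → Euc n) => z.1) z h2 hf
  have h5 : HasFDerivAt (jetLift φ) _ z :=
    h3.prodMk (hasFDerivAt_pi.2 fun a => h4.clm_apply (hs a))
  rw [h5.fderiv]
  refine Prod.ext rfl (funext fun a => ?_)
  simp
  abel

variable {V} in
-- Differentiating `η ∘ φ = Dφ · ξ` in the direction of each vector of the tuple gives the claim, by
-- symmetry of the second derivative of `φ`.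
theorem IsChange.fderiv_jetLift_completeLift {i j : ι}
    {φ : OpenPartialHomeomorph (Euc n) (Euc n)} (h : V.IsChange i j φ) {ξ η : Euc n → Euc n}
    (hξ : ContDiffOn ℝ ∞ ξ (V.U i)) (hη : ContDiffOn ℝ ∞ η (V.U j))
    (hnat : ∀ x ∈ φ.source, η (φ x) = fderiv ℝ φ x (ξ x)) {z : Euc n × (Fin n → Euc n)}
    (hz : z.1 ∈ φ.source) :
    fderiv ℝ (jetLift φ) z (completeLift ξ z) = completeLift η (jetLift φ z) := by
  have hφ := h.2.2.1.contDiffOn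
  have hφz : ContDiffAt ℝ ∞ φ z.1 := hφ.contDiffAt (φ.open_source.mem_nhds hz)
  rw [fderiv_jetLift φ.open_source hφ hz]
  refine Prod.ext (hnat _ hz).symm (funext fun a => ?_)
  have hs : IsSymmSndFDerivAt ℝ φ z.1 := hφz.isSymmSndFDerivAt (by
    rw [minSmoothness_of_isRCLikeNormedField]
    exact (WithTop.coe_le_coe.2 le_top : ((2 : ℕ∞) : WithTop ℕ∞) ≤ ∞))
  have h1 : HasFDerivAt φ (fderiv ℝ φ z.1) z.1 := (hφz.differentiableAt (by simp)).hasFDerivAt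
  have h2 : HasFDerivAt (fderiv ℝ φ) (fderiv ℝ (fderiv ℝ φ) z.1) z.1 :=
    ((hφz.fderiv_right (m := ∞) (by simp)).differentiableAt (by simp)).hasFDerivAt
  have h3 : HasFDerivAt ξ (fderiv ℝ ξ z.1) z.1 :=
    ((hξ.contDiffAt ((V.isOpen_U i).mem_nhds (h.1 hz))).differentiableAt (by simp)).hasFDerivAt
  have h4 : HasFDerivAt η (fderiv ℝ η (φ z.1)) (φ z.1) :=
    ((hη.contDiffAt ((V.isOpen_U j).mem_nhds (h.2.1 (φ.map_source hz)))).differentiableAt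
      (by simp)).hasFDerivAt
  have h5 := (h4.comp z.1 h1).congr_of_eventuallyEq
    (f₁ := fun x => fderiv ℝ φ x (ξ x)) (by
      filter_upwards [φ.open_source.mem_nhds hz] with x hx
      exact (hnat x hx).symm)
  have h6 := congrArg (fun L : Euc n →L[ℝ] Euc n => L (z.2 a)) (h5.unique (h2.clm_apply h3))
  simp only [ContinuousLinearMap.comp_apply, add_apply, ContinuousLinearMap.flip_apply] at h6
  show fderiv ℝ (fderiv ℝ φ) z.1 (ξ z.1) (z.2 a) + fderiv ℝ φ z.1 (fderiv ℝ ξ z.1 (z.2 a))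
    = fderiv ℝ η (φ z.1) (fderiv ℝ φ z.1 (z.2 a))
  rw [h6, hs.eq (ξ z.1) (z.2 a)]
  abel

variable {V} in
-- Lifts of isometries preserve the Gram functions, so the scalar weights of the correction match.
-- The correction is vertical, and on vertical vectors the lift acts by `Dφ`.
theorem IsChange.fderiv_jetLift_frameLift {i j : ι}
    {φ : OpenPartialHomeomorph (Euc n) (Euc n)} (h : V.IsChange i j φ) {ξ η : Euc n → Euc n}
    (hξ : ContDiffOn ℝ ∞ ξ (V.U i)) (hη : ContDiffOn ℝ ∞ η (V.U j))
    (hnat : ∀ x ∈ φ.source, η (φ x) = fderiv ℝ φ x (ξ x)) {z : Euc n × (Fin n → Euc n)}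
    (hz : z.1 ∈ φ.source) :
    fderiv ℝ (jetLift φ) z (V.frameLift i ξ z) = V.frameLift j η (jetLift φ z) := by
  have hφ := h.2.2.1.contDiffOn
  have hc := h.fderiv_jetLift_completeLift hξ hη hnat hz
  have hJ : DifferentiableAt ℝ (jetLift φ) z :=
    ((contDiffOn_jetLift φ.open_source hφ).contDiffAt
      ((φ.open_source.prod isOpen_univ).mem_nhds ⟨hz, trivial⟩)).differentiableAt (by simp)
  have hgram : ∀ a c, fderiv ℝ (V.gram j a c) (jetLift φ z) (completeLift η (jetLift φ z))
      = fderiv ℝ (V.gram i a c) z (completeLift ξ z) := by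
    intro a c
    have h1 : DifferentiableAt ℝ (V.gram j a c) (jetLift φ z) :=
      ((V.contDiffOn_gram j a c).contDiffAt ((V.isOpen_frameDomain j).mem_nhds
        ⟨h.2.1 (φ.map_source hz), trivial⟩)).differentiableAt (by simp)
    have h2 : V.gram j a c ∘ jetLift φ =ᶠ[𝓝 z] V.gram i a c := by
      filter_upwards [(φ.open_source.prod (isOpen_univ (X := Fin n → Euc n))).mem_nhds
        ⟨hz, trivial⟩] with w hw
      exact h.2.2.1.metric _ hw.1 _ _
    rw [← hc, ← h2.fderiv_eq, fderiv_comp z h1 hJ]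
    rfl
  rw [frameLift, map_sub, hc, frameLift, fderiv_jetLift φ.open_source hφ hz]
  congr 1
  refine Prod.ext (map_zero _) (funext fun a => ?_)
  simp only [map_zero, zero_apply, zero_add, gramCorrection, hgram, map_smul, map_sum]
  rfl

/-! ### The vector field on the resolution -/

/-- A family of vector fields on the charts which is invariant under changes of charts. -/
structure InvariantField where
  /-- the local vector fields -/
  ξ : ι → Euc n → Euc n
  contDiffOn : ∀ i, ContDiffOn ℝ ∞ (ξ i) (V.U i)
  natural : ∀ i j (φ : OpenPartialHomeomorph (Euc n) (Euc n)), V.IsChange i j φ →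
    ∀ x ∈ φ.source, ξ j (φ x) = fderiv ℝ φ x (ξ i x)

namespace InvariantField

variable {V} (W : V.InvariantField)

/-- The derivative of a smooth function on `Ṽ` along the lift of the field to `Ũ_i`. -/
noncomputable def derivAt (g : V.totSmooth) (i : ι) (u : V.frames i) : ℝ :=
  fderiv ℝ (g.2 i u).choose_spec.2.2.choose u.1 (V.frameLift i (W.ξ i) u.1)

/-- The lifted field is tangent to the orthonormal frames, so the chosen ambient extension may be
replaced by any other. -/
theorem derivAt_eq (g : V.totSmooth) {i : ι} (u : V.frames i) {G : Euc n × (Fin n → Euc n) → ℝ}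
    (hG : DifferentiableAt ℝ G u.1)
    (h : ∀ᶠ w in 𝓝 u.1, ∀ hw : w ∈ V.frames i,
      (g : V.Resolution → ℝ) (V.cls i ⟨w, hw⟩) = G w) :
    W.derivAt g i u = fderiv ℝ G u.1 (V.frameLift i (W.ξ i) u.1) := by
  have hO := (g.2 i u).choose_spec.1
  have hu := (g.2 i u).choose_spec.2.1
  obtain ⟨h1, h2⟩ := (g.2 i u).choose_spec.2.2.choose_spec
  refine V.fderiv_eq_of_eqOn_frames u.2 ((h1.contDiffAt (hO.mem_nhds hu)).differentiableAt
    (by simp)) hG ?_ (V.fderiv_gram_frameLift _ u.2)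
  filter_upwards [h, hO.mem_nhds hu] with w hw hwO hwf
  exact (h2 ⟨w, hwf⟩ hwO).symm.trans (hw hwf)

theorem exists_extension (g : V.totSmooth) {i : ι} (u : V.frames i) :
    ∃ O, IsOpen O ∧ u.1 ∈ O ∧ ∃ G : Euc n × (Fin n → Euc n) → ℝ, ContDiffOn ℝ ∞ G O ∧
      (∀ w (hw : w ∈ V.frames i), w ∈ O → (g : V.Resolution → ℝ) (V.cls i ⟨w, hw⟩) = G w) ∧
      ∀ w : V.frames i, w.1 ∈ O → W.derivAt g i w
        = fderiv ℝ G w.1 (V.frameLift i (W.ξ i) w.1) := by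
  obtain ⟨O, hO, hu, G, hG, h⟩ := g.2 i u
  refine ⟨O, hO, hu, G, hG, fun w hw hwO => h ⟨w, hw⟩ hwO, fun w hw => ?_⟩
  refine W.derivAt_eq g w ((hG.contDiffAt (hO.mem_nhds hw)).differentiableAt (by simp)) ?_
  filter_upwards [hO.mem_nhds hw] with w' hw' hwf
  exact h ⟨w', hwf⟩ hw'

/-- An extension over `U_j` pulls back along the lifted change of charts to one over `U_i`, and that
lift carries one field to the other. Hence the derivative descends to the resolution. -/
theorem derivAt_eq_of_cls_eq (g : V.totSmooth) {i j : ι} (u : V.frames i) (w : V.frames j)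
    (h : V.cls i u = V.cls j w) : W.derivAt g i u = W.derivAt g j w := by
  obtain ⟨φ, hφ, hus, hwu⟩ := (V.cls_eq_cls_iff u w).1 h
  obtain ⟨O, hO, hwO, G, hG, hGe, hGd⟩ := W.exists_extension g w
  have hwO' : jetLift φ u.1 ∈ O := hwu ▸ hwO
  have hJ : ContDiffAt ℝ ∞ (jetLift φ) u.1 :=
    (contDiffOn_jetLift φ.open_source hφ.2.2.1.contDiffOn).contDiffAt
      ((φ.open_source.prod isOpen_univ).mem_nhds ⟨hus, trivial⟩)
  have hGw : DifferentiableAt ℝ G (jetLift φ u.1) :=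
    (hG.contDiffAt (hO.mem_nhds hwO')).differentiableAt (by simp)
  have hJd : DifferentiableAt ℝ (jetLift φ) u.1 := hJ.differentiableAt (by simp)
  rw [hGd w hwO, W.derivAt_eq g u (G := G ∘ jetLift φ) (hGw.comp _ hJd) ?_,
    fderiv_comp _ hGw hJd, hwu, ContinuousLinearMap.comp_apply,
    hφ.fderiv_jetLift_frameLift (W.contDiffOn i) (W.contDiffOn j) (W.natural i j φ hφ) hus]
  filter_upwards [(φ.open_source.prod (isOpen_univ (X := Fin n → Euc n))).mem_nhds ⟨hus, trivial⟩,
    hJ.continuousAt.preimage_mem_nhds (hO.mem_nhds hwO')] with z hz hzO hzf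
  rw [Function.comp_apply, ← hGe _ (hφ.jetLift_mem hzf hz.1) hzO,
    hφ.cls_jetLift ⟨z, hzf⟩ hz.1]

/-- The lift of the field to `Ṽ`, acting on smooth functions. -/
noncomputable def lift : Module.End ℝ V.totSmooth where
  toFun g := ⟨Quotient.lift (fun a : Σ i, V.frames i => W.derivAt g a.1 a.2)
      fun a b h => W.derivAt_eq_of_cls_eq g a.2 b.2 (Quotient.sound h), by
    intro i z
    obtain ⟨O, hO, hzO, G, hG, -, hGd⟩ := W.exists_extension g z
    refine ⟨O ∩ V.U i ×ˢ Set.univ, hO.inter (V.isOpen_frameDomain i), ⟨hzO, z.2.1, trivial⟩,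
      fun w => fderiv ℝ G w (V.frameLift i (W.ξ i) w), ?_, fun w hw => hGd w hw.1⟩
    exact ((hG.fderiv_of_isOpen hO (m := ∞) (by simp)).mono Set.inter_subset_left).clm_apply
      ((V.contDiffOn_frameLift (W.contDiffOn i)).mono Set.inter_subset_right)⟩
  map_add' f g := by
    refine Subtype.ext (funext fun v => ?_)
    obtain ⟨i, u, rfl⟩ := V.exists_cls_eq v
    obtain ⟨O, hO, huO, G, hG, hGe, hGd⟩ := W.exists_extension f u
    obtain ⟨O', hO', huO', G', hG', hGe', hGd'⟩ := W.exists_extension g u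
    have d1 := (hG.contDiffAt (hO.mem_nhds huO)).differentiableAt (by simp)
    have d2 := (hG'.contDiffAt (hO'.mem_nhds huO')).differentiableAt (by simp)
    show W.derivAt (f + g) i u = W.derivAt f i u + W.derivAt g i u
    rw [hGd u huO, hGd' u huO', W.derivAt_eq (f + g) u (d1.add d2), fderiv_add d1 d2]
    · rfl
    · filter_upwards [hO.mem_nhds huO, hO'.mem_nhds huO'] with w hw hw' hwf
      exact congrArg₂ (· + ·) (hGe w hwf hw) (hGe' w hwf hw')
  map_smul' r f := by
    refine Subtype.ext (funext fun v => ?_)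
    obtain ⟨i, u, rfl⟩ := V.exists_cls_eq v
    obtain ⟨O, hO, huO, G, hG, hGe, hGd⟩ := W.exists_extension f u
    have d1 := (hG.contDiffAt (hO.mem_nhds huO)).differentiableAt (by simp)
    show W.derivAt (r • f) i u = r • W.derivAt f i u
    rw [hGd u huO, W.derivAt_eq (r • f) u (d1.const_smul r), fderiv_const_smul d1 r]
    · rfl
    · filter_upwards [hO.mem_nhds huO] with w hw hwf
      exact congrArg (r • ·) (hGe w hwf hw)

theorem lift_apply_cls (g : V.totSmooth) (i : ι) (u : V.frames i) :
    (W.lift g : V.Resolution → ℝ) (V.cls i u) = W.derivAt g i u := rfl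

/-- The possible values of the coordinate vector at a point form an affine, hence convex, set. Local
choices are therefore patched, as for the coefficients of operators. -/
theorem isVectorField_lift : V.IsVectorField W.lift := by
  intro κ
  let S : Euc (n * (n - 1) / 2) × Euc n → Set (Euc (n * (n - 1) / 2) × Euc n) := fun z =>
    {η | ∀ g : V.totSmooth, (W.lift g : V.Resolution → ℝ) (κ.ψ.symm z)
      = fderiv ℝ (fun z => (g : V.Resolution → ℝ) (κ.ψ.symm z)) z η}
  have hS : ∀ z, Convex ℝ (S z) := by
    intro z η hη η' hη' a b _ _ hab g
    rw [map_add, map_smul, map_smul, ← hη g, ← hη' g, ← add_smul, hab, one_smul]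
  have hloc : ∀ z₀ ∈ κ.ψ.target, ∃ N, IsOpen N ∧ z₀ ∈ N ∧
      ∃ η : Euc (n * (n - 1) / 2) × Euc n → Euc (n * (n - 1) / 2) × Euc n,
        ContDiffOn ℝ ∞ η N ∧ ∀ z ∈ N, z ∈ κ.ψ.target → η z ∈ S z := by
    intro z₀ hz₀
    obtain ⟨i, O, hO, hzO, hOt, s, hs, hcls⟩ := κ.smooth_symm z₀ hz₀
    obtain ⟨hs0, hs0c⟩ := hcls z₀ hzO
    obtain ⟨O', hO', hzO', G, hG, hGe⟩ := κ.smooth i ⟨s z₀, hs0⟩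
      (by rw [hs0c]; exact κ.ψ.map_target hz₀)
    have hGe' : ∀ w (hw : w ∈ V.frames i), w ∈ O' → κ.ψ (V.cls i ⟨w, hw⟩) = G w :=
      fun w hw hwO => hGe ⟨w, hw⟩ hwO
    have hN : IsOpen (O ∩ s ⁻¹' O') := hs.continuousOn.isOpen_inter_preimage hO hO'
    have hsf : ∀ z ∈ O, s z ∈ V.frames i := fun z hz => (hcls z hz).1
    -- Locally the coordinate vector is the frame lift at a local section `s`, pushed forward by an
    -- ambient extension `G` of the chart.
    refine ⟨_, hN, ⟨hzO, hzO'⟩, fun z => fderiv ℝ G (s z) (V.frameLift i (W.ξ i) (s z)), ?_,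
      fun z hz _ g => ?_⟩
    · have hs' := hs.mono (Set.inter_subset_left (t := s ⁻¹' O'))
      exact ((hG.fderiv_of_isOpen hO' (m := ∞) (by simp)).comp hs' fun z hz => hz.2).clm_apply
        ((V.contDiffOn_frameLift (W.contDiffOn i)).comp hs' fun z hz => ⟨(hsf z hz.1).1, trivial⟩)
    · obtain ⟨hsz, hszc⟩ := hcls z hz.1
      have hzt := hOt hz.1
      have hGz : G (s z) = z := by
        rw [← hGe' (s z) hsz hz.2, hszc, κ.ψ.right_inv hzt]
      have hGd : DifferentiableAt ℝ G (s z) :=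
        (hG.contDiffAt (hO'.mem_nhds hz.2)).differentiableAt (by simp)
      have hgd : DifferentiableAt ℝ (fun z => (g : V.Resolution → ℝ) (κ.ψ.symm z)) (G (s z)) := by
        rw [hGz]
        exact ((κ.contDiffOn g).contDiffAt (κ.ψ.open_target.mem_nhds hzt)).differentiableAt (by simp)
      rw [← hszc, W.lift_apply_cls, W.derivAt_eq g ⟨s z, hsz⟩ (hgd.comp _ hGd) ?_,
        fderiv_comp _ hgd hGd, hGz]
      · rfl
      · obtain ⟨O₁, hO₁, hO₁e⟩ := isOpen_induced_iff.1
          (κ.ψ.open_source.preimage (V.continuous_cls i))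
        have hmem : ∀ w (hw : w ∈ V.frames i), w ∈ O₁ ↔ V.cls i ⟨w, hw⟩ ∈ κ.ψ.source :=
          fun w hw => Set.ext_iff.1 hO₁e ⟨w, hw⟩
        have hszO₁ : s z ∈ O₁ := (hmem _ hsz).2 (by rw [hszc]; exact κ.ψ.map_target hzt)
        filter_upwards [hO'.mem_nhds hz.2, hO₁.mem_nhds hszO₁] with w hw hw1 hwf
        rw [Function.comp_apply, ← hGe' w hwf hw, κ.ψ.left_inv ((hmem w hwf).1 hw1)]
  obtain ⟨η, hη, hηS⟩ := exists_contDiffOn_forall_mem_convex_of_local κ.ψ.open_target S hS hloc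
  exact ⟨η, hη, fun g z hz => hηS z hz g⟩

/-- A pulled back function depends on the base point only, so the vertical components of the lift,
correction included, are invisible to it. -/
theorem lift_pullback (f : V.smooth) (i : ι) (u : V.frames i) :
    (W.lift (V.pullback f : V.folFun) : V.Resolution → ℝ) (V.cls i u)
      = fderiv ℝ ((f : X → ℝ) ∘ V.q i) u.1.1 (W.ξ i u.1.1) := by
  have hf : DifferentiableAt ℝ ((f : X → ℝ) ∘ V.q i) u.1.1 :=
    ((V.smooth_comp_q i f).contDiffAt ((V.isOpen_U i).mem_nhds u.2.1)).differentiableAt (by simp)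
  have h1 : HasFDerivAt (fun z : Euc n × (Fin n → Euc n) => z.1)
      (ContinuousLinearMap.fst ℝ (Euc n) (Fin n → Euc n)) u.1 := hasFDerivAt_fst
  have h2 : HasFDerivAt (fun z : Euc n × (Fin n → Euc n) => ((f : X → ℝ) ∘ V.q i) z.1)
      ((fderiv ℝ ((f : X → ℝ) ∘ V.q i) u.1.1).comp (ContinuousLinearMap.fst ℝ _ _)) u.1 :=
    HasFDerivAt.comp (g := (f : X → ℝ) ∘ V.q i)
      (f := fun z : Euc n × (Fin n → Euc n) => z.1) u.1 hf.hasFDerivAt h1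
  rw [W.lift_apply_cls, W.derivAt_eq _ u h2.differentiableAt
    (Filter.Eventually.of_forall fun w hw => rfl), h2.fderiv]
  simp [frameLift, completeLift]

end InvariantField

/-! ### First order operators and adapted vector fields -/

/-- Applying `D` to the constant `1` isolates the zero order term. For a change of charts `φ`, the
vectors `ξ_j ∘ φ` and `Dφ ξ_i` differentiate all smooth functions alike, so they agree by density of
the separating points. -/
theorem exists_invariantField [T2Space X] {D : Module.End ℝ V.smooth} (hD : D ∈ V.diffOp 1) :
    ∃ W : V.InvariantField, ∀ (f : V.smooth) (i : ι), ∀ x ∈ V.U i,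
      (D f : X → ℝ) (V.q i x) = (D 1 : X → ℝ) (V.q i x) * (f : X → ℝ) (V.q i x)
        + fderiv ℝ ((f : X → ℝ) ∘ V.q i) x (W.ξ i x) := by
  choose a ξ ha hξ hDf using fun i => (hD i).exists_of_one
  have ha1 : ∀ i, ∀ x ∈ V.U i, (D 1 : X → ℝ) (V.q i x) = a i x := by
    intro i x hx
    have h1 := hDf i 1 x hx
    have h2 : ((1 : V.smooth) : X → ℝ) ∘ V.q i = fun _ => 1 := rfl
    rw [h2] at h1
    simpa using h1
  have hform : ∀ (f : V.smooth) (i : ι), ∀ x ∈ V.U i,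
      (D f : X → ℝ) (V.q i x) = (D 1 : X → ℝ) (V.q i x) * (f : X → ℝ) (V.q i x)
        + fderiv ℝ ((f : X → ℝ) ∘ V.q i) x (ξ i x) := by
    intro f i x hx
    rw [ha1 i x hx]
    exact hDf i f x hx
  refine ⟨⟨ξ, hξ, fun i j φ hφ x hx => ?_⟩, hform⟩
  have hφc := hφ.2.2.1.contDiffOn
  have hdc : ∀ y ∈ φ.source, DifferentiableAt ℝ φ y := fun y hy =>
    (hφc.contDiffAt (φ.open_source.mem_nhds hy)).differentiableAt (by simp)
  refine sub_eq_zero.1 (V.eq_zero_of_forall_fderiv_eq_zero φ.open_source hφc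
    (fun y hy => hφ.2.1 (φ.map_source hy)) (fun y hy v w hvw => ?_)
    (η := fun y => ξ j (φ y) - fderiv ℝ φ y (ξ i y)) ?_ (fun f y hy => ?_) x hx)
  · rw [← hφ.fderiv_symm hy v, hvw, hφ.fderiv_symm hy w]
  · refine ContinuousOn.sub ?_ ?_
    · exact (hξ j).continuousOn.comp hφc.continuousOn fun y hy => hφ.2.1 (φ.map_source hy)
    · exact (hφc.fderiv_of_isOpen φ.open_source (m := ∞) (by simp)).continuousOn.clm_apply
        ((hξ i).continuousOn.mono hφ.1)
  · have hmem : φ y ∈ V.U j := hφ.2.1 (φ.map_source hy)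
    have h1 := hform f j (φ y) hmem
    have h2 := hform f i y (hφ.1 hy)
    rw [hφ.2.2.2 y hy] at h1
    have hfd : DifferentiableAt ℝ ((f : X → ℝ) ∘ V.q j) (φ y) :=
      ((V.smooth_comp_q j f).contDiffAt ((V.isOpen_U j).mem_nhds hmem)).differentiableAt (by simp)
    have h3 : (f : X → ℝ) ∘ V.q i =ᶠ[𝓝 y] ((f : X → ℝ) ∘ V.q j) ∘ φ := by
      filter_upwards [φ.open_source.mem_nhds hy] with w hw
      simp [hφ.2.2.2 w hw]
    rw [h3.fderiv_eq, fderiv_comp y hfd (hdc y hy), ContinuousLinearMap.comp_apply] at h2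
    rw [map_sub]
    linarith

variable {V} in
theorem IsVectorField.apply_one {Y : Module.End ℝ V.totSmooth} (hY : V.IsVectorField Y) :
    Y 1 = 0 := by
  refine Subtype.ext (funext fun v => ?_)
  obtain ⟨κ, hκ⟩ := V.exists_adaptedChart_mem v
  obtain ⟨ξ, -, h⟩ := hY κ
  have h1 := h 1 _ (κ.ψ.map_source hκ)
  have h2 : (fun z => ((1 : V.totSmooth) : V.Resolution → ℝ) (κ.ψ.symm z)) = fun _ => 1 := rfl
  rw [h2, κ.ψ.left_inv hκ] at h1
  simpa using h1

theorem mem_folFun_iff_exists_pullback {g : V.totSmooth} :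
    g ∈ V.folFun ↔ ∃ f : V.smooth, (V.pullback f : V.totSmooth) = g :=
  ⟨fun h => ⟨V.pullback.symm ⟨g, h⟩, by rw [AlgEquiv.apply_symm_apply]⟩,
    fun ⟨f, hf⟩ => hf ▸ (V.pullback f).2⟩

/-- Every first order operator is, up to an operator of order zero, the action of an adapted
vector field. -/
theorem exists_adapted_symbol [T2Space X] {D : Module.End ℝ V.smooth} (hD : D ∈ V.diffOp 1) :
    ∃ Y : V.adapted, D - V.conjPull.symm (V.adaptedAction Y) ∈ V.diffOp 0 := by
  obtain ⟨W, hW⟩ := V.exists_invariantField hD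
  have hact : ∀ f : V.smooth, W.lift (V.pullback f : V.folFun)
      = (V.pullback (D f - D 1 * f) : V.folFun) := by
    intro f
    refine Subtype.ext (funext fun v => ?_)
    obtain ⟨i, u, rfl⟩ := V.exists_cls_eq v
    rw [W.lift_pullback, V.pullback_apply, proj_cls]
    have h1 := hW f i u.1.1 u.2.1
    have h2 : ((D f - D 1 * f : V.smooth) : X → ℝ) (V.q i u.1.1) = (D f : X → ℝ) (V.q i u.1.1)
      - (D 1 : X → ℝ) (V.q i u.1.1) * (f : X → ℝ) (V.q i u.1.1) := rfl
    rw [h2]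
    linarith
  have hfol : ∀ g ∈ V.folFun, W.lift g ∈ V.folFun := by
    intro g hg
    obtain ⟨f, rfl⟩ := V.mem_folFun_iff_exists_pullback.1 hg
    rw [hact]
    exact Subtype.prop _
  have hvf := W.isVectorField_lift
  -- The lift preserves foliated functions and `T` kills them. So the commutator is a field killing
  -- them too, and such fields are tangent.
  have htan : ∀ T ∈ V.tangent, W.lift * T - T * W.lift ∈ V.tangent := by
    intro T hT
    have hT' : V.IsTangent T := hT
    have hTv : V.IsVectorField T := fun κ => by
      obtain ⟨ξ, hξ, -, h⟩ := hT' κ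
      exact ⟨ξ, hξ, h⟩
    refine (hvf.commutator hTv).isTangent fun g => ?_
    show W.lift (T g) - T (W.lift g) = 0
    rw [hT'.apply_folFun g, hT'.apply_folFun ⟨W.lift g, hfol g g.2⟩, map_zero, sub_zero]
  refine ⟨⟨W.lift, hvf, htan, hfol⟩, fun i => ?_⟩
  refine HasLocalForm.of_zero (V.smooth_comp_q i (D 1)) fun f x hx => ?_
  have h1 : V.conjPull.symm (V.adaptedAction ⟨W.lift, hvf, htan, hfol⟩) f = D f - D 1 * f := by
    rw [V.conjPull_symm_apply, AlgEquiv.symm_apply_eq]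
    exact Subtype.ext (hact f)
  have h2 : (D - V.conjPull.symm (V.adaptedAction ⟨W.lift, hvf, htan, hfol⟩)) f = D 1 * f := by
    rw [LinearMap.sub_apply, h1, sub_sub_cancel]
  rw [h2]
  rfl

/-- An operator of order zero is multiplication by its value on `1`, and a vector field kills `1`.
So order zero means zero action on foliated functions, which is tangency. -/
theorem adaptedAction_mem_zero_iff [T2Space X] (Y : V.adapted) :
    V.adaptedAction Y ∈ V.folDiffOp 0 ↔ Y ∈ V.tangentIdeal := by
  constructor
  · intro h
    refine Y.2.1.isTangent fun g => ?_
    have h1 := V.conjPull_symm_mem_iff.2 h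
    set E := V.conjPull.symm (V.adaptedAction Y) with hE
    have hE1 : E 1 = 0 := by
      rw [hE, V.conjPull_symm_apply, map_one, AlgEquiv.symm_apply_eq, map_zero]
      exact Subtype.ext Y.2.1.apply_one
    have hE0 : ∀ f, E f = 0 := by
      intro f
      refine Subtype.ext (funext fun p => ?_)
      obtain ⟨i, x, hx, rfl⟩ := V.cover p
      obtain ⟨a, -, ha⟩ := (h1 i).exists_of_zero
      have e1 := ha 1 x hx
      have e2 := ha f x hx
      have e3 : ((1 : V.smooth) : X → ℝ) (V.q i x) = 1 := rfl
      rw [hE1, Function.comp_apply, Function.comp_apply, e3, mul_one] at e1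
      rw [← e1] at e2
      exact e2.trans (zero_mul _)
    have h2 : V.adaptedAction Y g = 0 := by
      have := hE0 (V.pullback.symm g)
      rwa [hE, V.conjPull_symm_apply, AlgEquiv.apply_symm_apply, AlgEquiv.symm_apply_eq,
        map_zero] at this
    exact congrArg Subtype.val h2
  · intro h
    have h1 : V.IsTangent (Y : Module.End ℝ V.totSmooth) := h
    have h2 : V.adaptedAction Y = 0 := by
      ext g : 1
      exact Subtype.ext (h1.apply_folFun g)
    rw [h2]
    exact zero_mem _

/-! ### The isomorphism of the Lie algebras of vector fields -/

/-- The Lie algebra homomorphism from adapted vector fields to operators of order one. -/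
noncomputable def adaptedToOne : V.adapted →ₗ⁅ℝ⁆ V.diffOpOne where
  toFun Y := ⟨V.conjPull.symm (V.adaptedAction Y),
    V.conjPull_symm_mem_iff.2 (V.adaptedAction_mem Y)⟩
  map_add' Y Z := Subtype.ext (map_add V.conjPull.symm (V.adaptedAction Y) (V.adaptedAction Z))
  map_smul' r Y := Subtype.ext (map_smul V.conjPull.symm r (V.adaptedAction Y))
  map_lie' {Y Z} := by
    refine Subtype.ext (LinearMap.ext fun f => ?_)
    have h1 : V.conjPull.symm (V.adaptedAction Y) (V.conjPull.symm (V.adaptedAction Z) f)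
        = V.pullback.symm (V.adaptedAction Y (V.adaptedAction Z (V.pullback f))) := by
      simp only [V.conjPull_symm_apply, AlgEquiv.apply_symm_apply]
    have h2 : V.conjPull.symm (V.adaptedAction Z) (V.conjPull.symm (V.adaptedAction Y) f)
        = V.pullback.symm (V.adaptedAction Z (V.adaptedAction Y (V.pullback f))) := by
      simp only [V.conjPull_symm_apply, AlgEquiv.apply_symm_apply]
    show V.conjPull.symm (V.adaptedAction ⁅Y, Z⁆) f
      = V.conjPull.symm (V.adaptedAction Y) (V.conjPull.symm (V.adaptedAction Z) f)
        - V.conjPull.symm (V.adaptedAction Z) (V.conjPull.symm (V.adaptedAction Y) f)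
    rw [h1, h2, ← map_sub]
    rfl

theorem mk_eq_mk_iff {D E : V.diffOpOne} :
    (LieSubmodule.Quotient.mk D : V.Vect) = LieSubmodule.Quotient.mk E
      ↔ (D : Module.End ℝ V.smooth) - E ∈ V.diffOp 0 :=
  Submodule.Quotient.eq _

/-- The symbol of the operator given by an adapted vector field. -/
noncomputable def adaptedSymbol : V.adapted →ₗ[ℝ] V.Vect where
  toFun Y := LieSubmodule.Quotient.mk (V.adaptedToOne Y)
  map_add' Y Z := by rw [map_add]; rfl
  map_smul' r Y := by rw [map_smul]; rfl

theorem ker_adaptedSymbol [T2Space X] :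
    V.tangentIdeal.toSubmodule = LinearMap.ker V.adaptedSymbol := by
  ext Y
  refine (V.adaptedAction_mem_zero_iff Y).symm.trans (V.conjPull_symm_mem_iff.symm.trans ?_)
  exact (Submodule.Quotient.mk_eq_zero V.diffOpZero.toSubmodule (x := V.adaptedToOne Y)).symm

theorem adaptedSymbol_surjective [T2Space X] : Function.Surjective V.adaptedSymbol := by
  intro v
  obtain ⟨D, rfl⟩ := Submodule.Quotient.mk_surjective _ v
  obtain ⟨Y, hY⟩ := V.exists_adapted_symbol D.2
  exact ⟨Y, (V.mk_eq_mk_iff (E := V.adaptedToOne Y) |>.2 hY).symm⟩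

/-- The linear isomorphism `Vect(Ṽ, F) ≅ Vect(V)`. -/
noncomputable def folVectEquiv [T2Space X] : V.FolVect ≃ₗ[ℝ] V.Vect :=
  (Submodule.quotEquivOfEq _ _ V.ker_adaptedSymbol).trans
    (V.adaptedSymbol.quotKerEquivOfSurjective V.adaptedSymbol_surjective)

theorem folVectEquiv_mk [T2Space X] (Y : V.adapted) :
    V.folVectEquiv (LieSubmodule.Quotient.mk Y) = LieSubmodule.Quotient.mk (V.adaptedToOne Y) :=
  rfl

/-- The Lie algebra isomorphism `Vect(Ṽ, F) ≅ Vect(V)`. -/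
noncomputable def folVectLieEquiv [T2Space X] : V.FolVect ≃ₗ⁅ℝ⁆ V.Vect :=
  { V.folVectEquiv with
    map_lie' := by
      -- Brackets on both quotients are computed on representatives, where `adaptedToOne` is a Lie
      -- homomorphism.
      intro v w
      obtain ⟨Y, rfl⟩ := Submodule.Quotient.mk_surjective _ v
      obtain ⟨Z, rfl⟩ := Submodule.Quotient.mk_surjective _ w
      show (LieSubmodule.Quotient.mk (V.adaptedToOne ⁅Y, Z⁆) : V.Vect) = _
      rw [LieHom.map_lie]
      rfl }

end RiemannianOrbifold

end Orbifold

/-! ### Assembly of the isomorphisms -/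

theorem mainTheorem3 {n : ℕ} {X ι : Type*} [TopologicalSpace X] [T2Space X]
    [SecondCountableTopology X] (V : RiemannianOrbifold n X ι) :
    -- the isomorphism `p^* : C^∞(V) ≅ C^∞(Ṽ, F)`, `p^* f = f ∘ p`
    ∃ P : V.smooth ≃ₐ[ℝ] V.folFun,
      (∀ (f : V.smooth) (v : V.Resolution),
        ((P f : V.totSmooth) : V.Resolution → ℝ) v = (f : X → ℝ) (V.proj v)) ∧
      -- the isomorphism of operators of order `k`: conjugation `D ↦ p^* ∘ D ∘ (p^*)⁻¹`
      ∃ PD : ∀ k, V.diffOp k ≃ₗ[ℝ] V.folDiffOp k,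
        (∀ k (D : V.diffOp k), (PD k D).1 = P.toLinearEquiv.conj D.1) ∧
        -- conjugation is a Lie algebra isomorphism of the algebras of all operators
        (∃ PL : V.diffOps ≃ₗ⁅ℝ⁆ V.folDiffOps, ∀ D : V.diffOps,
          (PL D).1 = P.toLinearEquiv.conj D.1) ∧
        -- the induced isomorphism of symbols `[D] ↦ [p_D^* D]`
        ∃ PS : ∀ k, V.Symbols k ≃ₗ[ℝ] V.FolSymbols k,
          (∀ k (D : V.diffOp k),
            PS k (Submodule.Quotient.mk D) = Submodule.Quotient.mk (PD k D)) ∧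
          -- the induced Lie algebra isomorphism of vector fields: in degree one it is `PS 1`,
          -- a foliated vector field being identified with the symbol of its action on
          -- foliated functions
          ∃ PV : V.Vect ≃ₗ⁅ℝ⁆ V.FolVect, ∀ (D : V.diffOpOne) (Y : V.adapted),
            PV (LieSubmodule.Quotient.mk D) = LieSubmodule.Quotient.mk Y ↔
              ∃ hY : V.adaptedAction Y ∈ V.folDiffOp 1,
                PS 1 (Submodule.Quotient.mk ⟨D, D.2⟩)
                  = Submodule.Quotient.mk ⟨V.adaptedAction Y, hY⟩ := by
  refine ⟨V.pullback, fun f v => rfl, V.diffOpEquiv, fun k D => rfl,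
    ⟨V.diffOpsEquiv, fun D => rfl⟩, V.symbolsEquiv, fun k D => rfl,
    V.folVectLieEquiv.symm, fun D Y => ?_⟩
  -- Both sides of the equivalence say that `D` and the action of `Y`, compared through conjugation,
  -- differ by an operator of order zero.
  have h1 : V.folVectLieEquiv.symm (LieSubmodule.Quotient.mk D) = LieSubmodule.Quotient.mk Y
      ↔ (D : Module.End ℝ V.smooth) - V.conjPull.symm (V.adaptedAction Y) ∈ V.diffOp 0 := by
    refine Iff.trans ?_ (V.mk_eq_mk_iff (E := V.adaptedToOne Y))
    constructor
    · intro h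
      rw [← V.folVectEquiv_mk, ← h]
      exact (V.folVectEquiv.apply_symm_apply _).symm
    · intro h
      rw [h, ← V.folVectEquiv_mk]
      exact V.folVectEquiv.symm_apply_apply _
  have h2 : (D : Module.End ℝ V.smooth) - V.conjPull.symm (V.adaptedAction Y) ∈ V.diffOp 0
      ↔ V.conjPull D - V.adaptedAction Y ∈ V.folDiffOp 0 := by
    rw [← V.conjPull_mem_iff, map_sub, LinearEquiv.apply_symm_apply]
  rw [h1, h2]
  constructor
  · intro h
    exact ⟨V.adaptedAction_mem Y, (Submodule.Quotient.eq _).2 h⟩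
  · rintro ⟨hY, h⟩
    exact (Submodule.Quotient.eq (V.lowerFolOp 1)).1 h
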